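/- Conventions. $\mathcal H$ is the upper half-plane, $q=e^{2\pi i z}$, $f'=\frac1{2\pi i}\frac{df}{dz}$ and $\partial_k f=f'-\frac k{12}E_2f$. $E_2,E_4,E_6$ are the normalized Eisenstein series ($E_2=1-24\sum\sigma_1(n)q^n$, $E_4=1+240\sum\sigma_3(n)q^n$, $E_6=1-504\sum\sigma_5(n)q^n$). Put $H_2=\Theta_2^4$, $H_4=\Theta_4^4$ with $\Theta_2(z)=\sum_{n\in\mathbb Z}e^{\pi i(n+1/2)^2z}$ and $\Theta_4(z)=\sum_{n\in\mathbb Z}(-1)^ne^{\pi i n^2z}$. A quasimodular form of weight $w$, depth (at most) $s$ and level $\Gamma$ is a holomorphic $f:\mathcal H\to\mathbb C$ for which there are holomorphic $F_0,\dots,F_s$ with $$(cz+d)^{-w}f\Big(\frac{az+b}{cz+d}\Big)=\sum_{r=0}^sF_r(z)\Big(\frac c{cz+d}\Big)^r\qquad\text{for all }\begin{pmatrix}a&b\\c&d\end{pmatrix}\in\Gamma,$$ such that every slash translate $F_r|_{w-2r}\gamma$, $\gamma\in\mathrm{SL}_2(\mathbb Z)$, is bounded as $\Im z\to\infty$. The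 form $f$ is positive if $f(it)$ is real and $\ge 0$ for all $t>0$. A level-one quasimodular form of weight $w$ and depth (at most) $s$ is normalized extremal if, for some $n$, it equals $q^n+O(q^{n+1})$ and no nonzero level-one quasimodular form of weight $w$ and depth at most $s$ vanishes at $i\infty$ to order greater than $n$. Let $$F=49E_2^2E_4^3-25E_2^2E_6^2-48E_2E_4^2E_6-25E_4^4+49E_4E_6^2,\qquad G=H_2^5(2H_2^2+7H_2H_4+7H_4^2),$$ $A=H_2^2$, $B=H_2+2H_4$, and $L=K_{10}E_2^2+K_{12}E_2+K_{14}$, where $$K_{10}=-2(23H_2^4+46H_2^3H_4+54H_2^2H_4^2+16H_2H_4^3+8H_4^4)(H_2+2H_4),$$ $$K_{12}=-2(10H_2^4+35H_2^3H_4+3H_2^2H_4^2-64H_2H_4^3-32H_4^4)(H_2^2+H_2H_4+H_4^2),$$ $$K_{14}=(26H_2^6+78H_2^5H_4+177H_2^4H_4^2+182H_2^3H_4^3+51H_2^2H_4^4-48H_2H_4^5-16H_4^6)(H_2+2H_4).$$ Let $$X_{8,2}=\tfrac{-7E_2^2E_4+2E_2E_6+5E_4^2}{362880},\qquad X_{10,2}=\tfrac{5E_2^2E_6+2E_2E_4^2-7E_4E_6}{1088640},\qquad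 X_{12,2}=\tfrac{-77E_2^2E_4^2+34E_2E_4E_6+50E_4^3-7E_6^2}{798336000},$$ and, for $w\in\{8,10,12\}$, $X_{w,2}^{[2]}(z)=X_{w,2}(2z)$ and $\widetilde X_{w,2}=X_{w,2}-2^{w-1}X_{w,2}^{[2]}$. Then: (1) $F$ is a quasimodular form of weight $16$, depth $2$ and level $\mathrm{SL}_2(\mathbb Z)$; $G$ is a modular form of weight $14$ and level $\Gamma(2)$; $K_w$ is a modular form of weight $w$ and level $\Gamma_0(2)$ for $w=10,12,14$; $L$ is a quasimodular form of weight $14$, depth $2$ and level $\Gamma(2)$; for $w=8,10,12$, $X_{w,2}$ is the normalized extremal quasimodular form of weight $w$ and depth $2$, and $\widetilde X_{w,2}$ is a positive quasimodular form of weight $w$, depth $2$ and level $\Gamma_0(2)$. (2) $F'G-FG'=(\partial_{14}F)G-F(\partial_{14}G)=\frac{105}{8}H_2^5H_4^2(H_2+H_4)^2L.$ (3) $$L=78278400\,X_{8,2}^{[2]}AB+550800\,\widetilde X_{8,2}AB+90823680\,X_{10,2}^{[2]}A+116640\,\widetilde X_{10,2}A+678813696000\,X_{12,2}^{[2]}B+331776000\,\widetilde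 X_{12,2}B.$$ (4) For every $t>0$ the numbers $A(it)$, $B(it)$, $X_{8,2}(2it)$, $X_{10,2}(2it)$, $X_{12,2}(2it)$, $L(it)$ and $(F'G-FG')(it)$ are real and strictly positive. (5) For every $t>0$, $F(it)$ is real and $G(it)$ is real and strictly positive; the function $t\mapsto F(it)/G(it)$ is strictly decreasing on $(0,\infty)$ and tends to $432/\pi^2$ as $t\to0^+$; consequently $$F(it)<\frac{432}{\pi^2}\,G(it)\qquad\text{for all }t>0.$$ -/

import Mathlib

open scoped UpperHalfPlane MatrixGroups ModularForm Manifold Topology ComplexOrder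

namespace LeechIneq

noncomputable section

/-! ### Modular and quasimodular forms -/

/-- `f` is (the underlying function of) a modular form of weight `k` and level `Γ`. -/
def IsModular (Γ : Subgroup SL(2, ℤ)) (k : ℤ) (f : ℍ → ℂ) : Prop :=
  ∃ g : ModularForm (Γ : Subgroup (GL (Fin 2) ℝ)) k, (g : ℍ → ℂ) = f

/-- `f` is a quasimodular form of weight `w`, depth (at most) `s` and level `Γ`: it is holomorphic
and there are holomorphic `F 0, …, F s` such that, for `γ = (a b; c d)` in `Γ`,
`(f ∣[w] γ) z = ∑ r ≤ s, F r z * (c / (c z + d)) ^ r`.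
The boundedness of the slash translates of the `F r` (which have weight `w - 2 r`) is the usual
analytic condition at the cusps. -/
def IsQuasimodular (Γ : Subgroup SL(2, ℤ)) (w : ℤ) (s : ℕ) (f : ℍ → ℂ) : Prop :=
  MDiff f ∧
  ∃ F : Fin (s + 1) → ℍ → ℂ,
    (∀ r, MDiff (F r)) ∧
    (∀ r : Fin (s + 1), ∀ γ : SL(2, ℤ),
      UpperHalfPlane.IsBoundedAtImInfty (F r ∣[w - 2 * ((r : ℕ) : ℤ)] γ)) ∧
    ∀ γ ∈ Γ, ∀ z : ℍ, (f ∣[w] γ) z =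
      ∑ r : Fin (s + 1),
        F r z * (((γ 1 0 : ℤ) : ℂ) / (((γ 1 0 : ℤ) : ℂ) * (z : ℂ) + ((γ 1 1 : ℤ) : ℂ))) ^ (r : ℕ)

/-- The value `f (i t)`, for `t > 0`. -/
def onAxis (f : ℍ → ℂ) (t : ℝ) : ℂ := f (UpperHalfPlane.ofComplex (t * Complex.I))

/-- Positive quasimodular forms take real nonnegative values on the positive imaginary axis.
(In the order on `ℂ` used here, `0 ≤ c` says that `c` is real and nonnegative.) -/
def IsPositive (f : ℍ → ℂ) : Prop := ∀ t : ℝ, 0 < t → 0 ≤ onAxis f t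

/-- Strict version: `f (i t)` is real and strictly positive for all `t > 0`. -/
def IsPosOnAxis (f : ℍ → ℂ) : Prop := ∀ t : ℝ, 0 < t → 0 < onAxis f t

/-- `q ^ n` for the nome `q = exp (2 π i z)`. -/
def qPow (n : ℕ) (z : ℍ) : ℂ := Complex.exp (2 * Real.pi * Complex.I * (z : ℂ)) ^ n

/-- `f` is the normalized extremal quasimodular form of weight `w`, depth `s` and level one: for
some `n`, it is `q ^ n + O(q ^ (n + 1))`, and no nonzero quasimodular form of weight `w`, depth at
most `s` and level one vanishes at infinity to an order greater than `n`. -/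
def IsNormalizedExtremal (w : ℤ) (s : ℕ) (f : ℍ → ℂ) : Prop :=
  IsQuasimodular ⊤ w s f ∧
  ∃ n : ℕ,
    Filter.Tendsto (fun z => f z / qPow n z) UpperHalfPlane.atImInfty (𝓝 1) ∧
    ∀ g : ℍ → ℂ, IsQuasimodular ⊤ w s g →
      Filter.Tendsto (fun z => g z / qPow n z) UpperHalfPlane.atImInfty (𝓝 0) → g = 0

/-- The point `2 z`. -/
def double (z : ℍ) : ℍ := ⟨2 * (z : ℂ), by simpa using z.im_pos⟩

/-- `f ^ [2]`, i.e. `z ↦ f (2 z)`. -/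
def level2 (f : ℍ → ℂ) : ℍ → ℂ := fun z => f (double z)

/-! ### The forms -/

/-- Eisenstein series `E₂ = 1 - 24 ∑ σ₁(n) q ^ n`. -/
abbrev E₂ : ℍ → ℂ := EisensteinSeries.E2

/-- Eisenstein series `E₄ = 1 + 240 ∑ σ₃(n) q ^ n`. -/
abbrev E₄ : ℍ → ℂ := ModularForm.E₄

/-- Eisenstein series `E₆ = 1 - 504 ∑ σ₅(n) q ^ n`. -/
abbrev E₆ : ℍ → ℂ := ModularForm.E₆

/-- The theta function `Θ₂`. -/
def Θ₂ (z : ℍ) : ℂ :=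
  ∑' n : ℤ, Complex.exp (Real.pi * Complex.I * ((n : ℂ) + 1 / 2) ^ 2 * (z : ℂ))

/-- The theta function `Θ₄`. -/
def Θ₄ (z : ℍ) : ℂ :=
  ∑' n : ℤ, (-1 : ℂ) ^ n * Complex.exp (Real.pi * Complex.I * (n : ℂ) ^ 2 * (z : ℂ))

def H₂ : ℍ → ℂ := Θ₂ ^ 4

def H₄ : ℍ → ℂ := Θ₄ ^ 4

def F : ℍ → ℂ :=
  49 * E₂ ^ 2 * E₄ ^ 3 - 25 * E₂ ^ 2 * E₆ ^ 2 - 48 * E₂ * E₄ ^ 2 * E₆ - 25 * E₄ ^ 4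
    + 49 * E₄ * E₆ ^ 2

def G : ℍ → ℂ := H₂ ^ 5 * (2 * H₂ ^ 2 + 7 * H₂ * H₄ + 7 * H₄ ^ 2)

def K₁₀ : ℍ → ℂ :=
  -2 * (23 * H₂ ^ 4 + 46 * H₂ ^ 3 * H₄ + 54 * H₂ ^ 2 * H₄ ^ 2 + 16 * H₂ * H₄ ^ 3 + 8 * H₄ ^ 4)
    * (H₂ + 2 * H₄)

def K₁₂ : ℍ → ℂ :=
  -2 * (10 * H₂ ^ 4 + 35 * H₂ ^ 3 * H₄ + 3 * H₂ ^ 2 * H₄ ^ 2 - 64 * H₂ * H₄ ^ 3 - 32 * H₄ ^ 4)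
    * (H₂ ^ 2 + H₂ * H₄ + H₄ ^ 2)

def K₁₄ : ℍ → ℂ :=
  (26 * H₂ ^ 6 + 78 * H₂ ^ 5 * H₄ + 177 * H₂ ^ 4 * H₄ ^ 2 + 182 * H₂ ^ 3 * H₄ ^ 3
    + 51 * H₂ ^ 2 * H₄ ^ 4 - 48 * H₂ * H₄ ^ 5 - 16 * H₄ ^ 6) * (H₂ + 2 * H₄)

def L : ℍ → ℂ := K₁₀ * E₂ ^ 2 + K₁₂ * E₂ + K₁₄

def A : ℍ → ℂ := H₂ ^ 2

def B : ℍ → ℂ := H₂ + 2 * H₄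

/-- Normalized extremal form of weight 8 and depth 2, `q ^ 2 + 16 q ^ 3 + ⋯`. -/
def X₈ : ℍ → ℂ :=
  (1 / 362880 : ℂ) • (-7 * E₂ ^ 2 * E₄ + 2 * E₂ * E₆ + 5 * E₄ ^ 2)

/-- Normalized extremal form of weight 10 and depth 2, `q ^ 2 + (104 / 3) q ^ 3 + ⋯`. -/
def X₁₀ : ℍ → ℂ :=
  (1 / 1088640 : ℂ) • (5 * E₂ ^ 2 * E₆ + 2 * E₂ * E₄ ^ 2 - 7 * E₄ * E₆)

/-- Normalized extremal form of weight 12 and depth 2, `q ^ 3 + (51 / 2) q ^ 4 + ⋯`. -/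
def X₁₂ : ℍ → ℂ :=
  (1 / 798336000 : ℂ) •
    (-77 * E₂ ^ 2 * E₄ ^ 2 + 34 * E₂ * E₄ * E₆ + 50 * E₄ ^ 3 - 7 * E₆ ^ 2)

/-- `X̃_{8,2}`. -/
def Xt₈ : ℍ → ℂ := X₈ - 2 ^ 7 * level2 X₈

/-- `X̃_{10,2}`. -/
def Xt₁₀ : ℍ → ℂ := X₁₀ - 2 ^ 9 * level2 X₁₀

/-- `X̃_{12,2}`. -/
def Xt₁₂ : ℍ → ℂ := X₁₂ - 2 ^ 11 * level2 X₁₂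

/-- The Wronskian-type form `F' G - F G'`, where `f' = (2 π i)⁻¹ df/dz`. -/
def wronskian : ℍ → ℂ :=
  Derivative.normalizedDerivOfComplex F * G - F * Derivative.normalizedDerivOfComplex G

end

end LeechIneq

open LeechIneq

/-!
The theorem reduces to polynomial identities in `E₂, H₂, H₄` and to inequalities between real
functions on the imaginary axis.

*Quasimodularity.* A polynomial of degree two in `E₂` with modular coefficients is quasimodular of
depth two (`isQuasimodular_of_poly`), and in level one every form of depth two arises in this way
(`IsQuasimodular.exists_poly`). As the spaces of level one modular forms of weight at most `12` are
spanned by monomials in `E₄` and `E₆`, extremality of `X₈, X₁₀, X₁₂` is a statement of linear algebra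
about the first coefficients of the monomials. `SL(2, ℤ)` acts on the span of `H₂` and `H₄` through
`SL(2, ℤ/2)` (`thetaVec_slash`), which gives the level of `G` and of the `K`'s, the latter being
polynomials in the `Γ₀(2)`-forms `A`, `B` and `h = H₄ (H₂ + H₄)`.

*Identities.* Ramanujan's identities hold because, once the terms with `E₂` are on the left, both sides
are level one forms of small weight with the same value at `i∞`; for the same reason `E₄` and `E₆` are polynomials in `H₂, H₄`, whose
derivatives follow (`D_theta`). Landen's transformation of theta functions expresses `H₄ (2 z) ^ 2` and
then, by logarithmic differentiation, `E₂ (2 z)` in terms of forms at `z` (`E₂_double`). After these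
substitutions the factorization of the Wronskian (`wronskian_eq`) and the formula for `L` (`L_eq`) are
checked by expansion.

*Positivity.* By `L_eq`, everything rests on the positivity of `X_w` and of `X_w(z) - 2^(w-1) X_w(2z)`
on the imaginary axis, where `D = -(2 π)⁻¹ d/dt`. A function that vanishes at infinity and has `D f ≥ 0`
is nonnegative, and more generally so is a solution of `D f = a f + g` with `g ≥ 0`, if it is small
compared with an integrating factor (`nonneg_of_hasDerivAt`). With a power of `h` or with `H₂` as
integrating factor this gives upper and lower bounds for `E₂` in terms of `B` and `h`, hence the
positivity of `P, Q, R`, the derivatives of `E₂, E₄, E₆` up to constants, and the comparison of their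
values at `t` and `2 t`. The derivatives of `X₈, X₁₀, X₁₂` are
`2 P Q`, `(8 P R + 10 Q ^ 2) / 9` and `3 Q X₈`. So all three forms are positive, and for weights `8` and
`12` the inequality between the values at `t` and `2 t` follows by integration as well. In weight `10`
it is an algebraic consequence of the bounds for `E₂` (`axisX₁₀_two_mul_le`).

*Monotonicity and limit.* The derivative of `F / G` along the axis is a negative multiple of the
Wronskian. The limit at `0` is computed by `z ↦ -1 / z`: in `z ^ 2 F + κ z F₁ + κ ^ 2 F₂` with
`κ = 6 / (π i)` the first two terms decay exponentially at `i∞`, while `F₂` tends to `24` and the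
transform of `G` to `2` up to the sign and the power of `z` (`tendsto_onAxis_F_div_G`). As the quotient
is strictly decreasing, it stays below its limit.
-/

namespace LeechIneq

open UpperHalfPlane hiding I
open Filter Complex Derivative
open scoped Real

/-! ### Modular forms as functions -/

/-- `f` is holomorphic, invariant under the weight `k` action of `Γ`, and all of its translates
under `SL(2, ℤ)` are bounded at `i∞`. For `Γ` of finite index this says that `f` is a modular form,
see `IsMF.isModular`; the unbundled version is convenient for polynomial expressions. -/
structure IsMF (Γ : Subgroup SL(2, ℤ)) (k : ℤ) (f : ℍ → ℂ) : Prop where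
  mdiff : MDiff f
  slash : ∀ γ ∈ Γ, f ∣[k] γ = f
  bdd : ∀ γ : SL(2, ℤ), IsBoundedAtImInfty (f ∣[k] γ)

namespace IsMF

variable {Γ : Subgroup SL(2, ℤ)} {k l : ℤ} {f g : ℍ → ℂ}

lemma mono {Γ' : Subgroup SL(2, ℤ)} (hf : IsMF Γ k f) (h : Γ' ≤ Γ) : IsMF Γ' k f :=
  ⟨hf.mdiff, fun γ hγ ↦ hf.slash γ (h hγ), hf.bdd⟩

lemma add (hf : IsMF Γ k f) (hg : IsMF Γ k g) : IsMF Γ k (f + g) where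
  mdiff := hf.mdiff.add hg.mdiff
  slash γ hγ := by rw [SlashAction.add_slash, hf.slash γ hγ, hg.slash γ hγ]
  bdd γ := by
    rw [SlashAction.add_slash]
    exact (hf.bdd γ).add (hg.bdd γ)

lemma smul (hf : IsMF Γ k f) (c : ℂ) : IsMF Γ k (c • f) where
  mdiff := hf.mdiff.const_smul c
  slash γ hγ := by rw [ModularForm.SL_smul_slash, hf.slash γ hγ]
  bdd γ := by
    rw [ModularForm.SL_smul_slash]
    exact (const_boundedAtFilter _ c).mul (hf.bdd γ)

lemma sub (hf : IsMF Γ k f) (hg : IsMF Γ k g) : IsMF Γ k (f - g) := by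
  simpa [sub_eq_add_neg] using hf.add (hg.smul (-1))

lemma mul (hf : IsMF Γ k f) (hg : IsMF Γ l g) : IsMF Γ (k + l) (f * g) where
  mdiff := hf.mdiff.mul hg.mdiff
  slash γ hγ := by rw [ModularForm.mul_slash_SL2, hf.slash γ hγ, hg.slash γ hγ]
  bdd γ := by
    rw [ModularForm.mul_slash_SL2]
    exact (hf.bdd γ).mul (hg.bdd γ)

lemma one : IsMF Γ 0 1 where
  mdiff := mdifferentiable_const
  slash γ _ := ModularForm.is_invariant_one γ
  bdd γ := by
    rw [ModularForm.is_invariant_one γ]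
    exact const_boundedAtFilter _ 1

lemma pow (hf : IsMF Γ k f) (n : ℕ) : IsMF Γ (n * k) (f ^ n) := by
  induction n with
  | zero => simpa using one
  | succ n ih =>
    rw [pow_succ]
    convert ih.mul hf using 1
    push_cast
    ring

/-- Transport along an equality of weights and of functions. -/
lemma congr (hf : IsMF Γ k f) (hk : k = l) (h : f = g) : IsMF Γ l g := hk ▸ h ▸ hf

lemma isModular [Γ.FiniteIndex] (hf : IsMF Γ k f) : IsModular Γ k f :=
  ⟨{ toFun := f
     slash_action_eq' := by
       rintro _ ⟨γ, hγ, rfl⟩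
       exact hf.slash γ hγ
     holo' := hf.mdiff
     bdd_at_cusps' := fun {c} hc ↦ by
       rw [Subgroup.IsArithmetic.isCusp_iff_isCusp_SL2Z] at hc
       rw [OnePoint.isBoundedAt_iff_forall_SL2Z hc]
       exact fun γ _ ↦ hf.bdd γ }, rfl⟩

/-- The bundled level one form attached to `f`. -/
noncomputable def toLevelOne (hf : IsMF ⊤ k f) : ModularForm 𝒮ℒ k where
  toFun := f
  slash_action_eq' := by
    rintro _ ⟨γ, rfl⟩
    exact hf.slash γ trivial
  holo' := hf.mdiff
  bdd_at_cusps' := fun {c} hc ↦ by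
    rw [OnePoint.isBoundedAt_iff_forall_SL2Z hc]
    exact fun γ _ ↦ hf.bdd γ

lemma of_levelOne (f : ModularForm 𝒮ℒ k) : IsMF ⊤ k f := by
  have h (γ : SL(2, ℤ)) : (f : ℍ → ℂ) ∣[k] γ = f := f.slash_action_eq' _ ⟨γ, rfl⟩
  refine ⟨f.holo', fun γ _ ↦ h γ, fun γ ↦ ?_⟩
  rw [h]
  exact ModularFormClass.bdd_at_infty f

lemma isBoundedAtImInfty (hf : IsMF Γ k f) : IsBoundedAtImInfty f := by
  simpa using hf.bdd 1

/-- Invariance under the two generators of `SL(2, ℤ)` suffices in level one. -/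
lemma of_generators (hd : MDiff f) (hb : IsBoundedAtImInfty f)
    (hS : f ∣[k] ModularGroup.S = f) (hT : f ∣[k] ModularGroup.T = f) : IsMF ⊤ k f := by
  have h := SlashInvariantForm.slash_action_generators_SL2Z hS hT
  exact ⟨hd, fun γ _ ↦ h γ, fun γ ↦ by rwa [h]⟩

lemma periodic (hf : IsMF ⊤ k f) : Function.Periodic (f ∘ ofComplex) (1 : ℝ) :=
  SlashInvariantFormClass.periodic_comp_ofComplex hf.toLevelOne one_mem_strictPeriods_SL

/-- A level one form of weight less than `12` that vanishes at `i∞` is zero. -/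
lemma eq_zero_of_lt_twelve (hf : IsMF ⊤ k f) (hk : k < 12)
    (h0 : Tendsto f atImInfty (𝓝 0)) : f = 0 := by
  have hc : (qExpansion 1 hf.toLevelOne).coeff 0 = 0 := by
    rw [qExpansion_coeff_zero one_pos
      (ModularFormClass.analyticAt_cuspFunction_zero _ one_pos one_mem_strictPeriods_SL)
      hf.periodic]
    exact h0.limUnder_eq
  have := rank_zero_iff_forall_zero.mp (CuspForm.rank_eq_zero_of_weight_lt_twelve hk)
    (hf.toLevelOne.toCuspForm hc)
  ext z
  exact DFunLike.congr_fun this z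

/-- A level one form of weight less than `12` is determined by its value at `i∞`. -/
lemma eq_of_tendsto (hf : IsMF ⊤ k f) (hg : IsMF ⊤ k g) (hk : k < 12) {c : ℂ}
    (hfc : Tendsto f atImInfty (𝓝 c)) (hgc : Tendsto g atImInfty (𝓝 c)) : f = g :=
  sub_eq_zero.mp <| (hf.sub hg).eq_zero_of_lt_twelve hk
    (by simpa only [sub_self] using! hfc.sub hgc)

end IsMF

lemma isMF_E₄ : IsMF ⊤ 4 E₄ := .of_levelOne ModularForm.E₄

lemma isMF_E₆ : IsMF ⊤ 6 E₆ := .of_levelOne ModularForm.E₆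

/-! ### Expansions in `q` -/

/-- `f` is holomorphic and bounded at `i∞` and has period `1`, so that it is given by a convergent
power series in `q = exp (2 π i z)`. -/
structure HasQExp (f : ℍ → ℂ) : Prop where
  mdiff : MDiff f
  periodic : Function.Periodic (f ∘ ofComplex) (1 : ℝ)
  bdd : IsBoundedAtImInfty f

lemma IsMF.hasQExp {k : ℤ} {f : ℍ → ℂ} (hf : IsMF ⊤ k f) : HasQExp f :=
  ⟨hf.mdiff, hf.periodic, hf.isBoundedAtImInfty⟩

namespace HasQExp

variable {f g : ℍ → ℂ}

lemma analyticAt (hf : HasQExp f) : AnalyticAt ℂ (cuspFunction 1 f) 0 :=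
  analyticAt_cuspFunction_zero one_pos hf.periodic hf.mdiff hf.bdd

lemma cuspFunction_qParam (hf : HasQExp f) (z : ℍ) :
    cuspFunction 1 f (Function.Periodic.qParam 1 z) = f z :=
  eq_cuspFunction z one_ne_zero hf.periodic

lemma add (hf : HasQExp f) (hg : HasQExp g) : HasQExp (f + g) :=
  ⟨hf.mdiff.add hg.mdiff, hf.periodic.add hg.periodic, hf.bdd.add hg.bdd⟩

lemma mul (hf : HasQExp f) (hg : HasQExp g) : HasQExp (f * g) :=
  ⟨hf.mdiff.mul hg.mdiff, hf.periodic.mul hg.periodic, hf.bdd.mul hg.bdd⟩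

lemma const (c : ℂ) : HasQExp (Function.const ℍ c) :=
  ⟨mdifferentiable_const, fun _ ↦ rfl, const_boundedAtFilter _ c⟩

lemma smul (hf : HasQExp f) (c : ℂ) : HasQExp (c • f) := (const c).mul hf

lemma sub (hf : HasQExp f) (hg : HasQExp g) : HasQExp (f - g) := by
  simpa [sub_eq_add_neg] using hf.add (hg.smul (-1))

lemma pow (hf : HasQExp f) (n : ℕ) : HasQExp (f ^ n) := by
  induction n with
  | zero => exact const 1
  | succ n ih => exact pow_succ f n ▸ ih.mul hf

lemma tendsto (hf : HasQExp f) : Tendsto f atImInfty (𝓝 ((qExpansion 1 f).coeff 0)) := by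
  have := hf.analyticAt.continuousAt.tendsto.comp (qParam_tendsto_atImInfty one_pos)
  rw [qExpansion_coeff]
  simpa [Function.comp_def, hf.cuspFunction_qParam] using this

lemma of_hasSum {c : ℕ → ℂ} (hd : MDiff f)
    (h : ∀ z : ℍ, HasSum (fun m ↦ c m • Function.Periodic.qParam (1 : ℝ) z ^ m) (f z)) :
    HasQExp f := by
  refine ⟨hd, fun w ↦ ?_, isBoundedAtImInfty_of_hasSum_qExpansion one_pos h⟩
  by_cases hw : 0 < im w
  · have hw' : 0 < im (w + (1 : ℝ)) := by simpa using hw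
    simp only [Function.comp_apply, ofComplex_apply_of_im_pos hw', ofComplex_apply_of_im_pos hw]
    refine (h _).unique ?_
    convert h ⟨w, hw⟩ using 4
    simp [Function.Periodic.qParam, mul_add, exp_add]
  · have hw' : im (w + (1 : ℝ)) ≤ 0 := by simpa using hw
    simp only [Function.comp_apply, ofComplex_apply_of_im_nonpos hw',
      ofComplex_apply_of_im_nonpos (not_lt.mp hw)]

/-- In terms of `q`, the operator `D` is `q d/dq`. -/
lemma normalizedDeriv_eq (hf : HasQExp f) (z : ℍ) :
    D f z = Function.Periodic.qParam 1 z *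
      deriv (cuspFunction 1 f) (Function.Periodic.qParam 1 z) := by
  have hq : HasDerivAt (fun w : ℂ ↦ Function.Periodic.qParam 1 w)
      (2 * π * I * Function.Periodic.qParam 1 z) z := by
    have : HasDerivAt (fun w : ℂ ↦ 2 * π * I * w) (2 * π * I) z := by
      simpa using (hasDerivAt_id (z : ℂ)).const_mul (2 * π * I)
    simpa [Function.Periodic.qParam, mul_comm] using this.cexp
  have hΦ := (differentiableAt_cuspFunction one_pos hf.periodic hf.mdiff hf.bdd
    (Function.Periodic.norm_qParam_lt_one one_pos z.im_pos)).hasDerivAt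
  have hc := hΦ.comp (z : ℂ) hq
  have hev : f ∘ ofComplex =ᶠ[𝓝 (z : ℂ)] cuspFunction 1 f ∘ Function.Periodic.qParam 1 := by
    filter_upwards [isOpen_upperHalfPlaneSet.mem_nhds z.im_pos] with w hw
    have := hf.cuspFunction_qParam ⟨w, hw⟩
    simpa [ofComplex_apply_of_im_pos hw] using this.symm
  rw [normalizedDerivOfComplex, hev.deriv_eq, hc.deriv]
  have : (π : ℂ) ≠ 0 := mod_cast Real.pi_ne_zero
  field_simp [I_ne_zero]

/-- The derivative of a power series in `q` vanishes at `i∞`. -/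
lemma tendsto_normalizedDeriv (hf : HasQExp f) : Tendsto (D f) atImInfty (𝓝 0) := by
  have hd : ContinuousAt (fun q ↦ q * deriv (cuspFunction 1 f) q) 0 :=
    continuousAt_id.mul hf.analyticAt.deriv.continuousAt
  have := hd.tendsto.comp (qParam_tendsto_atImInfty one_pos)
  simp only [zero_mul] at this
  exact this.congr fun z ↦ (hf.normalizedDeriv_eq z).symm

end HasQExp

lemma IsMF.exists_tendsto {k : ℤ} {f : ℍ → ℂ} (hf : IsMF ⊤ k f) :
    ∃ c, Tendsto f atImInfty (𝓝 c) :=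
  ⟨_, hf.hasQExp.tendsto⟩

/-! ### Quasimodular forms as polynomials in `E₂` -/

/-- The constant `6 / (π i)` in the transformation law of `E₂`. -/
noncomputable def κ : ℂ := 6 / (π * I)

lemma κ_ne_zero : κ ≠ 0 := by
  have : (π : ℂ) ≠ 0 := mod_cast Real.pi_ne_zero
  simp [κ, this]

/-- The function `c / (c z + d)` attached to a matrix with lower row `(c, d)`. -/
noncomputable def cocycle (γ : SL(2, ℤ)) (z : ℍ) : ℂ :=
  ((γ 1 0 : ℤ) : ℂ) / (((γ 1 0 : ℤ) : ℂ) * (z : ℂ) + ((γ 1 1 : ℤ) : ℂ))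

lemma slash_apply' (f : ℍ → ℂ) (k : ℤ) (γ : SL(2, ℤ)) (z : ℍ) :
    (f ∣[k] γ) z =
      f (γ • z) * (((γ 1 0 : ℤ) : ℂ) * (z : ℂ) + ((γ 1 1 : ℤ) : ℂ)) ^ (-k) := by
  rw [ModularForm.SL_slash_apply, ModularGroup.denom_apply]

lemma denom_ne (γ : SL(2, ℤ)) (z : ℍ) :
    ((γ 1 0 : ℤ) : ℂ) * (z : ℂ) + ((γ 1 1 : ℤ) : ℂ) ≠ 0 := by
  rw [← ModularGroup.denom_apply]
  exact denom_ne_zero _ z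

lemma E₂_slash (γ : SL(2, ℤ)) (z : ℍ) : (E₂ ∣[(2 : ℤ)] γ) z = E₂ z + κ * cocycle γ z := by
  rw [EisensteinSeries.E2_slash_action]
  have : (π : ℂ) ≠ 0 := mod_cast Real.pi_ne_zero
  simp only [Pi.sub_apply, Pi.smul_apply, EisensteinSeries.D2, ModularGroup.denom_apply,
    smul_eq_mul, κ, cocycle, riemannZeta_two, sub_eq_add_neg]
  congr 1
  have := denom_ne γ z
  field_simp
  rw [I_sq]
  ring

lemma isBoundedAtImInfty_cocycle (γ : SL(2, ℤ)) : IsBoundedAtImInfty (cocycle γ) := by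
  rw [isBoundedAtImInfty_iff]
  refine ⟨1, 1, fun z hz ↦ ?_⟩
  rcases eq_or_ne (γ 1 0) 0 with hc | hc
  · simp [cocycle, hc]
  have hc' : (0 : ℝ) < |((γ 1 0 : ℤ) : ℝ)| := abs_pos.mpr (mod_cast hc)
  have him := Complex.abs_im_le_norm (((γ 1 0 : ℤ) : ℂ) * (z : ℂ) + ((γ 1 1 : ℤ) : ℂ))
  have : (((γ 1 0 : ℤ) : ℂ) * (z : ℂ) + ((γ 1 1 : ℤ) : ℂ)).im = ((γ 1 0 : ℤ) : ℝ) * z.im := by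
    simp
  rw [this, abs_mul, abs_of_pos z.im_pos] at him
  rw [cocycle, norm_div, Complex.norm_intCast]
  rw [div_le_one (lt_of_lt_of_le (mul_pos hc' z.im_pos) him)]
  nlinarith

/-- All translates of `E₂` are bounded at `i∞`; the trivial group imposes no invariance. -/
lemma isMF_bot_E₂ : IsMF ⊥ 2 E₂ where
  mdiff := E2_mdifferentiable
  slash γ hγ := by rw [Subgroup.mem_bot.mp hγ, SlashAction.slash_one]
  bdd γ := by
    have : E₂ ∣[(2 : ℤ)] γ = E₂ + (fun _ ↦ κ) * cocycle γ := funext (E₂_slash γ)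
    rw [this]
    exact EisensteinSeries.isBoundedAtImInfty_E2.add
      ((const_boundedAtFilter _ κ).mul (isBoundedAtImInfty_cocycle γ))

/-- A polynomial of degree two in `E₂` with modular coefficients is quasimodular; its components are
found by expanding `E₂_slash`. -/
lemma isQuasimodular_of_poly {Γ : Subgroup SL(2, ℤ)} {w : ℤ} {a b c : ℍ → ℂ}
    (hc : IsMF Γ (w - 4) c) (hb : IsMF Γ (w - 2) b) (ha : IsMF Γ w a) :
    IsQuasimodular Γ w 2 (c * E₂ ^ 2 + b * E₂ + a) := by
  have hc' := hc.mono (bot_le (a := Γ))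
  have hb' := hb.mono (bot_le (a := Γ))
  have h0 : IsMF ⊥ w (c * E₂ ^ 2 + b * E₂ + a) :=
    (((hc'.mul (isMF_bot_E₂.pow 2)).congr (by push_cast; ring) rfl).add
      ((hb'.mul isMF_bot_E₂).congr (by ring) rfl)).add (ha.mono bot_le)
  have h1 : IsMF ⊥ (w - 2) (κ • ((2 : ℂ) • (c * E₂) + b)) :=
    (((hc'.mul isMF_bot_E₂).congr (by ring) rfl).smul 2 |>.add hb').smul κ
  have h2 : IsMF ⊥ (w - 4) (κ ^ 2 • c) := hc'.smul _
  refine ⟨h0.mdiff, ![c * E₂ ^ 2 + b * E₂ + a, κ • ((2 : ℂ) • (c * E₂) + b), κ ^ 2 • c],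
    ?_, ?_, ?_⟩
  · intro r
    fin_cases r
    exacts [h0.mdiff, h1.mdiff, h2.mdiff]
  · intro r γ
    fin_cases r
    · simpa using h0.bdd γ
    · simpa using h1.bdd γ
    · simpa using h2.bdd γ
  · intro γ hγ z
    have e1 : (c * E₂ ^ 2) ∣[w] γ = c * (E₂ ∣[(2 : ℤ)] γ) ^ 2 := by
      rw [sq, sq, ← ModularForm.mul_slash_SL2]
      nth_rewrite 2 [← hc.slash γ hγ]
      rw [← ModularForm.mul_slash_SL2]
      congr 1
      ring
    have e2 : (b * E₂) ∣[w] γ = b * (E₂ ∣[(2 : ℤ)] γ) := by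
      have := ModularForm.mul_slash_SL2 (w - 2) 2 γ b E₂
      rw [hb.slash γ hγ] at this
      rw [← this]
      congr 1
      ring
    rw [SlashAction.add_slash, SlashAction.add_slash, e1, e2, ha.slash γ hγ]
    refine Eq.trans ?_ (Fin.sum_univ_three _).symm
    simp only [Pi.add_apply, Pi.mul_apply, Pi.pow_apply, E₂_slash, Matrix.cons_val, Pi.smul_apply,
      smul_eq_mul, ← cocycle.eq_def γ z, Fin.val_zero, Fin.val_one, Fin.val_two]
    ring

/-- The cocycle relation behind the composition of slash operators: `c / (c z + d)` is an additive
cocycle of weight two. -/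
lemma cocycle_mul (δ γ : SL(2, ℤ)) (z : ℍ) :
    cocycle (δ * γ) z = cocycle δ (γ • z) *
      ((((γ 1 0 : ℤ) : ℂ) * (z : ℂ) + ((γ 1 1 : ℤ) : ℂ)) ^ 2)⁻¹ + cocycle γ z := by
  have h := congrFun (EisensteinSeries.D2_mul δ γ) z
  have hpi : (2 * π * I : ℂ) ≠ 0 := two_pi_I_ne_zero
  simp only [Pi.add_apply, slash_apply', EisensteinSeries.D2, ModularGroup.denom_apply,
    mul_div_assoc] at h
  rw [mul_assoc (2 * π * I), ← mul_add] at h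
  have := mul_left_cancel₀ hpi h
  simpa [cocycle, zpow_neg] using! this

/-- A quadratic polynomial with three roots vanishes. -/
lemma quadratic_coeff_eq_zero {a b c t₁ t₂ : ℂ} (h₁ : t₁ ≠ 0) (h₂ : t₂ ≠ 0) (h : t₁ ≠ t₂)
    (e₀ : a = 0) (e₁ : a + b * t₁ + c * t₁ ^ 2 = 0) (e₂ : a + b * t₂ + c * t₂ ^ 2 = 0) :
    a = 0 ∧ b = 0 ∧ c = 0 := by
  have h12 : t₁ - t₂ ≠ 0 := sub_ne_zero.mpr h
  subst e₀
  have f₁ : b + c * t₁ = 0 := mul_right_cancel₀ h₁ (by linear_combination e₁)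
  have f₂ : b + c * t₂ = 0 := mul_right_cancel₀ h₂ (by linear_combination e₂)
  have hc : c = 0 := mul_right_cancel₀ h12 (by linear_combination f₁ - f₂)
  exact ⟨rfl, by simpa [hc] using f₁, hc⟩

/-- The components of a level one quasimodular form of depth two transform among themselves: compare
the expansions of `f ∣ (δ γ)` and `(f ∣ δ) ∣ γ` for `δ = 1, S, S T`. -/
lemma component_slash {w : ℤ} {f : ℍ → ℂ} {φ : Fin 3 → ℍ → ℂ}
    (h : ∀ γ : SL(2, ℤ), ∀ z : ℍ, (f ∣[w] γ) z = ∑ r : Fin 3, φ r z * cocycle γ z ^ (r : ℕ))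
    (γ : SL(2, ℤ)) (z : ℍ) :
    (φ 0 ∣[w] γ) z = φ 0 z + φ 1 z * cocycle γ z + φ 2 z * cocycle γ z ^ 2 ∧
    (φ 1 ∣[w - 2] γ) z = φ 1 z + 2 * φ 2 z * cocycle γ z ∧
    (φ 2 ∣[w - 4] γ) z = φ 2 z := by
  set j : ℂ := ((γ 1 0 : ℤ) : ℂ) * (z : ℂ) + ((γ 1 1 : ℤ) : ℂ) with hj
  have hj0 : j ≠ 0 := denom_ne γ z
  set X := cocycle γ z
  have key (δ : SL(2, ℤ)) :
      (φ 0 z + φ 1 z * X + φ 2 z * X ^ 2 - j ^ (-w) * φ 0 (γ • z)) +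
      (φ 1 z * (j ^ 2)⁻¹ + 2 * φ 2 z * X * (j ^ 2)⁻¹ - j ^ (-w) * φ 1 (γ • z)) *
        cocycle δ (γ • z) +
      (φ 2 z * (j ^ 2)⁻¹ ^ 2 - j ^ (-w) * φ 2 (γ • z)) * cocycle δ (γ • z) ^ 2 = 0 := by
    have h1 := h (δ * γ) z
    rw [SlashAction.slash_mul, slash_apply', h δ, cocycle_mul] at h1
    simp only [Fin.sum_univ_three, Fin.val_zero, Fin.val_one, Fin.val_two, pow_zero, pow_one,
      ← hj] at h1
    linear_combination -h1
  -- for fixed `γ` and `z` the relation `key` is a quadratic polynomial in `cocycle δ (γ z)`, which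
  -- takes the distinct values `0`, `1 / τ`, `1 / (τ + 1)` with `τ = γ z`
  have hτ := (γ • z).ne_zero
  have e10 : (ModularGroup.S * ModularGroup.T) 1 0 = 1 := by decide
  have e11 : (ModularGroup.S * ModularGroup.T) 1 1 = 1 := by decide
  have hτ1 : ((γ • z : ℍ) : ℂ) + 1 ≠ 0 := by
    simpa only [e10, e11, Int.cast_one, one_mul] using
      denom_ne (ModularGroup.S * ModularGroup.T) (γ • z)
  have c0 : cocycle 1 (γ • z) = 0 := by simp [cocycle]
  have c1 : cocycle ModularGroup.S (γ • z) = ((γ • z : ℍ) : ℂ)⁻¹ := by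
    simp [cocycle, ModularGroup.S]
  have c2 : cocycle (ModularGroup.S * ModularGroup.T) (γ • z) = (((γ • z : ℍ) : ℂ) + 1)⁻¹ := by
    rw [cocycle, e10, e11]
    simp
  have k0 := key 1
  have k1 := key ModularGroup.S
  have k2 := key (ModularGroup.S * ModularGroup.T)
  rw [c0] at k0
  rw [c1] at k1
  rw [c2] at k2
  obtain ⟨r0, r1, r2⟩ := quadratic_coeff_eq_zero (inv_ne_zero hτ) (inv_ne_zero hτ1)
    (fun he ↦ by simpa using inv_injective he) (by simpa using k0) k1 k2
  have p2 : j ^ (-(w - 2)) = j ^ (-w) * j ^ 2 := by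
    rw [show -(w - 2) = -w + 2 by ring, zpow_add₀ hj0]; rfl
  have p4 : j ^ (-(w - 4)) = j ^ (-w) * j ^ 4 := by
    rw [show -(w - 4) = -w + 4 by ring, zpow_add₀ hj0]; rfl
  refine ⟨?_, ?_, ?_⟩
  · rw [slash_apply', ← hj]
    linear_combination -r0
  · rw [slash_apply', ← hj, p2]
    field_simp at r1
    linear_combination -r1
  · rw [slash_apply', ← hj, p4]
    field_simp at r2
    linear_combination -r2

lemma sub_slash (k : ℤ) (γ : SL(2, ℤ)) (f g : ℍ → ℂ) :
    (f - g) ∣[k] γ = f ∣[k] γ - g ∣[k] γ := by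
  rw [sub_eq_add_neg, SlashAction.add_slash, SlashAction.neg_slash, ← sub_eq_add_neg]

/-- Level one quasimodular forms of depth two are polynomials in `E₂` with modular coefficients. The
coefficients are found by solving `φ₁ = κ (2 c E₂ + b)`, `φ₂ = κ ^ 2 c`, and their invariance
follows from `component_slash`. -/
lemma IsQuasimodular.exists_poly {w : ℤ} {f : ℍ → ℂ} (hf : IsQuasimodular ⊤ w 2 f) :
    ∃ a b c : ℍ → ℂ, IsMF ⊤ w a ∧ IsMF ⊤ (w - 2) b ∧ IsMF ⊤ (w - 4) c ∧
      f = c * E₂ ^ 2 + b * E₂ + a := by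
  obtain ⟨-, φ, hd, hb, h⟩ := hf
  replace h : ∀ γ : SL(2, ℤ), ∀ z : ℍ,
      (f ∣[w] γ) z = ∑ r : Fin 3, φ r z * cocycle γ z ^ (r : ℕ) := fun γ z ↦ h γ trivial z
  have hκ := κ_ne_zero
  have hf0 : f = φ 0 := by
    ext z
    simpa [Fin.sum_univ_three, cocycle] using h 1 z
  have h0 : IsMF ⊥ w (φ 0) :=
    ⟨hd 0, fun γ hγ ↦ by rw [Subgroup.mem_bot.mp hγ, SlashAction.slash_one],
      fun γ ↦ by simpa using hb 0 γ⟩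
  have h1 : IsMF ⊥ (w - 2) (φ 1) :=
    ⟨hd 1, fun γ hγ ↦ by rw [Subgroup.mem_bot.mp hγ, SlashAction.slash_one],
      fun γ ↦ by simpa using hb 1 γ⟩
  have h2 : IsMF ⊥ (w - 4) (φ 2) :=
    ⟨hd 2, fun γ hγ ↦ by rw [Subgroup.mem_bot.mp hγ, SlashAction.slash_one],
      fun γ ↦ by simpa using hb 2 γ⟩
  have h2E : IsMF ⊥ (w - 2) (φ 2 * E₂) := (h2.mul isMF_bot_E₂).congr (by ring) rfl
  have h1E : IsMF ⊥ w (φ 1 * E₂) := (h1.mul isMF_bot_E₂).congr (by ring) rfl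
  have h2EE : IsMF ⊥ w (φ 2 * E₂ * E₂) := (h2E.mul isMF_bot_E₂).congr (by ring) rfl
  have hb' : IsMF ⊥ (w - 2) (κ⁻¹ • φ 1 - (2 * κ⁻¹ ^ 2) • (φ 2 * E₂)) :=
    (h1.smul _).sub (h2E.smul _)
  have ha' : IsMF ⊥ w (φ 0 - κ⁻¹ • (φ 1 * E₂) + κ⁻¹ ^ 2 • (φ 2 * E₂ * E₂)) :=
    (h0.sub (h1E.smul _)).add (h2EE.smul _)
  refine ⟨_, _, κ⁻¹ ^ 2 • φ 2, ⟨ha'.mdiff, fun γ _ ↦ ?_, ha'.bdd⟩,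
    ⟨hb'.mdiff, fun γ _ ↦ ?_, hb'.bdd⟩, ⟨(h2.smul _).mdiff, fun γ _ ↦ ?_, (h2.smul _).bdd⟩, ?_⟩
  · ext z
    obtain ⟨t0, t1, t2⟩ := component_slash h γ z
    have m1 : (φ 1 * E₂) ∣[w] γ = (φ 1 ∣[w - 2] γ) * (E₂ ∣[(2 : ℤ)] γ) := by
      rw [← ModularForm.mul_slash_SL2, sub_add_cancel]
    have m2 : (φ 2 * E₂ * E₂) ∣[w] γ =
        (φ 2 ∣[w - 4] γ) * (E₂ ∣[(2 : ℤ)] γ) * (E₂ ∣[(2 : ℤ)] γ) := by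
      rw [← ModularForm.mul_slash_SL2, ← ModularForm.mul_slash_SL2]
      congr 1
      ring
    simp only [SlashAction.add_slash, sub_slash,
      ModularForm.SL_smul_slash, m1, m2, Pi.add_apply, Pi.sub_apply, Pi.smul_apply, Pi.mul_apply,
      t0, t1, t2, E₂_slash, smul_eq_mul]
    field_simp
    ring
  · ext z
    obtain ⟨t0, t1, t2⟩ := component_slash h γ z
    have m1 : (φ 2 * E₂) ∣[w - 2] γ = (φ 2 ∣[w - 4] γ) * (E₂ ∣[(2 : ℤ)] γ) := by
      rw [← ModularForm.mul_slash_SL2]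
      congr 1
      ring
    simp only [sub_slash, ModularForm.SL_smul_slash, m1, Pi.sub_apply, Pi.smul_apply, Pi.mul_apply,
      t1, t2, E₂_slash, smul_eq_mul]
    field_simp
    ring
  · ext z
    simp only [ModularForm.SL_smul_slash, Pi.smul_apply, (component_slash h γ z).2.2]
  · rw [hf0]
    ext z
    simp only [Pi.add_apply, Pi.sub_apply, Pi.smul_apply, Pi.mul_apply, Pi.pow_apply, smul_eq_mul]
    field_simp
    ring

/-! ### Theta functions -/

lemma hasSum_int_even_add_odd {f : ℤ → ℂ} {a b : ℂ} (he : HasSum (fun n ↦ f (2 * n)) a)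
    (ho : HasSum (fun n ↦ f (2 * n + 1)) b) : HasSum f (a + b) := by
  have h2 : Function.Injective (fun n : ℤ ↦ 2 * n) := fun a b h ↦ by simpa using h
  have h21 : Function.Injective (fun n : ℤ ↦ 2 * n + 1) := fun a b h ↦ by simpa using h
  replace he := h2.hasSum_range_iff.2 he
  replace ho := h21.hasSum_range_iff.2 ho
  refine he.add_isCompl ?_ ho
  have e1 : Set.range (fun n : ℤ ↦ 2 * n) = {n | Even n} := by
    ext n
    simp [even_iff_exists_two_mul]
  have e2 : Set.range (fun n : ℤ ↦ 2 * n + 1) = {n | Odd n} := by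
    ext n
    simp [Odd]
  rw [e1, e2]
  exact Int.isCompl_even_odd

lemma hasSum_jacobiTheta {τ : ℂ} (hτ : 0 < im τ) :
    HasSum (fun n : ℤ ↦ cexp (π * I * (n : ℂ) ^ 2 * τ)) (jacobiTheta τ) := by
  have := hasSum_jacobiTheta₂_term 0 hτ
  simpa [jacobiTheta₂_term, ← jacobiTheta_eq_jacobiTheta₂] using this

lemma hasSum_Θ₂ {τ : ℂ} (hτ : 0 < im τ) :
    HasSum (fun n : ℤ ↦ cexp (π * I * ((n : ℂ) + 1 / 2) ^ 2 * τ))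
      (jacobiTheta (τ / 4) - jacobiTheta τ) := by
  have hτ4 : 0 < im (τ / 4) := by
    rw [show (4 : ℂ) = (4 : ℝ) by norm_num, Complex.div_ofReal_im]
    positivity
  have h4 := hasSum_jacobiTheta hτ4
  have h1 := hasSum_jacobiTheta hτ
  have hodd : Summable (fun n : ℤ ↦ cexp (π * I * ((n : ℂ) + 1 / 2) ^ 2 * τ)) := by
    have hinj : Function.Injective (fun n : ℤ ↦ 2 * n + 1) := fun a b h ↦ by simpa using h
    refine (h4.summable.comp_injective hinj).congr fun n ↦ ?_
    simp only [Function.comp_apply]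
    congr 1
    push_cast
    ring
  have he : HasSum (fun n : ℤ ↦ cexp (π * I * ((2 * n : ℤ) : ℂ) ^ 2 * (τ / 4))) (jacobiTheta τ) :=
    h1.congr_fun fun n ↦ by
      congr 1
      push_cast
      ring
  have ho : HasSum (fun n : ℤ ↦ cexp (π * I * ((2 * n + 1 : ℤ) : ℂ) ^ 2 * (τ / 4)))
      (∑' n : ℤ, cexp (π * I * ((n : ℂ) + 1 / 2) ^ 2 * τ)) :=
    hodd.hasSum.congr_fun fun n ↦ by
      congr 1
      push_cast
      ring
  have := (hasSum_int_even_add_odd (f := fun n : ℤ ↦ cexp (π * I * (n : ℂ) ^ 2 * (τ / 4)))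
    he ho).unique h4
  rw [← this, add_sub_cancel_left]
  exact hodd.hasSum

/-- The odd indices in the series of `θ (z / 4)` give `Θ₂`, the even ones give `θ z`. -/
lemma Θ₂_eq (z : ℍ) : Θ₂ z = jacobiTheta (z / 4) - jacobiTheta z :=
  (hasSum_Θ₂ z.im_pos).tsum_eq

lemma neg_one_zpow_eq_exp (n : ℤ) : (-1 : ℂ) ^ n = cexp (π * I * (n : ℂ) ^ 2) := by
  rcases Int.even_or_odd' n with ⟨k, rfl | rfl⟩
  · rw [(even_two_mul k).neg_one_zpow, eq_comm, Complex.exp_eq_one_iff]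
    exact ⟨2 * k ^ 2, by push_cast; ring⟩
  · rw [Odd.neg_one_zpow ⟨k, rfl⟩, ← Complex.exp_pi_mul_I, Complex.exp_eq_exp_iff_exists_int]
    exact ⟨-(2 * k ^ 2 + 2 * k), by push_cast; ring⟩

lemma Θ₄_eq_add_one (z : ℍ) : Θ₄ z = jacobiTheta (z + 1) := by
  have h : 0 < im ((z : ℂ) + 1) := by simpa using z.im_pos
  rw [Θ₄, ← (hasSum_jacobiTheta h).tsum_eq]
  refine tsum_congr fun n ↦ ?_
  rw [neg_one_zpow_eq_exp, ← Complex.exp_add]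
  congr 1
  ring

/-- The even indices in the series of `Θ₄` give `θ (4 z)`, the odd ones `-Θ₂ (4 z)`. -/
lemma Θ₄_eq (z : ℍ) : Θ₄ z = 2 * jacobiTheta (4 * z) - jacobiTheta z := by
  have h4 : 0 < im (4 * (z : ℂ)) := by simpa using z.im_pos
  have he := hasSum_jacobiTheta h4
  have ho := hasSum_Θ₂ h4
  rw [mul_div_cancel_left₀ _ (by norm_num : (4 : ℂ) ≠ 0)] at ho
  refine ((hasSum_int_even_add_odd (f := fun n : ℤ ↦ (-1 : ℂ) ^ n * cexp (π * I * (n : ℂ) ^ 2 * z))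
    (he.congr_fun fun n ↦ ?_) (ho.neg.congr_fun fun n ↦ ?_)).tsum_eq).trans (by ring)
  · rw [(even_two_mul n).neg_one_zpow, one_mul]
    congr 1
    push_cast
    ring
  · rw [Odd.neg_one_zpow ⟨n, rfl⟩, neg_one_mul]
    congr 2
    push_cast
    ring

/-- The theta function `Θ₃`. -/
noncomputable def Θ₃ (z : ℍ) : ℂ := jacobiTheta z

/-- The fourth power of `Θ₃`. -/
noncomputable def H₃ : ℍ → ℂ := Θ₃ ^ 4

lemma Θ₂_vadd_one (z : ℍ) : Θ₂ ((1 : ℝ) +ᵥ z) = cexp (π * I / 4) * Θ₂ z := by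
  rw [Θ₂, Θ₂, ← tsum_mul_left]
  refine tsum_congr fun n ↦ ?_
  rw [← Complex.exp_add, Complex.exp_eq_exp_iff_exists_int]
  obtain ⟨k, hk⟩ := Int.even_mul_succ_self n
  refine ⟨k, ?_⟩
  have hk' : (n : ℂ) * (n + 1) = k + k := mod_cast hk
  simp only [coe_vadd, ofReal_one]
  linear_combination (π * I) * hk'

lemma Θ₄_vadd_one (z : ℍ) : Θ₄ ((1 : ℝ) +ᵥ z) = Θ₃ z := by
  rw [Θ₄_eq_add_one, Θ₃, ← jacobiTheta_two_add z, coe_vadd, ofReal_one]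
  congr 1
  ring

lemma Θ₃_vadd_one (z : ℍ) : Θ₃ ((1 : ℝ) +ᵥ z) = Θ₄ z := by
  rw [Θ₄_eq_add_one, Θ₃, coe_vadd, ofReal_one, add_comm]

lemma mdiff_coe {g : ℂ → ℂ} (h : ∀ z : ℍ, DifferentiableAt ℂ g z) : MDiff (fun z : ℍ ↦ g z) :=
  fun z ↦ (h z).mdifferentiableAt.comp z (mdifferentiable_coe z)

lemma mdiff_Θ₃ : MDiff Θ₃ := mdifferentiable_jacobiTheta

lemma mdiff_Θ₄ : MDiff Θ₄ := by
  rw [funext Θ₄_eq_add_one]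
  refine mdiff_coe (g := fun w ↦ jacobiTheta (w + 1)) fun z ↦ ?_
  exact (differentiableAt_jacobiTheta (by simpa using z.im_pos)).comp (z : ℂ)
    (differentiableAt_id.add_const 1)

lemma mdiff_Θ₂ : MDiff Θ₂ := by
  rw [funext Θ₂_eq]
  refine mdiff_coe (g := fun w ↦ jacobiTheta (w / 4) - jacobiTheta w) fun z ↦ ?_
  refine .sub ?_ (differentiableAt_jacobiTheta z.im_pos)
  refine (differentiableAt_jacobiTheta ?_).comp (z : ℂ) (differentiableAt_id.div_const 4)
  rw [show (4 : ℂ) = (4 : ℝ) by norm_num, Complex.div_ofReal_im]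
  exact div_pos z.im_pos four_pos

lemma tendsto_jacobiTheta : Tendsto jacobiTheta (comap Complex.im atTop) (𝓝 1) := by
  have h0 : Tendsto (fun τ : ℂ ↦ rexp (-π * τ.im)) (comap Complex.im atTop) (𝓝 0) := by
    refine Real.tendsto_exp_atBot.comp ?_
    exact (tendsto_comap (f := Complex.im)).const_mul_atTop_of_neg (by simpa using Real.pi_pos)
  have := isBigO_at_im_infty_jacobiTheta_sub_one.trans_tendsto h0
  simpa using this.add_const 1

lemma tendsto_Θ₃ : Tendsto Θ₃ atImInfty (𝓝 1) :=
  tendsto_jacobiTheta.comp tendsto_coe_atImInfty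

lemma tendsto_Θ₄ : Tendsto Θ₄ atImInfty (𝓝 1) := by
  rw [funext Θ₄_eq_add_one]
  refine tendsto_jacobiTheta.comp (tendsto_comap_iff.mpr ?_)
  simpa [Function.comp_def] using! (tendsto_comap (f := UpperHalfPlane.im))

lemma tendsto_Θ₂ : Tendsto Θ₂ atImInfty (𝓝 0) := by
  rw [funext Θ₂_eq, ← sub_self (1 : ℂ)]
  refine (tendsto_jacobiTheta.comp (tendsto_comap_iff.mpr ?_)).sub tendsto_Θ₃
  have h : (Complex.im ∘ fun z : ℍ ↦ (z : ℂ) / 4) = fun z : ℍ ↦ z.im / 4 := by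
    ext z
    rw [Function.comp_apply, show (4 : ℂ) = (4 : ℝ) by norm_num, Complex.div_ofReal_im]
    rfl
  rw [h]
  exact (tendsto_comap (f := UpperHalfPlane.im)).atTop_div_const four_pos

/-! ### The action of `SL(2, ℤ)` on `H₂` and `H₄` -/

lemma slash_S_apply (f : ℍ → ℂ) (k : ℤ) (z : ℍ) :
    (f ∣[k] ModularGroup.S) z = f (ModularGroup.S • z) * (z : ℂ) ^ (-k) := by
  rw [slash_apply']
  simp [ModularGroup.S]

lemma slash_T_apply (f : ℍ → ℂ) (k : ℤ) (z : ℍ) :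
    (f ∣[k] ModularGroup.T) z = f ((1 : ℝ) +ᵥ z) := by
  rw [slash_apply', modular_T_smul]
  simp [ModularGroup.T]

lemma neg_I_mul_cpow_half_pow_four (z : ℍ) :
    ((-I * z) ^ (1 / 2 : ℂ)) ^ 4 = -(z : ℂ) ^ 2 := by
  have h : ((-I * z) ^ (1 / 2 : ℂ)) ^ 2 = -I * (z : ℂ) := by
    rw [← Complex.cpow_nat_mul]
    norm_num
  rw [show 4 = 2 * 2 by norm_num, pow_mul, h, mul_pow, neg_sq, I_sq]
  ring

lemma Θ₂_S_smul (z : ℍ) : Θ₂ (ModularGroup.S • z) = (-I * z) ^ (1 / 2 : ℂ) * Θ₄ z := by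
  have h4 : 0 < (4 * (z : ℂ)).im := by simpa using z.im_pos
  have e : ((ModularGroup.S • z : ℍ) : ℂ) / 4 = ((ModularGroup.S • (⟨4 * z, h4⟩ : ℍ) : ℍ) : ℂ) := by
    simp only [modular_S_smul]
    field_simp
  have hs : (-I * (4 * z)) ^ (1 / 2 : ℂ) = 2 * (-I * (z : ℂ)) ^ (1 / 2 : ℂ) := by
    have hz : -I * (z : ℂ) ≠ 0 := mul_ne_zero (neg_ne_zero.mpr I_ne_zero) z.ne_zero
    rw [show -I * (4 * z) = ((4 : ℝ) : ℂ) * (-I * z) by push_cast; ring,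
      Complex.cpow_def_of_ne_zero (mul_ne_zero (by norm_num) hz), Complex.cpow_def_of_ne_zero hz,
      Complex.log_ofReal_mul four_pos hz, add_mul, Complex.exp_add]
    congr 1
    rw [show (4 : ℝ) = 2 ^ 2 by norm_num, Real.log_pow,
      show (((2 : ℕ) * Real.log 2 : ℝ) : ℂ) * (1 / 2) = ((Real.log 2 : ℝ) : ℂ) by push_cast; ring,
      ← Complex.ofReal_exp, Real.exp_log two_pos, Complex.ofReal_ofNat]
  rw [Θ₂_eq, e, jacobiTheta_S_smul, jacobiTheta_S_smul, Θ₄_eq, hs]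
  ring

lemma H₂_slash_S : H₂ ∣[(2 : ℤ)] ModularGroup.S = -H₄ := by
  ext z
  have hz := z.ne_zero
  rw [slash_S_apply, H₂, H₄, Pi.pow_apply, Pi.neg_apply, Pi.pow_apply, Θ₂_S_smul, mul_pow,
    neg_I_mul_cpow_half_pow_four]
  simp only [Int.reduceNeg, zpow_neg]
  norm_cast
  field_simp

lemma H₃_slash_S : H₃ ∣[(2 : ℤ)] ModularGroup.S = -H₃ := by
  ext z
  have hz := z.ne_zero
  rw [slash_S_apply, H₃, Pi.pow_apply, Pi.neg_apply, Pi.pow_apply, Θ₃, Θ₃, jacobiTheta_S_smul,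
    mul_pow, neg_I_mul_cpow_half_pow_four]
  simp only [Int.reduceNeg, zpow_neg]
  norm_cast
  field_simp

lemma neg_slash_S_S (f : ℍ → ℂ) : (f ∣[(2 : ℤ)] ModularGroup.S) ∣[(2 : ℤ)] ModularGroup.S = f := by
  rw [← SlashAction.slash_mul]
  ext z
  rw [slash_apply']
  have : ModularGroup.S * ModularGroup.S = -1 := by decide
  simp [this]

lemma H₄_slash_S : H₄ ∣[(2 : ℤ)] ModularGroup.S = -H₂ := by
  rw [← neg_eq_iff_eq_neg, ← SlashAction.neg_slash, ← H₂_slash_S, neg_slash_S_S]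

lemma H₂_slash_T : H₂ ∣[(2 : ℤ)] ModularGroup.T = -H₂ := by
  ext z
  rw [slash_T_apply, H₂, Pi.pow_apply, Pi.neg_apply, Pi.pow_apply, Θ₂_vadd_one, mul_pow,
    ← Complex.exp_nat_mul]
  rw [show ((4 : ℕ) : ℂ) * (π * I / 4) = π * I by push_cast; ring, Complex.exp_pi_mul_I]
  ring

lemma H₄_slash_T : H₄ ∣[(2 : ℤ)] ModularGroup.T = H₃ := by
  ext z
  rw [slash_T_apply, H₄, H₃, Pi.pow_apply, Pi.pow_apply, Θ₄_vadd_one]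

lemma H₃_slash_T : H₃ ∣[(2 : ℤ)] ModularGroup.T = H₄ := by
  ext z
  rw [slash_T_apply, H₄, H₃, Pi.pow_apply, Pi.pow_apply, Θ₃_vadd_one]

lemma tendsto_H₂ : Tendsto H₂ atImInfty (𝓝 0) := by
  simpa using! tendsto_Θ₂.pow 4

lemma tendsto_H₃ : Tendsto H₃ atImInfty (𝓝 1) := by
  simpa using! tendsto_Θ₃.pow 4

lemma tendsto_H₄ : Tendsto H₄ atImInfty (𝓝 1) := by
  simpa using! tendsto_Θ₄.pow 4

lemma mdiff_H₂ : MDiff H₂ := mdiff_Θ₂.pow 4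

lemma mdiff_H₃ : MDiff H₃ := mdiff_Θ₃.pow 4

lemma mdiff_H₄ : MDiff H₄ := mdiff_Θ₄.pow 4

/-- Jacobi's identity: `H₂ + H₄ - H₃` changes sign under both generators, so its square is a level
one form of weight `4`, and it vanishes at `i∞`. -/
lemma H₃_eq : H₃ = H₂ + H₄ := by
  set g := H₂ + H₄ - H₃ with hg
  have hS : g ∣[(2 : ℤ)] ModularGroup.S = -g := by
    rw [hg, sub_slash, SlashAction.add_slash, H₂_slash_S, H₄_slash_S, H₃_slash_S]
    ring
  have hT : g ∣[(2 : ℤ)] ModularGroup.T = -g := by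
    rw [hg, sub_slash, SlashAction.add_slash, H₂_slash_T, H₄_slash_T, H₃_slash_T]
    ring
  have h0 : Tendsto (g * g) atImInfty (𝓝 0) := by
    have := (tendsto_H₂.add tendsto_H₄).sub tendsto_H₃
    simp only [zero_add, sub_self] at this
    simpa using! this.mul this
  have hd : MDiff g := (mdiff_H₂.add mdiff_H₄).sub mdiff_H₃
  have h : IsMF ⊤ (2 + 2) (g * g) := by
    refine .of_generators (hd.mul hd) ?_ ?_ ?_
    · exact h0.isBigO_one ℝ
    · rw [ModularForm.mul_slash_SL2, hS, neg_mul_neg]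
    · rw [ModularForm.mul_slash_SL2, hT, neg_mul_neg]
  have hz := h.eq_zero_of_lt_twelve (by norm_num) h0
  ext z
  have := congrFun hz z
  simp only [hg, Pi.mul_apply, Pi.sub_apply, Pi.add_apply, Pi.zero_apply, mul_self_eq_zero] at this
  simp only [Pi.add_apply]
  linear_combination -this

/-- The representation of `SL(2, ℤ/2) ≅ S₃` on the span of `H₂, H₄`, as a function of the entries of
the matrix. Each element permutes the three vectors `H₂`, `H₄` and `-(H₂ + H₄)`, up to
the sign of that permutation. The three vectors correspond to the three nonzero rows `(u, v)` modulo
`2`, and the transpositions are the matrices of trace zero other than `1`. -/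
def thetaRep (a b c d : ZMod 2) : Matrix (Fin 2) (Fin 2) ℤ :=
  let row (u v : ZMod 2) : Fin 2 → ℤ :=
    if u = 0 then ![1, 0] else if v = 0 then ![0, 1] else ![-1, -1]
  (if a + d = 0 ∧ ¬ (b = 0 ∧ c = 0) then -1 else 1 : ℤ) • ![row c d, row a b]

/-- `H₂` and `H₄` as a family. -/
noncomputable def thetaVec : Fin 2 → ℍ → ℂ := ![H₂, H₄]

lemma thetaRep_mul : ∀ a b c d a' b' c' d' : ZMod 2, a * d - b * c = 1 → a' * d' - b' * c' = 1 →
    thetaRep (a * a' + b * c') (a * b' + b * d') (c * a' + d * c') (c * b' + d * d') =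
      thetaRep a b c d * thetaRep a' b' c' d' := by
  decide

/-- `thetaRep` on integral matrices. -/
def thetaRepZ (γ : SL(2, ℤ)) : Matrix (Fin 2) (Fin 2) ℤ :=
  thetaRep (γ 0 0 : ℤ) (γ 0 1 : ℤ) (γ 1 0 : ℤ) (γ 1 1 : ℤ)

lemma thetaRepZ_mul (γ δ : SL(2, ℤ)) : thetaRepZ (γ * δ) = thetaRepZ γ * thetaRepZ δ := by
  have h (γ : SL(2, ℤ)) : ((γ 0 0 : ℤ) : ZMod 2) * (γ 1 1 : ℤ) - (γ 0 1 : ℤ) * (γ 1 0 : ℤ) = 1 := by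
    have := γ.det_coe
    rw [Matrix.det_fin_two] at this
    exact mod_cast congrArg (Int.cast : ℤ → ZMod 2) this
  rw [thetaRepZ, thetaRepZ, thetaRepZ, ← thetaRep_mul _ _ _ _ _ _ _ _ (h γ) (h δ)]
  simp [Matrix.mul_apply, Fin.sum_univ_two]

/-- Both sides are right actions, so the two generators suffice. -/
lemma thetaVec_slash (γ : SL(2, ℤ)) (i : Fin 2) :
    thetaVec i ∣[(2 : ℤ)] γ = ∑ j, (thetaRepZ γ i j : ℂ) • thetaVec j := by
  have hγ : γ ∈ Subgroup.closure {ModularGroup.S, ModularGroup.T} := by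
    rw [SpecialLinearGroup.SL2Z_generators]
    trivial
  have one : thetaRepZ 1 = 1 := by decide
  induction hγ using Subgroup.closure_induction generalizing i with
  | mem x hx =>
    have eS : thetaRepZ ModularGroup.S = !![0, -1; -1, 0] := by decide
    have eT : thetaRepZ ModularGroup.T = !![-1, 0; 1, 1] := by decide
    rcases hx with rfl | rfl
    · fin_cases i <;> simp [thetaVec, eS, H₂_slash_S, H₄_slash_S, Fin.sum_univ_two]
    · fin_cases i <;> simp [thetaVec, eT, H₂_slash_T, H₄_slash_T, H₃_eq, Fin.sum_univ_two]
  | one => simp [one, SlashAction.slash_one, Matrix.one_apply]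
  | mul x y _ _ hx hy =>
    rw [SlashAction.slash_mul, hx, thetaRepZ_mul]
    simp only [Fin.sum_univ_two, SlashAction.add_slash, ModularForm.SL_smul_slash, hy,
      Matrix.mul_apply]
    push_cast
    module
  | inv x _ hx =>
    have e : thetaRepZ x⁻¹ * thetaRepZ x = 1 := by rw [← thetaRepZ_mul, inv_mul_cancel, one]
    have e' (i j) := congrFun (congrFun e i) j
    have hv (j) := congrArg (fun f ↦ f ∣[(2 : ℤ)] x⁻¹) (hx j)
    simp only [← SlashAction.slash_mul, mul_inv_cancel, SlashAction.slash_one, Fin.sum_univ_two,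
      SlashAction.add_slash, ModularForm.SL_smul_slash] at hv
    have e0 : (thetaRepZ x⁻¹ i 0 : ℂ) * thetaRepZ x 0 0 + thetaRepZ x⁻¹ i 1 * thetaRepZ x 1 0 =
        if i = 0 then 1 else 0 := by
      have := e' i 0
      simp only [Matrix.mul_apply, Fin.sum_univ_two, Matrix.one_apply] at this
      exact_mod_cast this
    have e1 : (thetaRepZ x⁻¹ i 0 : ℂ) * thetaRepZ x 0 1 + thetaRepZ x⁻¹ i 1 * thetaRepZ x 1 1 =
        if i = 1 then 1 else 0 := by
      have := e' i 1
      simp only [Matrix.mul_apply, Fin.sum_univ_two, Matrix.one_apply] at this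
      exact_mod_cast this
    have e2 : thetaVec i ∣[(2 : ℤ)] x⁻¹ =
        (if i = 0 then (1 : ℂ) else 0) • (thetaVec 0 ∣[(2 : ℤ)] x⁻¹) +
        (if i = 1 then (1 : ℂ) else 0) • (thetaVec 1 ∣[(2 : ℤ)] x⁻¹) := by
      fin_cases i <;> simp
    have hv0 := hv 0
    have hv1 := hv 1
    rw [e2, ← e0, ← e1, Fin.sum_univ_two]
    generalize thetaVec 0 ∣[(2 : ℤ)] x⁻¹ = w₀ at *
    generalize thetaVec 1 ∣[(2 : ℤ)] x⁻¹ = w₁ at *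
    rw [hv0, hv1]
    module

lemma isBoundedAtImInfty_thetaVec_slash (γ : SL(2, ℤ)) (i : Fin 2) :
    IsBoundedAtImInfty (thetaVec i ∣[(2 : ℤ)] γ) := by
  have h (j : Fin 2) (c : ℂ) : IsBoundedAtImInfty (c • thetaVec j) := by
    refine (const_boundedAtFilter _ c).mul ?_
    fin_cases j
    · exact tendsto_H₂.isBigO_one ℝ
    · exact tendsto_H₄.isBigO_one ℝ
  rw [thetaVec_slash, Fin.sum_univ_two]
  exact (h 0 _).add (h 1 _)

lemma isMF_thetaVec (i : Fin 2) : IsMF (CongruenceSubgroup.Gamma 2) 2 (thetaVec i) where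
  mdiff := by
    fin_cases i
    exacts [mdiff_H₂, mdiff_H₄]
  slash γ hγ := by
    have e : thetaRepZ γ = 1 := by
      obtain ⟨h0, h1, h2, h3⟩ := CongruenceSubgroup.Gamma_mem.mp hγ
      rw [thetaRepZ, h0, h1, h2, h3]
      decide
    rw [thetaVec_slash, e]
    simp [Matrix.one_apply]
  bdd γ := isBoundedAtImInfty_thetaVec_slash γ i

lemma isMF_H₂ : IsMF (CongruenceSubgroup.Gamma 2) 2 H₂ := isMF_thetaVec 0

lemma isMF_H₄ : IsMF (CongruenceSubgroup.Gamma 2) 2 H₄ := isMF_thetaVec 1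

/-- `H₂` and `H₄` transform under `Γ₀(2)` through its image modulo `2`, which is generated
by `T`. -/
lemma slash_Gamma0 {γ : SL(2, ℤ)} (hγ : γ ∈ CongruenceSubgroup.Gamma0 2) :
    (H₂ ∣[(2 : ℤ)] γ = H₂ ∧ H₄ ∣[(2 : ℤ)] γ = H₄) ∨
      (H₂ ∣[(2 : ℤ)] γ = -H₂ ∧ H₄ ∣[(2 : ℤ)] γ = H₂ + H₄) := by
  have hc := CongruenceSubgroup.Gamma0_mem.mp hγ
  have hdet : ((γ 0 0 : ℤ) : ZMod 2) * (γ 1 1 : ℤ) - (γ 0 1 : ℤ) * (γ 1 0 : ℤ) = 1 := by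
    have := γ.det_coe
    rw [Matrix.det_fin_two] at this
    exact mod_cast congrArg (Int.cast : ℤ → ZMod 2) this
  have key : ∀ a b c d : ZMod 2, a * d - b * c = 1 → c = 0 →
      thetaRep a b c d = 1 ∨ thetaRep a b c d = !![-1, 0; 1, 1] := by decide
  have h2 := thetaVec_slash γ 0
  have h4 := thetaVec_slash γ 1
  rcases key _ _ _ _ hdet hc with h | h
  · rw [thetaRepZ, h] at h2 h4
    exact .inl ⟨by simpa [thetaVec] using h2, by simpa [thetaVec] using h4⟩
  · rw [thetaRepZ, h] at h2 h4
    exact .inr ⟨by simpa [thetaVec] using h2, by simpa [thetaVec] using h4⟩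

/-- The conditions at the cusps do not involve the level, so only invariance has to be checked. -/
lemma IsMF.of_Gamma {k : ℤ} {f : ℍ → ℂ} (hf : IsMF (CongruenceSubgroup.Gamma 2) k f)
    (h : ∀ γ ∈ CongruenceSubgroup.Gamma0 2, f ∣[k] γ = f) :
    IsMF (CongruenceSubgroup.Gamma0 2) k f := ⟨hf.mdiff, h, hf.bdd⟩

lemma isMF_A : IsMF (CongruenceSubgroup.Gamma0 2) 4 A := by
  refine .of_Gamma ((isMF_H₂.pow 2).congr rfl rfl) fun γ hγ ↦ ?_
  rw [A, sq, show (4 : ℤ) = 2 + 2 by rfl, ModularForm.mul_slash_SL2]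
  rcases slash_Gamma0 hγ with ⟨h2, -⟩ | ⟨h2, -⟩ <;> rw [h2]
  ring

lemma B_eq : B = H₂ + (2 : ℂ) • H₄ := by
  ext z
  simp [B]

lemma isMF_B : IsMF (CongruenceSubgroup.Gamma0 2) 2 B := by
  rw [B_eq]
  refine .of_Gamma (isMF_H₂.add (isMF_H₄.smul 2)) fun γ hγ ↦ ?_
  rw [SlashAction.add_slash, ModularForm.SL_smul_slash]
  rcases slash_Gamma0 hγ with ⟨h2, h4⟩ | ⟨h2, h4⟩ <;> rw [h2, h4]
  module

/-- The form `H₄ (H₂ + H₄) = H₃ H₄` of weight `4` and level `Γ₀(2)`, nowhere zero and positive on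
the imaginary axis. It is denoted by `h` in comments. -/
noncomputable def hh : ℍ → ℂ := H₄ * (H₂ + H₄)

lemma isMF_hh : IsMF (CongruenceSubgroup.Gamma0 2) 4 hh := by
  refine .of_Gamma ((isMF_H₄.mul (isMF_H₂.add isMF_H₄)).congr rfl rfl) fun γ hγ ↦ ?_
  rw [hh, show (4 : ℤ) = 2 + 2 by rfl, ModularForm.mul_slash_SL2, SlashAction.add_slash]
  rcases slash_Gamma0 hγ with ⟨h2, h4⟩ | ⟨h2, h4⟩ <;> rw [h2, h4]
  ring

/-! ### Eisenstein series in terms of theta functions -/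

lemma tendsto_E₄ : Tendsto E₄ atImInfty (𝓝 1) := by
  have := isMF_E₄.hasQExp.tendsto
  rwa [show (qExpansion 1 E₄).coeff 0 = 1 from
    EisensteinSeries.E_qExpansion_coeff_zero _ (by decide)] at this

lemma tendsto_E₆ : Tendsto E₆ atImInfty (𝓝 1) := by
  have := isMF_E₆.hasQExp.tendsto
  rwa [show (qExpansion 1 E₆).coeff 0 = 1 from
    EisensteinSeries.E_qExpansion_coeff_zero _ (by decide)] at this

/-- The right-hand side is invariant under `S` and `T`, and both sides are `1` at `i∞`. -/
lemma E₄_eq : E₄ = H₂ * H₂ + H₂ * H₄ + H₄ * H₄ := by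
  have h : IsMF ⊤ 4 (H₂ * H₂ + H₂ * H₄ + H₄ * H₄) := by
    have h2 := ((isMF_H₂.mul isMF_H₂).add (isMF_H₂.mul isMF_H₄)).add (isMF_H₄.mul isMF_H₄)
    refine .of_generators h2.mdiff h2.isBoundedAtImInfty ?_ ?_ <;>
    rw [show (4 : ℤ) = 2 + 2 by rfl] <;>
    simp only [SlashAction.add_slash, ModularForm.mul_slash_SL2, H₂_slash_S, H₄_slash_S, H₂_slash_T,
      H₄_slash_T, H₃_eq] <;>
    ring
  refine isMF_E₄.eq_of_tendsto h (by norm_num) tendsto_E₄ ?_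
  simpa using! ((tendsto_H₂.mul tendsto_H₂).add (tendsto_H₂.mul tendsto_H₄)).add
    (tendsto_H₄.mul tendsto_H₄)

lemma two_smul_E₆_eq :
    (2 : ℂ) • E₆ = (H₂ + (2 : ℂ) • H₄) * ((2 : ℂ) • H₂ + H₄) * (H₄ - H₂) := by
  have h : IsMF ⊤ 6 ((H₂ + (2 : ℂ) • H₄) * ((2 : ℂ) • H₂ + H₄) * (H₄ - H₂)) := by
    have h2 := ((isMF_H₂.add (isMF_H₄.smul 2)).mul ((isMF_H₂.smul 2).add isMF_H₄)).mul
      (isMF_H₄.sub isMF_H₂)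
    refine .of_generators h2.mdiff h2.isBoundedAtImInfty ?_ ?_ <;>
    rw [show (6 : ℤ) = 2 + 2 + 2 by rfl] <;>
    simp only [SlashAction.add_slash, ModularForm.mul_slash_SL2, sub_slash,
      ModularForm.SL_smul_slash, H₂_slash_S, H₄_slash_S, H₂_slash_T, H₄_slash_T, H₃_eq] <;>
    simp only [two_smul] <;>
    ring
  refine (isMF_E₆.smul 2).eq_of_tendsto h (by norm_num) (c := 2) ?_ ?_
  · simpa using! tendsto_E₆.const_mul 2
  · simpa using! ((tendsto_H₂.add (tendsto_H₄.const_mul 2)).mul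
      ((tendsto_H₂.const_mul 2).add tendsto_H₄)).mul (tendsto_H₄.sub tendsto_H₂)

/-! ### Ramanujan's identities and the derivatives of theta functions -/

lemma hasQExp_E₂ : HasQExp E₂ :=
  .of_hasSum E2_mdifferentiable
    (c := fun m ↦ if m = 0 then 1 else -24 * ArithmeticFunction.sigma 1 m)
    fun z ↦ by
      simpa [Function.Periodic.qParam] using EisensteinSeries.hasSum_qExpansion_E2 (z := z)

lemma HasQExp.coeff_eq {f : ℍ → ℂ} (hf : HasQExp f) {c : ℕ → ℂ}
    (h : ∀ z : ℍ, HasSum (fun m ↦ c m • Function.Periodic.qParam (1 : ℝ) z ^ m) (f z)) (m : ℕ) :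
    (qExpansion 1 f).coeff m = c m := by
  have h1 := (hasFPowerSeriesOnBall_cuspFunction one_pos hf.analyticAt h).hasFPowerSeriesAt
  have h2 := h1.eq_formalMultilinearSeries hf.analyticAt.hasFPowerSeriesAt
  have := congr_arg (FormalMultilinearSeries.coeff · m) h2
  simpa [qExpansion_coeff, div_eq_mul_inv, mul_comm] using this.symm

lemma qExpansion_E₂_coeff (m : ℕ) : (qExpansion 1 E₂).coeff m =
    if m = 0 then 1 else -24 * (ArithmeticFunction.sigma 1 m : ℂ) := by
  refine hasQExp_E₂.coeff_eq (c := fun m ↦ if m = 0 then 1 else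
    -24 * (ArithmeticFunction.sigma 1 m : ℂ)) (fun z ↦ ?_) m
  simpa [Function.Periodic.qParam] using EisensteinSeries.hasSum_qExpansion_E2 (z := z)

lemma tendsto_E₂ : Tendsto E₂ atImInfty (𝓝 1) := by
  have h := hasQExp_E₂.tendsto
  rwa [qExpansion_E₂_coeff, if_pos rfl] at h

lemma hasDerivAt_cocycle (γ : SL(2, ℤ)) (z : ℍ) :
    HasDerivAt (cocycle γ ∘ ofComplex) (-cocycle γ z ^ 2) z := by
  have hj := denom_ne γ z
  have h1 : HasDerivAt (fun w : ℂ ↦ ((γ 1 0 : ℤ) : ℂ) / (((γ 1 0 : ℤ) : ℂ) * w + ((γ 1 1 : ℤ) : ℂ)))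
      (-cocycle γ z ^ 2) z := by
    have := (((hasDerivAt_id (z : ℂ)).const_mul ((γ 1 0 : ℤ) : ℂ)).add_const
      ((γ 1 1 : ℤ) : ℂ)).inv hj |>.const_mul ((γ 1 0 : ℤ) : ℂ)
    refine (this.congr_deriv ?_).congr_of_eventuallyEq (.of_forall fun w ↦ ?_)
    · simp only [cocycle, id]
      field_simp
    · simp [div_eq_mul_inv]
  refine h1.congr_of_eventuallyEq ?_
  filter_upwards [isOpen_upperHalfPlaneSet.mem_nhds z.im_pos] with w hw
  simp [cocycle, ofComplex_apply_of_im_pos hw]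

/-- `f` is holomorphic with `D f = g`. -/
structure HasD (f g : ℍ → ℂ) : Prop where
  mdiff : MDiff f
  eq : D f = g

namespace HasD

variable {f g f' g' : ℍ → ℂ}

lemma add (hf : HasD f f') (hg : HasD g g') : HasD (f + g) (f' + g') :=
  ⟨hf.mdiff.add hg.mdiff, by
    rw [normalizedDerivOfComplex_add _ _ hf.mdiff hg.mdiff, hf.eq, hg.eq]⟩

lemma sub (hf : HasD f f') (hg : HasD g g') : HasD (f - g) (f' - g') :=
  ⟨hf.mdiff.sub hg.mdiff, by
    rw [normalizedDerivOfComplex_sub _ _ hf.mdiff hg.mdiff, hf.eq, hg.eq]⟩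

lemma mul (hf : HasD f f') (hg : HasD g g') : HasD (f * g) (f' * g + f * g') :=
  ⟨hf.mdiff.mul hg.mdiff, by
    rw [normalizedDerivOfComplex_mul _ _ hf.mdiff hg.mdiff, hf.eq, hg.eq]⟩

lemma pow (hf : HasD f f') (n : ℕ) : HasD (f ^ n) (n * f ^ (n - 1) * f') :=
  ⟨hf.mdiff.pow n, by rw [normalizedDerivOfComplex_pow _ _ hf.mdiff, hf.eq]⟩

lemma smul (c : ℂ) (hf : HasD f f') : HasD (c • f) (c • f') :=
  ⟨hf.mdiff.const_smul c, by rw [normalizedDerivOfComplex_smul _ _ hf.mdiff, hf.eq]⟩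

lemma ofNat_mul (n : ℕ) [n.AtLeastTwo] (hf : HasD f f') :
    HasD ((OfNat.ofNat n : ℍ → ℂ) * f) ((OfNat.ofNat n : ℍ → ℂ) * f') :=
  hf.smul (OfNat.ofNat n)

lemma congr {h : ℍ → ℂ} (hf : HasD f f') (e : f' = h) : HasD f h := e ▸ hf

end HasD

/-- Differentiating `E₂_slash` shows that the terms spoiling the modularity of `D E₂` and of
`E₂ ^ 2 / 12` are the same. -/
lemma isMF_D_E₂_sub : IsMF ⊤ 4 (D E₂ - (1 / 12 : ℂ) • (E₂ * E₂)) := by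
  have hd : MDiff (D E₂ - (1 / 12 : ℂ) • (E₂ * E₂)) :=
    (normalizedDerivOfComplex_mdifferentiable E2_mdifferentiable).sub
      ((E2_mdifferentiable.mul E2_mdifferentiable).const_smul _)
  have hπ : (π : ℂ) ≠ 0 := mod_cast Real.pi_ne_zero
  have hslash (γ : SL(2, ℤ)) : (D E₂ - (1 / 12 : ℂ) • (E₂ * E₂)) ∣[(4 : ℤ)] γ =
      D E₂ - (1 / 12 : ℂ) • (E₂ * E₂) := by
    have e1 : E₂ ∣[(2 : ℤ)] γ = fun z ↦ E₂ z + κ * cocycle γ z := funext (E₂_slash γ)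
    have e2 : (E₂ * E₂) ∣[(4 : ℤ)] γ = E₂ ∣[(2 : ℤ)] γ * E₂ ∣[(2 : ℤ)] γ :=
      ModularForm.mul_slash_SL2 2 2 γ E₂ E₂
    have e3 := normalizedDerivOfComplex_SL_slash (k := 2) E2_mdifferentiable (γ := γ)
    ext z
    have e4 : D (E₂ ∣[(2 : ℤ)] γ) z = D E₂ z - (2 * π * I)⁻¹ * κ * cocycle γ z ^ 2 := by
      have h1 := (mdifferentiableAt_iff.mp (E2_mdifferentiable z)).hasDerivAt
      have h2 := h1.add ((hasDerivAt_cocycle γ z).const_mul κ)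
      rw [e1, normalizedDerivOfComplex, normalizedDerivOfComplex]
      rw [show (fun z ↦ E₂ z + κ * cocycle γ z) ∘ ofComplex = E₂ ∘ ofComplex +
        fun w ↦ κ * (cocycle γ ∘ ofComplex) w from rfl, h2.deriv]
      ring
    have e5 := congrFun e3 z
    rw [e4, Pi.sub_apply, E₂_slash, ModularGroup.denom_apply] at e5
    rw [sub_slash, ModularForm.SL_smul_slash, e2, e1]
    simp only [Pi.sub_apply, Pi.smul_apply, Pi.mul_apply, smul_eq_mul]
    have e6 : (D E₂ ∣[(4 : ℤ)] γ) z = D E₂ z - (2 * π * I)⁻¹ * κ * cocycle γ z ^ 2 +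
        2 * (2 * π * I)⁻¹ * cocycle γ z * (E₂ z + κ * cocycle γ z) := by
      rw [e5]
      simp [cocycle]
    rw [e6, κ]
    field_simp
    ring
  refine ⟨hd, fun γ _ ↦ hslash γ, fun γ ↦ ?_⟩
  rw [hslash]
  refine (hasQExp_E₂.tendsto_normalizedDeriv.isBigO_one ℝ).sub ?_
  exact ((hasQExp_E₂.mul hasQExp_E₂).smul _).bdd

/-- Ramanujan's identity; the weight four form `D E₂ - E₂ ^ 2 / 12` has the value `-1 / 12`
at `i∞`. -/
lemma hasD_E₂ : HasD E₂ ((1 / 12 : ℂ) • (E₂ * E₂ - E₄)) := by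
  refine ⟨E2_mdifferentiable, ?_⟩
  have := isMF_D_E₂_sub.eq_of_tendsto (isMF_E₄.smul (-1 / 12)) (by norm_num) (c := -1 / 12) ?_ ?_
  · rw [sub_eq_iff_eq_add] at this
    rw [this]
    module
  · have := hasQExp_E₂.tendsto_normalizedDeriv.sub ((tendsto_E₂.mul tendsto_E₂).const_mul (1 / 12))
    simpa [neg_div] using! this
  · simpa using! tendsto_E₄.const_mul (-1 / 12)

lemma isMF_serreDerivative {k : ℤ} {f : ℍ → ℂ} (hf : IsMF ⊤ k f) :
    IsMF ⊤ (k + 2) (serreDerivative k f) := by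
  have h (γ : SL(2, ℤ)) : serreDerivative k f ∣[k + 2] γ = serreDerivative k f :=
    serreDerivative_slash_invariant hf.mdiff (hf.slash γ trivial)
  refine ⟨serreDerivative_mdifferentiable _ hf.mdiff, fun γ _ ↦ h γ, fun γ ↦ ?_⟩
  rw [h]
  refine (hf.hasQExp.tendsto_normalizedDeriv.isBigO_one ℝ).sub ?_
  exact (((HasQExp.const (k * 12⁻¹ : ℂ)).mul hasQExp_E₂).mul hf.hasQExp).bdd

lemma tendsto_serreDerivative {k : ℤ} {f : ℍ → ℂ} (hf : IsMF ⊤ k f)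
    (h1 : Tendsto f atImInfty (𝓝 1)) : Tendsto (serreDerivative k f) atImInfty (𝓝 (-k / 12)) := by
  have := hf.hasQExp.tendsto_normalizedDeriv.sub ((tendsto_E₂.const_mul (k * 12⁻¹ : ℂ)).mul h1)
  simp only [mul_one, zero_sub] at this
  rw [neg_div, div_eq_mul_inv]
  exact this

lemma hasD_E₄ : HasD E₄ ((1 / 3 : ℂ) • (E₂ * E₄ - E₆)) := by
  refine ⟨isMF_E₄.mdiff, ?_⟩
  have := (isMF_serreDerivative isMF_E₄).eq_of_tendsto (isMF_E₆.smul (-(4 : ℤ) / 12)) (by norm_num)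
    (tendsto_serreDerivative isMF_E₄ tendsto_E₄)
    (by simpa using! tendsto_E₆.const_mul (-(4 : ℤ) / 12 : ℂ))
  ext z
  have := congrFun this z
  simp only [serreDerivative_apply, Pi.smul_apply, smul_eq_mul, Pi.sub_apply, Pi.mul_apply]
    at this ⊢
  push_cast at this
  linear_combination this

lemma hasD_E₆ : HasD E₆ ((1 / 2 : ℂ) • (E₂ * E₆ - E₄ * E₄)) := by
  refine ⟨isMF_E₆.mdiff, ?_⟩
  have := (isMF_serreDerivative isMF_E₆).eq_of_tendsto ((isMF_E₄.mul isMF_E₄).smul (-(6 : ℤ) / 12))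
    (by norm_num) (tendsto_serreDerivative isMF_E₆ tendsto_E₆)
    (by simpa using! (tendsto_E₄.mul tendsto_E₄).const_mul (-(6 : ℤ) / 12 : ℂ))
  ext z
  have := congrFun this z
  simp only [serreDerivative_apply, Pi.smul_apply, smul_eq_mul, Pi.sub_apply, Pi.mul_apply]
    at this ⊢
  push_cast at this
  linear_combination this

lemma E₄_apply (z : ℍ) : E₄ z = H₂ z ^ 2 + H₂ z * H₄ z + H₄ z ^ 2 := by
  rw [E₄_eq]
  simp only [Pi.add_apply, Pi.mul_apply]
  ring

lemma E₆_apply (z : ℍ) :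
    E₆ z = (H₂ z + 2 * H₄ z) * (2 * H₂ z + H₄ z) * (H₄ z - H₂ z) / 2 := by
  have := congrFun two_smul_E₆_eq z
  simp only [Pi.smul_apply, Pi.mul_apply, Pi.add_apply, Pi.sub_apply, smul_eq_mul] at this
  linear_combination this / 2

/-- Up to a constant the discriminant is the square of `H₂ H₄ (H₂ + H₄)`. -/
lemma theta_prod_ne_zero (z : ℍ) : H₂ z * H₄ z * (H₂ z + H₄ z) ≠ 0 := by
  intro h
  refine ModularForm.discriminant_ne_zero z ?_
  rw [ModularForm.discriminant_eq_E₄_cube_sub_E₆_sq, ← E₄, ← E₆, E₄_apply, E₆_apply]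
  linear_combination H₂ z * H₄ z * (H₂ z + H₄ z) / 256 * h

/-- The derivatives of `H₂` and `H₄` are determined by those of `E₄` and `E₆`, since the Jacobian of
`(E₄, E₆)` with respect to `(H₂, H₄)` is a multiple of `H₂ H₄ (H₂ + H₄)`. -/
lemma D_theta (z : ℍ) :
    D H₂ z = (E₂ z * H₂ z + H₂ z ^ 2 + 2 * H₂ z * H₄ z) / 6 ∧
    D H₄ z = (E₂ z * H₄ z - 2 * H₂ z * H₄ z - H₄ z ^ 2) / 6 := by
  have h2 : HasD H₂ (D H₂) := ⟨mdiff_H₂, rfl⟩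
  have h4 : HasD H₄ (D H₄) := ⟨mdiff_H₄, rfl⟩
  have e4 := congrFun ((((h2.mul h2).add (h2.mul h4)).add (h4.mul h4)).eq.symm.trans
    (E₄_eq ▸ hasD_E₄.eq)) z
  have e6 := congrFun ((((h2.add (h4.smul 2)).mul ((h2.smul 2).add h4)).mul
    (h4.sub h2)).eq.symm.trans (two_smul_E₆_eq ▸ (hasD_E₆.smul 2).eq)) z
  have hj := theta_prod_ne_zero z
  rw [← E₄_eq] at e4
  simp only [Pi.smul_apply, Pi.mul_apply, Pi.add_apply, Pi.sub_apply, smul_eq_mul, E₄_apply,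
    E₆_apply] at e4 e6
  set x := H₂ z
  set y := H₄ z
  -- Cramer's rule
  constructor
  · refine mul_left_cancel₀ hj ?_
    linear_combination (6 * y ^ 2 + 6 * x * y - 3 * x ^ 2) / 27 * e4 - (x + 2 * y) / 27 * e6
  · refine mul_left_cancel₀ hj ?_
    linear_combination -(3 * y ^ 2 - 6 * x * y - 6 * x ^ 2) / 27 * e4 + (2 * x + y) / 27 * e6

/-! ### Duplication of the argument -/

lemma coe_double (z : ℍ) : (double z : ℂ) = 2 * z := rfl

lemma level2_comp_ofComplex {f : ℍ → ℂ} {w : ℂ} (hw : 0 < w.im) :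
    (level2 f ∘ ofComplex) w = (f ∘ ofComplex) (2 * w) := by
  have h2 : 0 < (2 * w).im := by simpa using hw
  simp only [Function.comp_apply, level2, ofComplex_apply_of_im_pos hw,
    ofComplex_apply_of_im_pos h2]
  rfl

lemma hasD_level2 {f g : ℍ → ℂ} (hf : HasD f g) : HasD (level2 f) ((2 : ℂ) • level2 g) := by
  have key (z : ℍ) :
      HasDerivAt (level2 f ∘ ofComplex) (2 * deriv (f ∘ ofComplex) (double z)) z := by
    have h1 := (mdifferentiableAt_iff.mp (hf.mdiff (double z))).hasDerivAt
    have h2 : HasDerivAt (fun w : ℂ ↦ 2 * w) 2 z := by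
      simpa using (hasDerivAt_id (z : ℂ)).const_mul 2
    have h3 : HasDerivAt ((f ∘ ofComplex) ∘ fun w ↦ 2 * w) _ (z : ℂ) :=
      HasDerivAt.comp (z : ℂ) h1 h2
    rw [mul_comm]
    refine h3.congr_of_eventuallyEq ?_
    filter_upwards [isOpen_upperHalfPlaneSet.mem_nhds z.im_pos] with w hw
    exact level2_comp_ofComplex hw
  refine ⟨fun z ↦ mdifferentiableAt_iff.mpr (key z).differentiableAt, ?_⟩
  ext z
  rw [normalizedDerivOfComplex, (key z).deriv, ← hf.eq]
  simp only [Pi.smul_apply, smul_eq_mul, level2, normalizedDerivOfComplex]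
  ring

/-- Substituting `m = a + b`, `n = a - b` or `m = a + b + 1`, `n = a - b` in the double series of
`Θ₃ ^ 2`, according to the parity of `m + n`. -/
lemma Θ₃_sq (z : ℍ) : Θ₃ z ^ 2 = Θ₃ (double z) ^ 2 + Θ₂ (double z) ^ 2 := by
  have hsum {f : ℤ → ℂ} {a : ℂ} (hf : HasSum f a) :
      HasSum (fun p : ℤ × ℤ ↦ f p.1 * f p.2) (a ^ 2) := by
    rw [sq]
    exact hf.mul hf (summable_mul_of_summable_norm hf.summable.norm hf.summable.norm)
  have h := hsum (hasSum_jacobiTheta z.im_pos)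
  have h3 := hsum (hasSum_jacobiTheta (double z).im_pos)
  have h2 := hsum (hasSum_Θ₂ (double z).im_pos)
  set f : ℤ × ℤ → ℂ := fun p ↦ cexp (π * I * (p.1 : ℂ) ^ 2 * z) * cexp (π * I * (p.2 : ℂ) ^ 2 * z)
    with hf
  let e : ℤ × ℤ → ℤ × ℤ := fun p ↦ (p.1 + p.2, p.1 - p.2)
  let o : ℤ × ℤ → ℤ × ℤ := fun p ↦ (p.1 + p.2 + 1, p.1 - p.2)
  have he : Function.Injective e := fun p q h ↦ by
    simp only [e, Prod.mk.injEq] at h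
    ext <;> omega
  have ho : Function.Injective o := fun p q h ↦ by
    simp only [o, Prod.mk.injEq] at h
    ext <;> omega
  have e1 : HasSum (f ∘ e) (jacobiTheta (double z) ^ 2) := by
    refine h3.congr_fun fun p ↦ ?_
    simp only [hf, Function.comp_apply, e, ← Complex.exp_add, coe_double]
    congr 1
    push_cast
    ring
  have e2 : HasSum (f ∘ o) ((jacobiTheta (double z / 4) - jacobiTheta (double z)) ^ 2) := by
    refine h2.congr_fun fun p ↦ ?_
    simp only [hf, Function.comp_apply, o, ← Complex.exp_add, coe_double]
    congr 1
    push_cast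
    ring
  have hc : IsCompl (Set.range e) (Set.range o) := by
    have r1 : Set.range e = {p | Even (p.1 + p.2)} := by
      ext ⟨m, n⟩
      simp only [Set.mem_range, Prod.exists, e, Prod.mk.injEq, Set.mem_ofPred_eq]
      constructor
      · rintro ⟨a, b, rfl, rfl⟩
        exact ⟨a, by ring⟩
      · rintro ⟨a, ha⟩
        exact ⟨a, m - a, by omega, by omega⟩
    have r2 : Set.range o = {p | Even (p.1 + p.2)}ᶜ := by
      ext ⟨m, n⟩
      simp only [Set.mem_range, Prod.exists, o, Prod.mk.injEq, Set.mem_compl_iff, Set.mem_ofPred_eq,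
        Int.not_even_iff_odd]
      constructor
      · rintro ⟨a, b, rfl, rfl⟩
        exact ⟨a, by ring⟩
      · rintro ⟨a, ha⟩
        exact ⟨a, m - a - 1, by omega, by omega⟩
    rw [r1, r2]
    exact isCompl_compl
  rw [Θ₂_eq, Θ₃, Θ₃]
  exact h.unique (HasSum.add_isCompl hc (he.hasSum_range_iff.mpr e1) (ho.hasSum_range_iff.mpr e2))

/-- The translate of `Θ₃_sq` by `z ↦ z + 1`. -/
lemma Θ₄_sq (z : ℍ) : Θ₄ z ^ 2 = Θ₃ (double z) ^ 2 - Θ₂ (double z) ^ 2 := by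
  have e : double ((1 : ℝ) +ᵥ z) = (1 : ℝ) +ᵥ ((1 : ℝ) +ᵥ double z) := by
    ext
    simp only [coe_double, coe_vadd, ofReal_one]
    ring
  have h := Θ₃_sq ((1 : ℝ) +ᵥ z)
  rw [e, Θ₃_vadd_one, Θ₃_vadd_one, Θ₄_vadd_one, Θ₂_vadd_one, Θ₂_vadd_one, ← mul_assoc, mul_pow,
    ← Complex.exp_add, ← Complex.exp_nat_mul] at h
  rw [h, show ((2 : ℕ) : ℂ) * (π * I / 4 + π * I / 4) = π * I by push_cast; ring,
    Complex.exp_pi_mul_I]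
  ring

lemma H₃_apply (z : ℍ) : H₃ z = H₂ z + H₄ z := congrFun H₃_eq z

lemma B_apply (z : ℍ) : B z = H₂ z + 2 * H₄ z := rfl

lemma A_apply (z : ℍ) : A z = H₂ z ^ 2 := rfl

lemma hh_apply (z : ℍ) : hh z = H₄ z * (H₂ z + H₄ z) := rfl

lemma H₄_double_sq (z : ℍ) : H₄ (double z) ^ 2 = hh z := by
  have h3 := H₃_apply (double z)
  have h3' := H₃_apply z
  rw [hh_apply, ← h3']
  simp only [H₂, H₃, H₄, Pi.pow_apply] at *
  have a := Θ₃_sq z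
  have b := Θ₄_sq z
  have a' : Θ₃ z ^ 4 = (Θ₃ (double z) ^ 2 + Θ₂ (double z) ^ 2) ^ 2 := by rw [← a]; ring
  have b' : Θ₄ z ^ 4 = (Θ₃ (double z) ^ 2 - Θ₂ (double z) ^ 2) ^ 2 := by rw [← b]; ring
  have c : Θ₄ (double z) ^ 4 = Θ₃ (double z) ^ 4 - Θ₂ (double z) ^ 4 := by rw [h3]; ring
  rw [a', b', c]
  ring

lemma H₂_double (z : ℍ) : 4 * H₂ (double z) = B z - 2 * H₄ (double z) := by
  have h3 := H₃_apply (double z)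
  have h3' := H₃_apply z
  have e : B z = H₃ z + H₄ z := by rw [h3', B_apply]; ring
  rw [e]
  simp only [H₂, H₃, H₄, Pi.pow_apply] at *
  have a' : Θ₃ z ^ 4 = (Θ₃ (double z) ^ 2 + Θ₂ (double z) ^ 2) ^ 2 := by rw [← Θ₃_sq z]; ring
  have b' : Θ₄ z ^ 4 = (Θ₃ (double z) ^ 2 - Θ₂ (double z) ^ 2) ^ 2 := by rw [← Θ₄_sq z]; ring
  rw [a', b']
  linear_combination -2 * h3

lemma E₄_eq_B (z : ℍ) : E₄ z = B z ^ 2 - 3 * hh z := by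
  rw [E₄_apply, B_apply, hh_apply]
  ring

lemma E₆_eq_B (z : ℍ) : E₆ z = B z * (9 * hh z - 2 * B z ^ 2) / 2 := by
  rw [E₆_apply, B_apply, hh_apply]
  ring

lemma E₄_double (z : ℍ) : E₄ (double z) = (B z ^ 2 + 12 * hh z) / 16 := by
  have h : H₂ (double z) = (B z - 2 * H₄ (double z)) / 4 := by linear_combination H₂_double z / 4
  rw [E₄_apply, h, ← H₄_double_sq]
  ring

lemma E₆_double (z : ℍ) : E₆ (double z) = B z * (36 * hh z - B z ^ 2) / 64 := by
  have h : H₂ (double z) = (B z - 2 * H₄ (double z)) / 4 := by linear_combination H₂_double z / 4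
  rw [E₆_apply, h, ← H₄_double_sq]
  ring

lemma hh_ne_zero (z : ℍ) : hh z ≠ 0 := by
  have := theta_prod_ne_zero z
  rw [mul_assoc] at this
  exact right_ne_zero_of_mul this

lemma hasD_H₂ : HasD H₂ ((1 / 6 : ℂ) • (E₂ * H₂ + H₂ * H₂ + (2 : ℂ) • (H₂ * H₄))) := by
  refine ⟨mdiff_H₂, funext fun z ↦ (D_theta z).1.trans ?_⟩
  simp only [Pi.smul_apply, Pi.mul_apply, Pi.add_apply, smul_eq_mul]
  ring

lemma hasD_H₄ : HasD H₄ ((1 / 6 : ℂ) • (E₂ * H₄ - (2 : ℂ) • (H₂ * H₄) - H₄ * H₄)) := by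
  refine ⟨mdiff_H₄, funext fun z ↦ (D_theta z).2.trans ?_⟩
  simp only [Pi.smul_apply, Pi.mul_apply, Pi.sub_apply, smul_eq_mul]
  ring

lemma hasD_B : HasD B ((1 / 6 : ℂ) • (E₂ * B + B * B - (6 : ℂ) • hh)) := by
  have h := hasD_H₂.add (hasD_H₄.smul 2)
  rw [← B_eq] at h
  refine h.congr ?_
  ext z
  simp only [Pi.smul_apply, Pi.mul_apply, Pi.add_apply, Pi.sub_apply, smul_eq_mul, B_apply,
    hh_apply]
  ring

lemma hasD_hh : HasD hh ((1 / 6 : ℂ) • (hh * ((2 : ℂ) • E₂ - B))) := by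
  refine (hasD_H₄.mul (hasD_H₂.add hasD_H₄)).congr ?_
  ext z
  simp only [Pi.smul_apply, Pi.mul_apply, Pi.add_apply, Pi.sub_apply, smul_eq_mul, B_apply,
    hh_apply]
  ring

/-- Logarithmic differentiation of `H₄ (2 z) ^ 2 = h z`. -/
lemma E₂_double (z : ℍ) : E₂ (double z) = (2 * E₂ z + B z) / 4 := by
  have h : level2 H₄ * level2 H₄ = hh := by
    ext z
    rw [← H₄_double_sq, sq]
    rfl
  have hd := (hasD_level2 hasD_H₄).mul (hasD_level2 hasD_H₄)
  rw [h] at hd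
  have e := congrFun (hd.eq.symm.trans hasD_hh.eq) z
  simp only [Pi.smul_apply, Pi.mul_apply, Pi.add_apply, Pi.sub_apply, smul_eq_mul, level2] at e
  have h2 := H₂_double z
  have h0 := hh_ne_zero z
  rw [← H₄_double_sq] at e h0
  refine mul_left_cancel₀ h0 ?_
  linear_combination (3 / 2) * e + H₄ (double z) ^ 2 / 2 * h2

/-! ### Modularity and quasimodularity -/

/-- A level one form `f` for which `z ↦ f (2 z)` is known to have level `Γ₀(2)`. -/
structure IsMFDouble (k : ℤ) (f : ℍ → ℂ) : Prop where
  isMF : IsMF ⊤ k f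
  level2 : IsMF (CongruenceSubgroup.Gamma0 2) k (level2 f)

namespace IsMFDouble

variable {k l : ℤ} {f g : ℍ → ℂ}

lemma add (hf : IsMFDouble k f) (hg : IsMFDouble k g) : IsMFDouble k (f + g) :=
  ⟨hf.isMF.add hg.isMF, hf.level2.add hg.level2⟩

lemma mul (hf : IsMFDouble k f) (hg : IsMFDouble l g) : IsMFDouble (k + l) (f * g) :=
  ⟨hf.isMF.mul hg.isMF, hf.level2.mul hg.level2⟩

lemma smul (hf : IsMFDouble k f) (c : ℂ) : IsMFDouble k (c • f) :=
  ⟨hf.isMF.smul c, hf.level2.smul c⟩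

end IsMFDouble

lemma isMFDouble_E₄ : IsMFDouble 4 E₄ := by
  refine ⟨isMF_E₄, ?_⟩
  refine ((isMF_B.mul isMF_B).add (isMF_hh.smul 12)).smul (1 / 16) |>.congr rfl ?_
  ext z
  rw [level2, E₄_double]
  simp only [Pi.smul_apply, Pi.mul_apply, Pi.add_apply, smul_eq_mul]
  ring

lemma isMFDouble_E₆ : IsMFDouble 6 E₆ := by
  refine ⟨isMF_E₆, ?_⟩
  refine (isMF_B.mul ((isMF_hh.smul 36).sub (isMF_B.mul isMF_B))).smul (1 / 64) |>.congr rfl ?_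
  ext z
  rw [level2, E₆_double]
  simp only [Pi.smul_apply, Pi.mul_apply, Pi.sub_apply, smul_eq_mul]
  ring

/-- Doubling the argument: by `E₂_double` the form `z ↦ f (2 z)` is again a polynomial in `E₂`. -/
lemma isQuasimodular_sub_smul_level2 {w : ℤ} {a b c : ℍ → ℂ} (hc : IsMFDouble (w - 4) c)
    (hb : IsMFDouble (w - 2) b) (ha : IsMFDouble w a) (m : ℂ) :
    IsQuasimodular (CongruenceSubgroup.Gamma0 2) w 2
      ((c * E₂ ^ 2 + b * E₂ + a) - m • level2 (c * E₂ ^ 2 + b * E₂ + a)) := by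
  have hBc : IsMF (CongruenceSubgroup.Gamma0 2) (w - 2) (B * level2 c) :=
    (isMF_B.mul hc.level2).congr (by ring) rfl
  have hBBc : IsMF (CongruenceSubgroup.Gamma0 2) w (B * (B * level2 c)) :=
    (isMF_B.mul hBc).congr (by ring) rfl
  have hBb : IsMF (CongruenceSubgroup.Gamma0 2) w (B * level2 b) :=
    (isMF_B.mul hb.level2).congr (by ring) rfl
  have h := isQuasimodular_of_poly (w := w)
    ((hc.isMF.mono le_top).sub (hc.level2.smul (m / 4)))
    ((hb.isMF.mono le_top).sub ((hBc.smul (m / 4)).add (hb.level2.smul (m / 2))))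
    ((ha.isMF.mono le_top).sub
      (((hBBc.smul (m / 16)).add (hBb.smul (m / 4))).add (ha.level2.smul m)))
  convert h using 1
  ext z
  simp only [Pi.smul_apply, Pi.mul_apply, Pi.sub_apply, Pi.add_apply, Pi.pow_apply, smul_eq_mul,
    level2, E₂_double]
  ring

lemma X₈_eq : X₈ = ((-7 / 362880 : ℂ) • E₄) * E₂ ^ 2 + ((2 / 362880 : ℂ) • E₆) * E₂ +
    (5 / 362880 : ℂ) • (E₄ * E₄) := by
  ext z
  simp [X₈]
  ring

lemma X₁₀_eq : X₁₀ = ((5 / 1088640 : ℂ) • E₆) * E₂ ^ 2 + ((2 / 1088640 : ℂ) • (E₄ * E₄)) * E₂ +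
    (-7 / 1088640 : ℂ) • (E₄ * E₆) := by
  ext z
  simp [X₁₀]
  ring

lemma X₁₂_eq : X₁₂ = ((-77 / 798336000 : ℂ) • (E₄ * E₄)) * E₂ ^ 2 +
    ((34 / 798336000 : ℂ) • (E₄ * E₆)) * E₂ +
    ((50 / 798336000 : ℂ) • (E₄ * E₄ * E₄) + (-7 / 798336000 : ℂ) • (E₆ * E₆)) := by
  ext z
  simp [X₁₂]
  ring

lemma isQuasimodular_X₈ : IsQuasimodular ⊤ 8 2 X₈ := by
  rw [X₈_eq]
  exact isQuasimodular_of_poly (isMF_E₄.smul _) (isMF_E₆.smul _) ((isMF_E₄.mul isMF_E₄).smul _)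

lemma isQuasimodular_X₁₀ : IsQuasimodular ⊤ 10 2 X₁₀ := by
  rw [X₁₀_eq]
  exact isQuasimodular_of_poly (isMF_E₆.smul _) ((isMF_E₄.mul isMF_E₄).smul _)
    ((isMF_E₄.mul isMF_E₆).smul _)

lemma isQuasimodular_X₁₂ : IsQuasimodular ⊤ 12 2 X₁₂ := by
  rw [X₁₂_eq]
  exact isQuasimodular_of_poly ((isMF_E₄.mul isMF_E₄).smul _) ((isMF_E₄.mul isMF_E₆).smul _)
    ((((isMF_E₄.mul isMF_E₄).mul isMF_E₄).smul _).add ((isMF_E₆.mul isMF_E₆).smul _))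

lemma isQuasimodular_Xt₈ : IsQuasimodular (CongruenceSubgroup.Gamma0 2) 8 2 Xt₈ := by
  have h : Xt₈ = X₈ - (2 ^ 7 : ℂ) • level2 X₈ := rfl
  rw [h, X₈_eq]
  exact isQuasimodular_sub_smul_level2 (isMFDouble_E₄.smul _) (isMFDouble_E₆.smul _)
    ((isMFDouble_E₄.mul isMFDouble_E₄).smul _) _

lemma isQuasimodular_Xt₁₀ : IsQuasimodular (CongruenceSubgroup.Gamma0 2) 10 2 Xt₁₀ := by
  have h : Xt₁₀ = X₁₀ - (2 ^ 9 : ℂ) • level2 X₁₀ := rfl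
  rw [h, X₁₀_eq]
  exact isQuasimodular_sub_smul_level2 (isMFDouble_E₆.smul _)
    ((isMFDouble_E₄.mul isMFDouble_E₄).smul _) ((isMFDouble_E₄.mul isMFDouble_E₆).smul _) _

lemma isQuasimodular_Xt₁₂ : IsQuasimodular (CongruenceSubgroup.Gamma0 2) 12 2 Xt₁₂ := by
  have h : Xt₁₂ = X₁₂ - (2 ^ 11 : ℂ) • level2 X₁₂ := rfl
  rw [h, X₁₂_eq]
  exact isQuasimodular_sub_smul_level2 ((isMFDouble_E₄.mul isMFDouble_E₄).smul _)
    ((isMFDouble_E₄.mul isMFDouble_E₆).smul _)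
    ((((isMFDouble_E₄.mul isMFDouble_E₄).mul isMFDouble_E₄).smul _).add
      ((isMFDouble_E₆.mul isMFDouble_E₆).smul _)) _

lemma isQuasimodular_F : IsQuasimodular ⊤ 16 2 F := by
  have h444 := (isMF_E₄.mul isMF_E₄).mul isMF_E₄
  have h66 := isMF_E₆.mul isMF_E₆
  have h := isQuasimodular_of_poly (Γ := ⊤) (w := 16) ((h444.smul 49).sub (h66.smul 25))
    (((isMF_E₄.mul isMF_E₄).mul isMF_E₆).smul (-48))
    (((isMF_E₄.mul h66).smul 49).sub ((h444.mul isMF_E₄).smul 25))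
  convert h using 1
  ext z
  simp [F]
  ring

lemma isMF_G : IsMF (CongruenceSubgroup.Gamma 2) 14 G := by
  refine ((isMF_H₂.pow 5).mul ((((isMF_H₂.mul isMF_H₂).smul 2).add
    ((isMF_H₂.mul isMF_H₄).smul 7)).add ((isMF_H₄.mul isMF_H₄).smul 7))).congr rfl ?_
  ext z
  simp only [G, Pi.mul_apply, Pi.add_apply, Pi.smul_apply, Pi.pow_apply, Pi.ofNat_apply,
    smul_eq_mul]
  ring

/-- `K₁₀` is a polynomial in the `Γ₀(2)`-forms `A`, `h` and `B`; likewise `K₁₂` and `K₁₄`. -/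
lemma isMF_K₁₀ : IsMF (CongruenceSubgroup.Gamma0 2) 10 K₁₀ := by
  refine ((((isMF_A.mul isMF_A).smul 23).add ((isMF_A.mul isMF_hh).smul 46)).add
    ((isMF_hh.mul isMF_hh).smul 8)).smul (-2) |>.mul isMF_B |>.congr rfl ?_
  ext z
  simp only [K₁₀, A_apply, hh_apply, B_apply, Pi.mul_apply, Pi.add_apply,
    Pi.neg_apply, Pi.smul_apply, Pi.pow_apply, Pi.ofNat_apply, smul_eq_mul]
  ring

lemma isMF_K₁₂ : IsMF (CongruenceSubgroup.Gamma0 2) 12 K₁₂ := by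
  refine ((((isMF_A.mul isMF_A).smul 10).add ((isMF_A.mul isMF_hh).smul 35)).sub
    ((isMF_hh.mul isMF_hh).smul 32)).smul (-2) |>.mul (isMF_A.add isMF_hh) |>.congr rfl ?_
  ext z
  simp only [K₁₂, A_apply, hh_apply, Pi.mul_apply, Pi.add_apply, Pi.sub_apply,
    Pi.neg_apply, Pi.smul_apply, Pi.pow_apply, Pi.ofNat_apply, smul_eq_mul]
  ring

lemma isMF_K₁₄ : IsMF (CongruenceSubgroup.Gamma0 2) 14 K₁₄ := by
  refine ((((((isMF_A.mul isMF_A).mul isMF_A).smul 26).add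
    (((isMF_A.mul isMF_A).mul isMF_hh).smul 78)).add
    (((isMF_A.mul isMF_hh).mul isMF_hh).smul 99)).sub
    (((isMF_hh.mul isMF_hh).mul isMF_hh).smul 16)).mul isMF_B |>.congr rfl ?_
  ext z
  simp only [K₁₄, A_apply, hh_apply, B_apply, Pi.mul_apply, Pi.add_apply, Pi.sub_apply,
    Pi.smul_apply, Pi.pow_apply, Pi.ofNat_apply, smul_eq_mul]
  ring

lemma Gamma_two_le_Gamma0 : CongruenceSubgroup.Gamma 2 ≤ CongruenceSubgroup.Gamma0 2 :=
  fun _ h ↦ CongruenceSubgroup.Gamma0_mem.mpr (CongruenceSubgroup.Gamma_mem.mp h).2.2.1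

lemma isQuasimodular_L : IsQuasimodular (CongruenceSubgroup.Gamma 2) 14 2 L :=
  isQuasimodular_of_poly (isMF_K₁₀.mono Gamma_two_le_Gamma0) (isMF_K₁₂.mono Gamma_two_le_Gamma0)
    (isMF_K₁₄.mono Gamma_two_le_Gamma0)

/-! ### Two identities for `L` -/

lemma F_apply (z : ℍ) : F z = 49 * E₂ z ^ 2 * E₄ z ^ 3 - 25 * E₂ z ^ 2 * E₆ z ^ 2
    - 48 * E₂ z * E₄ z ^ 2 * E₆ z - 25 * E₄ z ^ 4 + 49 * E₄ z * E₆ z ^ 2 := rfl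

lemma G_apply (z : ℍ) :
    G z = H₂ z ^ 5 * (2 * H₂ z ^ 2 + 7 * H₂ z * H₄ z + 7 * H₄ z ^ 2) := rfl

lemma mdiff_F : MDiff F := isQuasimodular_F.1

lemma mdiff_G : MDiff G := isMF_G.mdiff

lemma D_F (z : ℍ) : D F z =
    49 * (2 * E₂ z * E₄ z ^ 3 * D E₂ z + 3 * E₂ z ^ 2 * E₄ z ^ 2 * D E₄ z)
    - 25 * (2 * E₂ z * E₆ z ^ 2 * D E₂ z + 2 * E₂ z ^ 2 * E₆ z * D E₆ z)
    - 48 * (E₄ z ^ 2 * E₆ z * D E₂ z + 2 * E₂ z * E₄ z * E₆ z * D E₄ z + E₂ z * E₄ z ^ 2 * D E₆ z)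
    - 100 * E₄ z ^ 3 * D E₄ z + 49 * (E₆ z ^ 2 * D E₄ z + 2 * E₄ z * E₆ z * D E₆ z) := by
  have h2 : HasD E₂ (D E₂) := ⟨hasD_E₂.mdiff, rfl⟩
  have h4 : HasD E₄ (D E₄) := ⟨hasD_E₄.mdiff, rfl⟩
  have h6 : HasD E₆ (D E₆) := ⟨hasD_E₆.mdiff, rfl⟩
  have h := (((((h2.pow 2).ofNat_mul 49).mul (h4.pow 3)).sub
    (((h2.pow 2).ofNat_mul 25).mul (h6.pow 2))).sub
    (((h2.ofNat_mul 48).mul (h4.pow 2)).mul h6)).sub ((h4.pow 4).ofNat_mul 25) |>.add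
    ((h4.ofNat_mul 49).mul (h6.pow 2))
  refine (congrFun h.eq z).trans ?_
  simp
  ring

lemma D_G (z : ℍ) : D G z =
    5 * H₂ z ^ 4 * D H₂ z * (2 * H₂ z ^ 2 + 7 * H₂ z * H₄ z + 7 * H₄ z ^ 2) +
    H₂ z ^ 5 * (4 * H₂ z * D H₂ z + 7 * (D H₂ z * H₄ z + H₂ z * D H₄ z) +
      14 * H₄ z * D H₄ z) := by
  have h2 : HasD H₂ (D H₂) := ⟨mdiff_H₂, rfl⟩
  have h4 : HasD H₄ (D H₄) := ⟨mdiff_H₄, rfl⟩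
  have h := (h2.pow 5).mul ((((h2.pow 2).ofNat_mul 2).add ((h2.ofNat_mul 7).mul h4)).add
    ((h4.pow 2).ofNat_mul 7))
  refine (congrFun h.eq z).trans ?_
  simp only [Pi.mul_apply, Pi.add_apply, Pi.pow_apply, Pi.ofNat_apply,
    Nat.reduceSub, Nat.cast_ofNat]
  ring

lemma D_E₂ (z : ℍ) : D E₂ z = (E₂ z ^ 2 - E₄ z) / 12 := by
  rw [hasD_E₂.eq]
  simp
  ring

lemma D_E₄ (z : ℍ) : D E₄ z = (E₂ z * E₄ z - E₆ z) / 3 := by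
  rw [hasD_E₄.eq]
  simp
  ring

lemma D_E₆ (z : ℍ) : D E₆ z = (E₂ z * E₆ z - E₄ z ^ 2) / 2 := by
  rw [hasD_E₆.eq]
  simp
  ring

lemma L_apply (z : ℍ) : L z =
    -2 * (23 * H₂ z ^ 4 + 46 * H₂ z ^ 3 * H₄ z + 54 * H₂ z ^ 2 * H₄ z ^ 2 + 16 * H₂ z * H₄ z ^ 3 +
      8 * H₄ z ^ 4) * (H₂ z + 2 * H₄ z) * E₂ z ^ 2 +
    -2 * (10 * H₂ z ^ 4 + 35 * H₂ z ^ 3 * H₄ z + 3 * H₂ z ^ 2 * H₄ z ^ 2 - 64 * H₂ z * H₄ z ^ 3 -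
      32 * H₄ z ^ 4) * (H₂ z ^ 2 + H₂ z * H₄ z + H₄ z ^ 2) * E₂ z +
    (26 * H₂ z ^ 6 + 78 * H₂ z ^ 5 * H₄ z + 177 * H₂ z ^ 4 * H₄ z ^ 2 +
      182 * H₂ z ^ 3 * H₄ z ^ 3 + 51 * H₂ z ^ 2 * H₄ z ^ 4 - 48 * H₂ z * H₄ z ^ 5 -
      16 * H₄ z ^ 6) * (H₂ z + 2 * H₄ z) := rfl

/-- After Ramanujan's identities and `D_theta` both sides are polynomials in `E₂, H₂, H₄`. -/
lemma wronskian_eq (z : ℍ) : wronskian z =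
    105 / 8 * H₂ z ^ 5 * H₄ z ^ 2 * (H₂ z + H₄ z) ^ 2 * L z := by
  have h : wronskian z = D F z * G z - F z * D G z := rfl
  rw [h, D_F, D_G, D_E₂, D_E₄, D_E₆, (D_theta z).1, (D_theta z).2, F_apply, G_apply, L_apply,
    E₄_apply, E₆_apply]
  ring

lemma wronskian_eq_serreDerivative :
    wronskian = serreDerivative 14 F * G - F * serreDerivative 14 G := by
  ext z
  simp only [wronskian, Pi.sub_apply, Pi.mul_apply, serreDerivative_apply]
  ring

lemma X₈_apply (z : ℍ) :
    X₈ z = (-7 * E₂ z ^ 2 * E₄ z + 2 * E₂ z * E₆ z + 5 * E₄ z ^ 2) / 362880 := by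
  simp [X₈]
  ring

lemma X₁₀_apply (z : ℍ) :
    X₁₀ z = (5 * E₂ z ^ 2 * E₆ z + 2 * E₂ z * E₄ z ^ 2 - 7 * E₄ z * E₆ z) / 1088640 := by
  simp [X₁₀]
  ring

lemma X₁₂_apply (z : ℍ) :
    X₁₂ z = (-77 * E₂ z ^ 2 * E₄ z ^ 2 + 34 * E₂ z * E₄ z * E₆ z + 50 * E₄ z ^ 3 - 7 * E₆ z ^ 2)
      / 798336000 := by
  simp [X₁₂]
  ring

lemma Xt₈_apply (z : ℍ) : Xt₈ z = X₈ z - 2 ^ 7 * X₈ (double z) := rfl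

lemma Xt₁₀_apply (z : ℍ) : Xt₁₀ z = X₁₀ z - 2 ^ 9 * X₁₀ (double z) := rfl

lemma Xt₁₂_apply (z : ℍ) : Xt₁₂ z = X₁₂ z - 2 ^ 11 * X₁₂ (double z) := rfl

/-- By the duplication formulas both sides are polynomials in `E₂, H₂, H₄`. -/
lemma L_eq (z : ℍ) : L z =
    78278400 * level2 X₈ z * A z * B z + 550800 * Xt₈ z * A z * B z
      + 90823680 * level2 X₁₀ z * A z + 116640 * Xt₁₀ z * A z
      + 678813696000 * level2 X₁₂ z * B z + 331776000 * Xt₁₂ z * B z := by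
  simp only [level2, Xt₈_apply, Xt₁₀_apply, Xt₁₂_apply, X₈_apply, X₁₀_apply, X₁₂_apply, E₂_double,
    E₄_double, E₆_double]
  rw [E₄_apply, E₆_apply, L_apply, A_apply, B_apply, hh_apply]
  ring

/-! ### Order of vanishing at infinity and extremality -/

/-- `f = a₀ + a₁ q + a₂ q ^ 2 + a₃ q ^ 3 + O(q ^ 4)`. -/
structure HasCoeffs (f : ℍ → ℂ) (a₀ a₁ a₂ a₃ : ℂ) : Prop where
  hasQExp : HasQExp f
  c₀ : (qExpansion 1 f).coeff 0 = a₀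
  c₁ : (qExpansion 1 f).coeff 1 = a₁
  c₂ : (qExpansion 1 f).coeff 2 = a₂
  c₃ : (qExpansion 1 f).coeff 3 = a₃

namespace HasCoeffs

variable {f g : ℍ → ℂ} {a₀ a₁ a₂ a₃ b₀ b₁ b₂ b₃ : ℂ}

lemma add (hf : HasCoeffs f a₀ a₁ a₂ a₃) (hg : HasCoeffs g b₀ b₁ b₂ b₃) :
    HasCoeffs (f + g) (a₀ + b₀) (a₁ + b₁) (a₂ + b₂) (a₃ + b₃) := by
  have h := qExpansion_add hf.hasQExp.analyticAt hg.hasQExp.analyticAt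
  refine ⟨hf.hasQExp.add hg.hasQExp, ?_, ?_, ?_, ?_⟩ <;> rw [h, map_add]
  exacts [by rw [hf.c₀, hg.c₀], by rw [hf.c₁, hg.c₁], by rw [hf.c₂, hg.c₂], by rw [hf.c₃, hg.c₃]]

lemma smul (c : ℂ) (hf : HasCoeffs f a₀ a₁ a₂ a₃) :
    HasCoeffs (c • f) (c * a₀) (c * a₁) (c * a₂) (c * a₃) := by
  have h := qExpansion_smul hf.hasQExp.analyticAt c
  refine ⟨hf.hasQExp.smul c, ?_, ?_, ?_, ?_⟩ <;> rw [h, PowerSeries.coeff_smul, smul_eq_mul]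
  exacts [by rw [hf.c₀], by rw [hf.c₁], by rw [hf.c₂], by rw [hf.c₃]]

lemma mul (hf : HasCoeffs f a₀ a₁ a₂ a₃) (hg : HasCoeffs g b₀ b₁ b₂ b₃) :
    HasCoeffs (f * g) (a₀ * b₀) (a₀ * b₁ + a₁ * b₀) (a₀ * b₂ + a₁ * b₁ + a₂ * b₀)
      (a₀ * b₃ + a₁ * b₂ + a₂ * b₁ + a₃ * b₀) := by
  have h := qExpansion_mul hf.hasQExp.analyticAt hg.hasQExp.analyticAt
  refine ⟨hf.hasQExp.mul hg.hasQExp, ?_, ?_, ?_, ?_⟩ <;>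
    simp only [h, PowerSeries.coeff_mul, Finset.Nat.sum_antidiagonal_eq_sum_range_succ_mk,
      Finset.sum_range_succ, Finset.sum_range_zero, Nat.succ_eq_add_one, Nat.reduceAdd, zero_add,
      Nat.reduceSub, hf.c₀, hf.c₁, hf.c₂, hf.c₃, hg.c₀, hg.c₁, hg.c₂, hg.c₃]

lemma congr {a₀' a₁' a₂' a₃' : ℂ} (hf : HasCoeffs f a₀ a₁ a₂ a₃) (h : f = g) (h₀ : a₀ = a₀')
    (h₁ : a₁ = a₁') (h₂ : a₂ = a₂') (h₃ : a₃ = a₃') : HasCoeffs g a₀' a₁' a₂' a₃' := by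
  subst h h₀ h₁ h₂ h₃
  exact hf

end HasCoeffs

lemma sigma_values : ArithmeticFunction.sigma 1 2 = 3 ∧ ArithmeticFunction.sigma 1 3 = 4 ∧
    ArithmeticFunction.sigma 3 2 = 9 ∧ ArithmeticFunction.sigma 3 3 = 28 ∧
    ArithmeticFunction.sigma 5 2 = 33 ∧ ArithmeticFunction.sigma 5 3 = 244 := by
  decide

lemma hasCoeffs_E₂ : HasCoeffs E₂ 1 (-24) (-72) (-96) := by
  obtain ⟨h2, h3, -⟩ := sigma_values
  refine ⟨hasQExp_E₂, ?_, ?_, ?_, ?_⟩ <;> rw [qExpansion_E₂_coeff] <;> norm_num [h2, h3]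

lemma qExpansion_E₄_coeff {m : ℕ} (hm : m ≠ 0) :
    (qExpansion 1 E₄).coeff m = 240 * (ArithmeticFunction.sigma 3 m : ℂ) := by
  have h1 := ModularForm.E₄_qExpansion_coeff_one
  have h (m : ℕ) : (qExpansion 1 E₄).coeff m = _ :=
    EisensteinSeries.E_qExpansion_coeff (k := 4) (by norm_num) (by decide) m
  rw [h] at h1 ⊢
  simp only [one_ne_zero, if_false, ArithmeticFunction.sigma_one, Nat.cast_one, mul_one] at h1
  rw [if_neg hm, h1]

lemma qExpansion_E₆_coeff {m : ℕ} (hm : m ≠ 0) :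
    (qExpansion 1 E₆).coeff m = -504 * (ArithmeticFunction.sigma 5 m : ℂ) := by
  have h1 := ModularForm.E₆_qExpansion_coeff_one
  have h (m : ℕ) : (qExpansion 1 E₆).coeff m = _ :=
    EisensteinSeries.E_qExpansion_coeff (k := 6) (by norm_num) (by decide) m
  rw [h] at h1 ⊢
  simp only [one_ne_zero, if_false, ArithmeticFunction.sigma_one, Nat.cast_one, mul_one] at h1
  rw [if_neg hm, h1]

lemma hasCoeffs_E₄ : HasCoeffs E₄ 1 240 2160 6720 := by
  obtain ⟨-, -, h2, h3, -⟩ := sigma_values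
  refine ⟨isMF_E₄.hasQExp, EisensteinSeries.E_qExpansion_coeff_zero _ (by decide),
    ModularForm.E₄_qExpansion_coeff_one, ?_, ?_⟩ <;>
  rw [qExpansion_E₄_coeff (by norm_num)] <;> norm_num [h2, h3]

lemma hasCoeffs_E₆ : HasCoeffs E₆ 1 (-504) (-16632) (-122976) := by
  obtain ⟨-, -, -, -, h2, h3⟩ := sigma_values
  refine ⟨isMF_E₆.hasQExp, EisensteinSeries.E_qExpansion_coeff_zero _ (by decide),
    ModularForm.E₆_qExpansion_coeff_one, ?_, ?_⟩ <;>
  rw [qExpansion_E₆_coeff (by norm_num)] <;> norm_num [h2, h3]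

lemma hasCoeffs_E₂_sq : HasCoeffs (E₂ * E₂) 1 (-48) 432 3264 :=
  (hasCoeffs_E₂.mul hasCoeffs_E₂).congr rfl (by norm_num) (by norm_num) (by norm_num) (by norm_num)

lemma hasCoeffs_E₄_sq : HasCoeffs (E₄ * E₄) 1 480 61920 1050240 :=
  (hasCoeffs_E₄.mul hasCoeffs_E₄).congr rfl (by norm_num) (by norm_num) (by norm_num) (by norm_num)

lemma hasCoeffs_E₄_mul_E₆ : HasCoeffs (E₄ * E₆) 1 (-264) (-135432) (-5196576) :=
  (hasCoeffs_E₄.mul hasCoeffs_E₆).congr rfl (by norm_num) (by norm_num) (by norm_num) (by norm_num)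

lemma hasCoeffs_E₆_sq : HasCoeffs (E₆ * E₆) 1 (-1008) 220752 16519104 :=
  (hasCoeffs_E₆.mul hasCoeffs_E₆).congr rfl (by norm_num) (by norm_num) (by norm_num) (by norm_num)

lemma hasCoeffs_E₄_cube : HasCoeffs (E₄ * E₄ * E₄) 1 720 179280 16954560 :=
  (hasCoeffs_E₄_sq.mul hasCoeffs_E₄).congr rfl (by norm_num)
    (by norm_num) (by norm_num) (by norm_num)

lemma qPow_eq (n : ℕ) (z : ℍ) : qPow n z = Function.Periodic.qParam 1 z ^ n := by
  simp [qPow, Function.Periodic.qParam]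

/-- If the coefficients of index less than `n` vanish, then `f / q ^ n` tends to the `n`-th one. -/
lemma HasQExp.tendsto_div_qPow {f : ℍ → ℂ} (hf : HasQExp f) {n : ℕ}
    (h : ∀ m < n, (qExpansion 1 f).coeff m = 0) :
    Tendsto (fun z ↦ f z / qPow n z) atImInfty (𝓝 ((qExpansion 1 f).coeff n)) := by
  have h1 := hf.analyticAt.hasFPowerSeriesAt.isBigO_sub_partialSum_pow (n + 1)
  have h2 := h1.comp_tendsto (qParam_tendsto_atImInfty one_pos)
  simp only [Function.comp_def, zero_add, hf.cuspFunction_qParam] at h2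
  have h3 (z : ℍ) : (FormalMultilinearSeries.ofScalars ℂ fun n ↦
      iteratedDeriv n (cuspFunction 1 f) 0 / n.factorial).partialSum (n + 1)
      (Function.Periodic.qParam 1 z) = (qExpansion 1 f).coeff n * qPow n z := by
    have hc (m : ℕ) : iteratedDeriv m (cuspFunction 1 f) 0 / m.factorial =
        (qExpansion 1 f).coeff m := by
      rw [qExpansion_coeff, div_eq_mul_inv, mul_comm]
    simp only [FormalMultilinearSeries.partialSum, FormalMultilinearSeries.ofScalars_apply_eq, hc,
      smul_eq_mul, qPow_eq]
    refine (Finset.sum_range_succ _ _).trans ?_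
    rw [Finset.sum_eq_zero fun m hm ↦ by rw [h m (Finset.mem_range.mp hm), zero_mul], zero_add]
  simp only [h3] at h2
  have h4 : (fun z : ℍ ↦ f z / qPow n z - (qExpansion 1 f).coeff n) =O[atImInfty]
      fun z : ℍ ↦ ‖Function.Periodic.qParam 1 (z : ℂ)‖ := by
    have h5 := h2.mul (Asymptotics.isBigO_refl (fun z : ℍ ↦ (qPow n z)⁻¹) atImInfty).norm_right
    refine (h5.congr' ?_ ?_)
    · refine .of_forall fun z ↦ ?_
      have : qPow n z ≠ 0 := pow_ne_zero _ (Complex.exp_ne_zero _)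
      field_simp
    · refine .of_forall fun z ↦ ?_
      have : Function.Periodic.qParam 1 (z : ℂ) ≠ 0 := Complex.exp_ne_zero _
      simp only [qPow_eq, norm_inv, norm_pow, pow_succ]
      field_simp
  have h6 := h4.trans_tendsto (by
    simpa using! (qParam_tendsto_atImInfty one_pos).norm)
  simpa using h6.add_const ((qExpansion 1 f).coeff n)

/-- If `f / q ^ n` tends to zero, then all coefficients up to index `n` vanish. -/
lemma HasQExp.coeff_eq_zero {f : ℍ → ℂ} (hf : HasQExp f) {n : ℕ}
    (h : Tendsto (fun z ↦ f z / qPow n z) atImInfty (𝓝 0)) :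
    ∀ m ≤ n, (qExpansion 1 f).coeff m = 0 := by
  intro m
  induction m using Nat.strong_induction_on with
  | _ m ih =>
    intro hm
    refine tendsto_nhds_unique (hf.tendsto_div_qPow fun i hi ↦ ih i hi (by omega)) ?_
    have hq : Tendsto (fun z : ℍ ↦ Function.Periodic.qParam 1 (z : ℂ) ^ (n - m)) atImInfty
        (𝓝 (0 ^ (n - m))) := (qParam_tendsto_atImInfty one_pos).pow (n - m)
    have := h.mul hq
    rw [zero_mul] at this
    refine this.congr fun z ↦ ?_
    have h0 : Function.Periodic.qParam 1 (z : ℂ) ≠ 0 := Complex.exp_ne_zero _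
    rw [qPow_eq, qPow_eq, ← Nat.sub_add_cancel hm, pow_add]
    field_simp
    simp

lemma IsMF.exists_smul_eq {k : ℤ} {f g : ℍ → ℂ} (hf : IsMF ⊤ k f) (hg : IsMF ⊤ k g) (hk : k < 12)
    (hg1 : Tendsto g atImInfty (𝓝 1)) : ∃ c : ℂ, f = c • g := by
  obtain ⟨c, hc⟩ := hf.exists_tendsto
  exact ⟨c, hf.eq_of_tendsto (hg.smul c) hk hc (by simpa using! hg1.const_mul c)⟩

/-- In weight `12` the level one forms are spanned by `E₄ ^ 3` and `E₆ ^ 2`. -/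
lemma IsMF.exists_eq_weight_twelve {f : ℍ → ℂ} (hf : IsMF ⊤ 12 f) :
    ∃ c d : ℂ, f = c • (E₄ * E₄ * E₄) + d • (E₆ * E₆) := by
  obtain ⟨c, hc⟩ := hf.exists_tendsto
  have h444 : IsMF ⊤ 12 (E₄ * E₄ * E₄) := (isMF_E₄.mul isMF_E₄).mul isMF_E₄
  have hd : IsMF ⊤ 12 (f - c • (E₄ * E₄ * E₄)) := hf.sub (h444.smul c)
  have h0 : (qExpansion 1 hd.toLevelOne).coeff 0 = 0 := by
    refine tendsto_nhds_unique hd.hasQExp.tendsto ?_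
    simpa using! hc.sub (((tendsto_E₄.mul tendsto_E₄).mul tendsto_E₄).const_mul c)
  obtain ⟨d, hd⟩ := CuspForm.exists_smul_discriminant_of_weight_eq_twelve
    (hd.toLevelOne.toCuspForm h0)
  refine ⟨c + d / 1728, -(d / 1728), ?_⟩
  ext z
  have h1 : d * ModularForm.discriminant z = f z - c * (E₄ z * E₄ z * E₄ z) :=
    DFunLike.congr_fun hd z
  rw [ModularForm.discriminant_eq_E₄_cube_sub_E₆_sq] at h1
  simp only [Pi.add_apply, Pi.smul_apply, Pi.mul_apply, smul_eq_mul]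
  linear_combination -h1

lemma tendsto_one_mul {f g : ℍ → ℂ} (hf : Tendsto f atImInfty (𝓝 1))
    (hg : Tendsto g atImInfty (𝓝 1)) : Tendsto (f * g) atImInfty (𝓝 1) := by
  simpa using! hf.mul hg

lemma hasCoeffs_X₈ : ∃ a, HasCoeffs X₈ 0 0 1 a := by
  rw [X₈_eq, sq]
  have h := (((hasCoeffs_E₄.smul (-7 / 362880)).mul hasCoeffs_E₂_sq).add
    ((hasCoeffs_E₆.smul (2 / 362880)).mul hasCoeffs_E₂)).add
    (hasCoeffs_E₄_sq.smul (5 / 362880))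
  exact ⟨_, h.congr rfl (by norm_num) (by norm_num) (by norm_num) rfl⟩

lemma hasCoeffs_X₁₀ : ∃ a, HasCoeffs X₁₀ 0 0 1 a := by
  rw [X₁₀_eq, sq]
  have h := (((hasCoeffs_E₆.smul (5 / 1088640)).mul hasCoeffs_E₂_sq).add
    ((hasCoeffs_E₄_sq.smul (2 / 1088640)).mul hasCoeffs_E₂)).add
    (hasCoeffs_E₄_mul_E₆.smul (-7 / 1088640))
  exact ⟨_, h.congr rfl (by norm_num) (by norm_num) (by norm_num) rfl⟩

lemma hasCoeffs_X₁₂ : HasCoeffs X₁₂ 0 0 0 1 := by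
  rw [X₁₂_eq, sq]
  have h := (((hasCoeffs_E₄_sq.smul (-77 / 798336000)).mul
    hasCoeffs_E₂_sq).add
    ((hasCoeffs_E₄_mul_E₆.smul (34 / 798336000)).mul hasCoeffs_E₂)).add
    ((hasCoeffs_E₄_cube.smul (50 / 798336000)).add
      (hasCoeffs_E₆_sq.smul (-7 / 798336000)))
  exact h.congr rfl (by norm_num) (by norm_num) (by norm_num) (by norm_num)

/-- The forms of weight `8` and depth at most `2` are spanned by `E₄ E₂ ^ 2`, `E₆ E₂` and `E₄ ^ 2`,
and the coefficients of `1, q, q ^ 2` are linearly independent on this span. -/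
lemma isNormalizedExtremal_X₈ : IsNormalizedExtremal 8 2 X₈ := by
  obtain ⟨x, hX⟩ := hasCoeffs_X₈
  refine ⟨isQuasimodular_X₈, 2, ?_, fun g hg h0 ↦ ?_⟩
  · rw [← hX.c₂]
    refine hX.hasQExp.tendsto_div_qPow fun m hm ↦ ?_
    interval_cases m
    exacts [hX.c₀, hX.c₁]
  obtain ⟨a, b, c, ma, mb, mc, rfl⟩ := hg.exists_poly
  obtain ⟨c, rfl⟩ := mc.exists_smul_eq isMF_E₄ (by norm_num) tendsto_E₄
  obtain ⟨b, rfl⟩ := mb.exists_smul_eq isMF_E₆ (by norm_num) tendsto_E₆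
  obtain ⟨a, rfl⟩ := ma.exists_smul_eq (isMF_E₄.mul isMF_E₄) (by norm_num)
    (tendsto_one_mul tendsto_E₄ tendsto_E₄)
  have h := (((hasCoeffs_E₄.smul c).mul hasCoeffs_E₂_sq).add
    ((hasCoeffs_E₆.smul b).mul hasCoeffs_E₂)).add (hasCoeffs_E₄_sq.smul a)
  rw [← sq E₂] at h
  have e := h.hasQExp.coeff_eq_zero h0
  have e0 := h.c₀.symm.trans (e 0 (by norm_num))
  have e1 := h.c₁.symm.trans (e 1 (by norm_num))
  have e2 := h.c₂.symm.trans (e 2 (by norm_num))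
  -- the inverse of the coefficient matrix
  have hc : c = 0 := by
    linear_combination (7/12) * e0 + (11/8640) * e1 + (-1/51840) * e2
  have hb : b = 0 := by
    linear_combination (13/42) * e0 + (-41/30240) * e1 + (1/181440) * e2
  have ha : a = 0 := by
    linear_combination (3/28) * e0 + (1/12096) * e1 + (1/72576) * e2
  simp [ha, hb, hc]

lemma isNormalizedExtremal_X₁₀ : IsNormalizedExtremal 10 2 X₁₀ := by
  obtain ⟨x, hX⟩ := hasCoeffs_X₁₀
  refine ⟨isQuasimodular_X₁₀, 2, ?_, fun g hg h0 ↦ ?_⟩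
  · rw [← hX.c₂]
    refine hX.hasQExp.tendsto_div_qPow fun m hm ↦ ?_
    interval_cases m
    exacts [hX.c₀, hX.c₁]
  obtain ⟨a, b, c, ma, mb, mc, rfl⟩ := hg.exists_poly
  obtain ⟨c, rfl⟩ := mc.exists_smul_eq isMF_E₆ (by norm_num) tendsto_E₆
  obtain ⟨b, rfl⟩ := mb.exists_smul_eq (isMF_E₄.mul isMF_E₄) (by norm_num)
    (tendsto_one_mul tendsto_E₄ tendsto_E₄)
  obtain ⟨a, rfl⟩ := ma.exists_smul_eq (isMF_E₄.mul isMF_E₆) (by norm_num)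
    (tendsto_one_mul tendsto_E₄ tendsto_E₆)
  have h := (((hasCoeffs_E₆.smul c).mul hasCoeffs_E₂_sq).add
    ((hasCoeffs_E₄_sq.smul b).mul hasCoeffs_E₂)).add (hasCoeffs_E₄_mul_E₆.smul a)
  rw [← sq E₂] at h
  have e := h.hasQExp.coeff_eq_zero h0
  have e0 := h.c₀.symm.trans (e 0 (by norm_num))
  have e1 := h.c₁.symm.trans (e 1 (by norm_num))
  have e2 := h.c₂.symm.trans (e 2 (by norm_num))
  -- the inverse of the coefficient matrix
  have hc : c = 0 := by
    linear_combination (935/3024) * e0 + (-43/36288) * e1 + (1/217728) * e2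
  have hb : b = 0 := by
    linear_combination (3707/7560) * e0 + (83/90720) * e1 + (1/544320) * e2
  have ha : a = 0 := by
    linear_combination (433/2160) * e0 + (7/25920) * e1 + (-1/155520) * e2
  simp [ha, hb, hc]

lemma isNormalizedExtremal_X₁₂ : IsNormalizedExtremal 12 2 X₁₂ := by
  have hX := hasCoeffs_X₁₂
  refine ⟨isQuasimodular_X₁₂, 3, ?_, fun g hg h0 ↦ ?_⟩
  · rw [← hX.c₃]
    refine hX.hasQExp.tendsto_div_qPow fun m hm ↦ ?_
    interval_cases m
    exacts [hX.c₀, hX.c₁, hX.c₂]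
  obtain ⟨a, b, c, ma, mb, mc, rfl⟩ := hg.exists_poly
  obtain ⟨c, rfl⟩ := mc.exists_smul_eq (isMF_E₄.mul isMF_E₄) (by norm_num)
    (tendsto_one_mul tendsto_E₄ tendsto_E₄)
  obtain ⟨b, rfl⟩ := mb.exists_smul_eq (isMF_E₄.mul isMF_E₆) (by norm_num)
    (tendsto_one_mul tendsto_E₄ tendsto_E₆)
  obtain ⟨a, d, rfl⟩ := ma.exists_eq_weight_twelve
  have h := (((hasCoeffs_E₄_sq.smul c).mul hasCoeffs_E₂_sq).add
    ((hasCoeffs_E₄_mul_E₆.smul b).mul hasCoeffs_E₂)).add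
    ((hasCoeffs_E₄_cube.smul a).add (hasCoeffs_E₆_sq.smul d))
  rw [← sq E₂] at h
  have e := h.hasQExp.coeff_eq_zero h0
  have e0 := h.c₀.symm.trans (e 0 (by norm_num))
  have e1 := h.c₁.symm.trans (e 1 (by norm_num))
  have e2 := h.c₂.symm.trans (e 2 (by norm_num))
  have e3 := h.c₃.symm.trans (e 3 (by norm_num))
  -- the inverse of the coefficient matrix
  have hc : c = 0 := by
    linear_combination (1001/1800) * e0 + (133/864000) * e1 + (7/1296000) * e2 + (-1/10368000) * e3
  have hb : b = 0 := by
    linear_combination (3419/9900) * e0 + (-4661/33264000) * e1 + (-269/49896000) * e2 +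
      (17/399168000) * e3
  have ha : a = 0 := by
    linear_combination (-19/792) * e0 + (677/1330560) * e1 + (-1/443520) * e2 + (1/15966720) * e3
  have hd : d = 0 := by
    linear_combination (1213/9900) * e0 + (-4967/9504000) * e1 + (1/445500) * e2 +
      (-1/114048000) * e3
  simp [ha, hb, hc, hd]

/-! ### Restriction to the imaginary axis -/

lemma coe_axis {t : ℝ} (ht : 0 < t) : (ofComplex (t * I) : ℂ) = t * I := by
  rw [ofComplex_apply_of_im_pos (by simpa using ht)]

lemma double_axis {t : ℝ} (ht : 0 < t) :
    double (ofComplex (t * I)) = ofComplex ((2 * t : ℝ) * I) := by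
  ext
  rw [coe_double, coe_axis ht, coe_axis (by positivity)]
  push_cast
  ring

lemma onAxis_level2 (f : ℍ → ℂ) {t : ℝ} (ht : 0 < t) : onAxis (level2 f) t = onAxis f (2 * t) := by
  rw [onAxis, level2, double_axis ht, onAxis]

lemma tendsto_axis : Tendsto (fun t : ℝ ↦ ofComplex (t * I)) atTop atImInfty := by
  refine tendsto_comap_im_ofComplex.comp (tendsto_comap_iff.mpr ?_)
  simpa [Function.comp_def] using! tendsto_id

lemma tendsto_onAxis_re {f : ℍ → ℂ} {c : ℂ} (hf : Tendsto f atImInfty (𝓝 c)) :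
    Tendsto (fun t ↦ (onAxis f t).re) atTop (𝓝 c.re) :=
  (Complex.continuous_re.tendsto c).comp (hf.comp tendsto_axis)

/-- A form with a `q`-expansion without constant term decays exponentially at `i∞`. -/
lemma HasQExp.isBigO_onAxis {f : ℍ → ℂ} (hf : HasQExp f) (h0 : Tendsto f atImInfty (𝓝 0)) :
    onAxis f =O[atTop] fun t ↦ rexp (-(2 * π * t)) := by
  have hO := (IsZeroAtImInfty.exp_decay_atImInfty h0 one_pos hf.periodic hf.mdiff
    hf.bdd).comp_tendsto tendsto_axis
  refine hO.congr' (EventuallyEq.refl _ _) ?_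
  filter_upwards [eventually_gt_atTop 0] with t ht
  simp [← coe_im, coe_axis ht]

/-- On the imaginary axis `D` is `-(2 π)⁻¹ d/dt`. -/
lemma hasDerivAt_onAxis_re {f g : ℍ → ℂ} (hf : HasD f g) {t : ℝ} (ht : 0 < t) :
    HasDerivAt (fun t ↦ (onAxis f t).re) (-(2 * π) * (onAxis g t).re) t := by
  have h1 : HasDerivAt (f ∘ ofComplex) (deriv (f ∘ ofComplex) (t * I)) (t * I) := by
    have := (mdifferentiableAt_iff.mp (hf.mdiff (ofComplex (t * I)))).hasDerivAt
    rwa [coe_axis ht] at this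
  have h2 : HasDerivAt (fun s : ℝ ↦ (s : ℂ) * I) I t := by
    simpa using (Complex.ofRealCLM.hasDerivAt (x := t)).mul_const I
  have h3 : HasDerivAt (onAxis f) (deriv (f ∘ ofComplex) (t * I) * I) t :=
    HasDerivAt.comp t (h₂ := f ∘ ofComplex) h1 h2
  have h4 : onAxis g t = (2 * π * I)⁻¹ * deriv (f ∘ ofComplex) (t * I) := by
    rw [onAxis, ← hf.eq, normalizedDerivOfComplex, coe_axis ht]
  have hπ : (π : ℂ) ≠ 0 := mod_cast Real.pi_ne_zero
  have h5 : deriv (f ∘ ofComplex) (t * I) * I = (-(2 * π) : ℝ) * onAxis g t := by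
    rw [h4]
    push_cast
    field_simp
    rw [I_sq]
    ring
  have h6 := Complex.reCLM.hasFDerivAt.comp_hasDerivAt t h3
  rw [h5] at h6
  simpa only [Complex.reCLM_apply, Complex.re_ofReal_mul] using! h6

/-- The coefficients of the `q`-expansion are real. -/
lemma onAxis_E₂_im {t : ℝ} (ht : 0 < t) : (onAxis E₂ t).im = 0 := by
  have h := EisensteinSeries.hasSum_qExpansion_E2 (z := ofComplex (t * I))
  rw [coe_axis ht] at h
  have := Complex.hasSum_iff _ _ |>.mp h |>.2
  refine this.unique ?_
  have e (m : ℕ) : ((if m = 0 then 1 else -24 * (ArithmeticFunction.sigma 1 m : ℂ)) •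
      cexp (2 * π * I * (t * I)) ^ m).im = 0 := by
    have e1 : cexp (2 * π * I * (t * I)) = (rexp (-(2 * π * t)) : ℝ) := by
      push_cast
      congr 1
      linear_combination 2 * π * t * I_sq
    have e2 : (if m = 0 then 1 else -24 * (ArithmeticFunction.sigma 1 m : ℂ)) =
        ((if m = 0 then 1 else -24 * (ArithmeticFunction.sigma 1 m : ℝ) : ℝ) : ℂ) := by
      split_ifs <;> push_cast <;> rfl
    rw [e1, e2, smul_eq_mul, ← Complex.ofReal_pow, ← Complex.ofReal_mul, Complex.ofReal_im]
  simpa only [e] using! hasSum_zero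

lemma hasSum_onAxis_Θ₂ {t : ℝ} (ht : 0 < t) : ∃ s : ℝ, onAxis Θ₂ t = s ∧
    HasSum (fun n : ℤ ↦ rexp (-(π * ((n : ℝ) + 1 / 2) ^ 2 * t))) s := by
  have h := hasSum_Θ₂ (ofComplex (t * I)).im_pos
  rw [← Θ₂_eq, coe_axis ht] at h
  have e (n : ℤ) : cexp (π * I * ((n : ℂ) + 1 / 2) ^ 2 * (t * I)) =
      (rexp (-(π * ((n : ℝ) + 1 / 2) ^ 2 * t)) : ℝ) := by
    push_cast
    congr 1
    linear_combination π * ((n : ℂ) + 1 / 2) ^ 2 * t * I_sq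
  simp only [e] at h
  obtain ⟨s, hs⟩ := Complex.summable_ofReal.mp h.summable
  exact ⟨s, h.unique (Complex.hasSum_ofReal.mpr hs), hs⟩

lemma onAxis_Θ₄_im {t : ℝ} (ht : 0 < t) : (onAxis Θ₄ t).im = 0 := by
  have e (n : ℤ) : (-1 : ℂ) ^ n * cexp (π * I * (n : ℂ) ^ 2 * (t * I)) =
      ((-1 : ℝ) ^ n * rexp (-(π * (n : ℝ) ^ 2 * t)) : ℝ) := by
    push_cast
    congr 2
    linear_combination π * (n : ℂ) ^ 2 * t * I_sq
  rw [onAxis, Θ₄, coe_axis ht]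
  simp only [e]
  rw [← Complex.ofReal_tsum, Complex.ofReal_im]

/-- The real part of `f (i t)`; all forms used below are real on the imaginary axis. -/
noncomputable def axis (f : ℍ → ℂ) (t : ℝ) : ℝ := (onAxis f t).re

lemma onAxis_E₂ {t : ℝ} (ht : 0 < t) : onAxis E₂ t = axis E₂ t :=
  Complex.ext rfl (by simpa using onAxis_E₂_im ht)

lemma onAxis_H₂ {t : ℝ} (ht : 0 < t) : onAxis H₂ t = axis H₂ t := by
  obtain ⟨s, hs, -⟩ := hasSum_onAxis_Θ₂ ht
  have : onAxis H₂ t = (s ^ 4 : ℝ) := by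
    rw [Complex.ofReal_pow, ← hs]
    rfl
  rw [axis, this, Complex.ofReal_re]

lemma exp_le_axis_H₂ {t : ℝ} (ht : 0 < t) : rexp (-(π * t)) ≤ axis H₂ t := by
  obtain ⟨s, hs, h⟩ := hasSum_onAxis_Θ₂ ht
  have h0 : rexp (-(π * t / 4)) ≤ s := by
    have := le_hasSum h 0 fun n _ ↦ (Real.exp_pos _).le
    rwa [show π * (((0 : ℤ) : ℝ) + 1 / 2) ^ 2 * t = π * t / 4 by push_cast; ring] at this
  have e : axis H₂ t = s ^ 4 := by
    have : onAxis H₂ t = (s ^ 4 : ℝ) := by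
      rw [Complex.ofReal_pow, ← hs]
      rfl
    rw [axis, this, Complex.ofReal_re]
  rw [e, show -(π * t) = (4 : ℕ) * (-(π * t / 4)) by push_cast; ring, Real.exp_nat_mul]
  exact pow_le_pow_left₀ (Real.exp_pos _).le h0 4

lemma axis_H₂_pos {t : ℝ} (ht : 0 < t) : 0 < axis H₂ t :=
  (Real.exp_pos _).trans_le (exp_le_axis_H₂ ht)

lemma onAxis_H₄_eq_pow {t : ℝ} (ht : 0 < t) : onAxis H₄ t = ((axis Θ₄ t) ^ 4 : ℝ) := by
  have : onAxis Θ₄ t = axis Θ₄ t := Complex.ext rfl (by simpa using onAxis_Θ₄_im ht)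
  rw [Complex.ofReal_pow, ← this]
  rfl

lemma onAxis_H₄ {t : ℝ} (ht : 0 < t) : onAxis H₄ t = axis H₄ t := by
  rw [axis, onAxis_H₄_eq_pow ht, Complex.ofReal_re]

lemma axis_H₄_pos {t : ℝ} (ht : 0 < t) : 0 < axis H₄ t := by
  have h : axis H₄ t = axis Θ₄ t ^ 4 := by rw [axis, onAxis_H₄_eq_pow ht, Complex.ofReal_re]
  refine lt_of_le_of_ne (h ▸ by positivity) fun h0 ↦ ?_
  have h1 : H₄ (ofComplex (t * I)) = 0 := by
    have := onAxis_H₄ ht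
    rwa [← h0, Complex.ofReal_zero] at this
  exact theta_prod_ne_zero (ofComplex (t * I)) (by rw [h1]; ring)

lemma axis_B {t : ℝ} (ht : 0 < t) : axis B t = axis H₂ t + 2 * axis H₄ t := by
  have h : onAxis B t = (axis H₂ t + 2 * axis H₄ t : ℝ) := by
    push_cast
    rw [← onAxis_H₂ ht, ← onAxis_H₄ ht]
    rfl
  rw [axis, h, Complex.ofReal_re]

lemma onAxis_B {t : ℝ} (ht : 0 < t) : onAxis B t = axis B t := by
  rw [axis_B ht]
  push_cast
  rw [← onAxis_H₂ ht, ← onAxis_H₄ ht]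
  rfl

lemma axis_hh {t : ℝ} (ht : 0 < t) : axis hh t = axis H₄ t * (axis H₂ t + axis H₄ t) := by
  have h : onAxis hh t = (axis H₄ t * (axis H₂ t + axis H₄ t) : ℝ) := by
    push_cast
    rw [← onAxis_H₂ ht, ← onAxis_H₄ ht]
    rfl
  rw [axis, h, Complex.ofReal_re]

lemma onAxis_hh {t : ℝ} (ht : 0 < t) : onAxis hh t = axis hh t := by
  rw [axis_hh ht]
  push_cast
  rw [← onAxis_H₂ ht, ← onAxis_H₄ ht]
  rfl

lemma onAxis_E₄ {t : ℝ} (ht : 0 < t) : onAxis E₄ t = (axis B t ^ 2 - 3 * axis hh t : ℝ) := by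
  push_cast
  rw [← onAxis_B ht, ← onAxis_hh ht]
  exact E₄_eq_B _

lemma onAxis_E₆ {t : ℝ} (ht : 0 < t) :
    onAxis E₆ t = (axis B t * (9 * axis hh t - 2 * axis B t ^ 2) / 2 : ℝ) := by
  push_cast
  rw [← onAxis_B ht, ← onAxis_hh ht]
  exact E₆_eq_B _

lemma axis_E₄ {t : ℝ} (ht : 0 < t) : axis E₄ t = axis B t ^ 2 - 3 * axis hh t := by
  rw [axis, onAxis_E₄ ht, Complex.ofReal_re]

lemma axis_E₆ {t : ℝ} (ht : 0 < t) :
    axis E₆ t = axis B t * (9 * axis hh t - 2 * axis B t ^ 2) / 2 := by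
  rw [axis, onAxis_E₆ ht, Complex.ofReal_re]

lemma axis_E₂_two_mul {t : ℝ} (ht : 0 < t) :
    axis E₂ (2 * t) = (2 * axis E₂ t + axis B t) / 4 := by
  have h : onAxis E₂ (2 * t) = ((2 * axis E₂ t + axis B t) / 4 : ℝ) := by
    rw [← onAxis_level2 _ ht]
    push_cast
    rw [← onAxis_B ht, ← onAxis_E₂ ht]
    exact E₂_double _
  rw [axis, h, Complex.ofReal_re]

lemma axis_E₄_two_mul {t : ℝ} (ht : 0 < t) :
    axis E₄ (2 * t) = (axis B t ^ 2 + 12 * axis hh t) / 16 := by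
  have h : onAxis E₄ (2 * t) = ((axis B t ^ 2 + 12 * axis hh t) / 16 : ℝ) := by
    rw [← onAxis_level2 _ ht]
    push_cast
    rw [← onAxis_B ht, ← onAxis_hh ht]
    exact E₄_double _
  rw [axis, h, Complex.ofReal_re]

lemma axis_E₆_two_mul {t : ℝ} (ht : 0 < t) :
    axis E₆ (2 * t) = axis B t * (36 * axis hh t - axis B t ^ 2) / 64 := by
  have h : onAxis E₆ (2 * t) = (axis B t * (36 * axis hh t - axis B t ^ 2) / 64 : ℝ) := by
    rw [← onAxis_level2 _ ht]
    push_cast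
    rw [← onAxis_B ht, ← onAxis_hh ht]
    exact E₆_double _
  rw [axis, h, Complex.ofReal_re]

lemma axis_hh_pos {t : ℝ} (ht : 0 < t) : 0 < axis hh t := by
  rw [axis_hh ht]
  have := axis_H₂_pos ht
  have := axis_H₄_pos ht
  positivity

lemma axis_B_pos {t : ℝ} (ht : 0 < t) : 0 < axis B t := by
  rw [axis_B ht]
  have := axis_H₂_pos ht
  have := axis_H₄_pos ht
  positivity

/-- Equivalently, `A = B ^ 2 - 4 h` is positive. -/
lemma four_mul_axis_hh_lt {t : ℝ} (ht : 0 < t) : 4 * axis hh t < axis B t ^ 2 := by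
  rw [axis_hh ht, axis_B ht]
  have := pow_pos (axis_H₂_pos ht) 2
  linarith

lemma hasDerivAt_axis_E₂ {t : ℝ} (ht : 0 < t) :
    HasDerivAt (axis E₂) (-(2 * π) * ((axis E₂ t ^ 2 - axis E₄ t) / 12)) t := by
  refine (hasDerivAt_onAxis_re hasD_E₂ ht).congr_deriv ?_
  have : onAxis ((1 / 12 : ℂ) • (E₂ * E₂ - E₄)) t = ((axis E₂ t ^ 2 - axis E₄ t) / 12 : ℝ) := by
    rw [axis_E₄ ht, Complex.ofReal_div, Complex.ofReal_sub, ← onAxis_E₄ ht]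
    push_cast
    rw [← onAxis_E₂ ht]
    simp only [onAxis, Pi.smul_apply, Pi.sub_apply, Pi.mul_apply, smul_eq_mul]
    ring
  rw [this, Complex.ofReal_re]

lemma hasDerivAt_axis_B {t : ℝ} (ht : 0 < t) : HasDerivAt (axis B)
    (-(2 * π) * ((axis E₂ t * axis B t + axis B t ^ 2 - 6 * axis hh t) / 6)) t := by
  refine (hasDerivAt_onAxis_re hasD_B ht).congr_deriv ?_
  have : onAxis ((1 / 6 : ℂ) • (E₂ * B + B * B - (6 : ℂ) • hh)) t =
      ((axis E₂ t * axis B t + axis B t ^ 2 - 6 * axis hh t) / 6 : ℝ) := by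
    push_cast
    rw [← onAxis_E₂ ht, ← onAxis_B ht, ← onAxis_hh ht]
    simp only [onAxis, Pi.smul_apply, Pi.sub_apply, Pi.add_apply, Pi.mul_apply, smul_eq_mul]
    ring
  rw [this, Complex.ofReal_re]

lemma hasDerivAt_axis_hh {t : ℝ} (ht : 0 < t) : HasDerivAt (axis hh)
    (-(2 * π) * (axis hh t * (2 * axis E₂ t - axis B t) / 6)) t := by
  refine (hasDerivAt_onAxis_re hasD_hh ht).congr_deriv ?_
  have : onAxis ((1 / 6 : ℂ) • (hh * ((2 : ℂ) • E₂ - B))) t =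
      (axis hh t * (2 * axis E₂ t - axis B t) / 6 : ℝ) := by
    push_cast
    rw [← onAxis_E₂ ht, ← onAxis_B ht, ← onAxis_hh ht]
    simp only [onAxis, Pi.smul_apply, Pi.sub_apply, Pi.mul_apply, smul_eq_mul]
    ring
  rw [this, Complex.ofReal_re]

lemma hasDerivAt_axis_H₂ {t : ℝ} (ht : 0 < t) : HasDerivAt (axis H₂)
    (-(2 * π) * ((axis E₂ t + axis B t) / 6 * axis H₂ t)) t := by
  refine (hasDerivAt_onAxis_re hasD_H₂ ht).congr_deriv ?_
  have : onAxis ((1 / 6 : ℂ) • (E₂ * H₂ + H₂ * H₂ + (2 : ℂ) • (H₂ * H₄))) t =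
      ((axis E₂ t + axis B t) / 6 * axis H₂ t : ℝ) := by
    push_cast
    rw [← onAxis_E₂ ht, ← onAxis_B ht, ← onAxis_H₂ ht]
    simp only [onAxis, Pi.smul_apply, Pi.add_apply, Pi.mul_apply, smul_eq_mul, B_apply]
    ring
  rw [this, Complex.ofReal_re]

lemma tendsto_axis_E₂ : Tendsto (axis E₂) atTop (𝓝 1) := tendsto_onAxis_re tendsto_E₂

lemma tendsto_axis_E₄ : Tendsto (axis E₄) atTop (𝓝 1) := tendsto_onAxis_re tendsto_E₄

lemma tendsto_axis_E₆ : Tendsto (axis E₆) atTop (𝓝 1) := tendsto_onAxis_re tendsto_E₆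

lemma tendsto_B : Tendsto B atImInfty (𝓝 2) := by
  rw [B_eq]
  simpa using! tendsto_H₂.add (tendsto_H₄.const_mul 2)

lemma tendsto_hh : Tendsto hh atImInfty (𝓝 1) := by
  simpa using! tendsto_H₄.mul (tendsto_H₂.add tendsto_H₄)

/-- The translation `T` belongs to `Γ₀(2)`. -/
lemma IsMF.hasQExp_of_Gamma0 {k : ℤ} {f : ℍ → ℂ} (hf : IsMF (CongruenceSubgroup.Gamma0 2) k f) :
    HasQExp f := by
  refine ⟨hf.mdiff, fun w ↦ ?_, hf.isBoundedAtImInfty⟩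
  have hT := hf.slash ModularGroup.T (CongruenceSubgroup.Gamma0_mem.mpr (by simp [ModularGroup.T]))
  by_cases hw : 0 < w.im
  · have hw' : 0 < (w + (1 : ℝ)).im := by simpa using hw
    simp only [Function.comp_apply, ofComplex_apply_of_im_pos hw', ofComplex_apply_of_im_pos hw]
    have := congrFun hT ⟨w, hw⟩
    rw [slash_T_apply] at this
    rw [← this]
    congr 1
    ext
    simp [add_comm]
  · have hw' : (w + (1 : ℝ)).im ≤ 0 := by simpa using hw
    simp only [Function.comp_apply, ofComplex_apply_of_im_nonpos hw',
      ofComplex_apply_of_im_nonpos (not_lt.mp hw)]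

lemma tendsto_axis_B : Tendsto (axis B) atTop (𝓝 2) := tendsto_onAxis_re tendsto_B

lemma tendsto_axis_hh : Tendsto (axis hh) atTop (𝓝 1) := tendsto_onAxis_re tendsto_hh

/-! ### Positivity on the imaginary axis -/

/-- If `D f = a f + g` with `g ≥ 0`, if `w > 0` solves `D w = a w`, and if `f / w` vanishes at
infinity, then `f ≥ 0`: the quotient `f / w` is decreasing. -/
lemma nonneg_of_hasDerivAt {f a g w : ℝ → ℝ}
    (hf : ∀ t, 0 < t → HasDerivAt f (-(2 * π) * (a t * f t + g t)) t)
    (hw : ∀ t, 0 < t → HasDerivAt w (-(2 * π) * (a t * w t)) t)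
    (hw0 : ∀ t, 0 < t → 0 < w t) (hg : ∀ t, 0 < t → 0 ≤ g t)
    (hl : Tendsto (fun t ↦ f t / w t) atTop (𝓝 0)) {t : ℝ} (ht : 0 < t) : 0 ≤ f t := by
  have hd (t : ℝ) (ht : 0 < t) : HasDerivAt (fun t ↦ f t / w t) (-(2 * π) * (g t / w t)) t := by
    refine ((hf t ht).div (hw t ht) (hw0 t ht).ne').congr_deriv ?_
    have := (hw0 t ht).ne'
    field_simp
    ring
  have ha : AntitoneOn (fun t ↦ f t / w t) (Set.Ioi 0) := by
    refine antitoneOn_of_deriv_nonpos (convex_Ioi 0)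
      (fun t ht ↦ (hd t ht).continuousAt.continuousWithinAt)
      (fun t ht ↦ (hd t (interior_subset ht)).differentiableAt.differentiableWithinAt)
      fun t ht ↦ ?_
    have ht' : 0 < t := interior_subset ht
    rw [(hd t ht').deriv]
    have := div_nonneg (hg t ht') (hw0 t ht').le
    have := mul_nonneg Real.two_pi_pos.le this
    linarith
  have h0 : 0 ≤ f t / w t := by
    refine le_of_tendsto hl ?_
    filter_upwards [eventually_ge_atTop t] with s hs
    exact ha ht (ht.trans_le hs) hs
  rw [← div_mul_cancel₀ (f t) (hw0 t ht).ne']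
  exact mul_nonneg h0 (hw0 t ht).le

lemma pos_of_hasDerivAt {f g : ℝ → ℝ} (hf : ∀ t, 0 < t → HasDerivAt f (-(2 * π) * g t) t)
    (hg : ∀ t, 0 < t → 0 < g t) (hl : Tendsto f atTop (𝓝 0)) {t : ℝ} (ht : 0 < t) : 0 < f t := by
  have ha : StrictAntiOn f (Set.Ioi 0) := by
    refine strictAntiOn_of_deriv_neg (convex_Ioi 0)
      (fun t ht ↦ (hf t ht).continuousAt.continuousWithinAt) fun t ht ↦ ?_
    have ht' : 0 < t := interior_subset ht
    rw [(hf t ht').deriv]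
    have := mul_pos Real.two_pi_pos (hg t ht')
    linarith
  have h1 : 0 ≤ f (t + 1) := by
    refine le_of_tendsto hl ?_
    filter_upwards [eventually_ge_atTop (t + 1)] with s hs
    exact ha.antitoneOn (show 0 < t + 1 by positivity) (show 0 < s by linarith) hs
  exact h1.trans_lt (ha ht (show 0 < t + 1 by positivity) (by linarith))

/-- The case `a = 0` of `nonneg_of_hasDerivAt`. -/
lemma nonneg_of_hasDerivAt' {f g : ℝ → ℝ} (hf : ∀ t, 0 < t → HasDerivAt f (-(2 * π) * g t) t)
    (hg : ∀ t, 0 < t → 0 ≤ g t) (hl : Tendsto f atTop (𝓝 0)) {t : ℝ} (ht : 0 < t) : 0 ≤ f t :=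
  nonneg_of_hasDerivAt (a := 0) (w := fun _ ↦ 1) (fun t ht ↦ by simpa using hf t ht)
    (fun t _ ↦ by simpa using hasDerivAt_const t (1 : ℝ)) (fun _ _ ↦ one_pos) hg
    (by simpa using! hl) ht

/-- Powers of `h` serve as integrating factors: `D h = h (2 E₂ - B) / 6`. -/
lemma hasDerivAt_axis_hh_rpow (p : ℝ) {t : ℝ} (ht : 0 < t) :
    HasDerivAt (fun t ↦ axis hh t ^ p)
      (-(2 * π) * (p * (2 * axis E₂ t - axis B t) / 6 * axis hh t ^ p)) t := by
  refine ((hasDerivAt_axis_hh ht).rpow_const (Or.inl (axis_hh_pos ht).ne')).congr_deriv ?_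
  rw [Real.rpow_sub_one (axis_hh_pos ht).ne']
  have := (axis_hh_pos ht).ne'
  field_simp

lemma tendsto_div_axis_hh_rpow {f : ℝ → ℝ} (hf : Tendsto f atTop (𝓝 0)) (p : ℝ) :
    Tendsto (fun t ↦ f t / axis hh t ^ p) atTop (𝓝 0) := by
  have := hf.div (tendsto_axis_hh.rpow_const (p := p) (Or.inl one_ne_zero)) (by simp)
  simpa using! this

/-- The difference `u = B - 2 E₂` satisfies `D u = (2 E₂ - B) u / 24 + 3 A / 8`, and `A > 0`. -/
lemma axis_B_sub_two_mul_E₂_nonneg {t : ℝ} (ht : 0 < t) : 0 ≤ axis B t - 2 * axis E₂ t := by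
  refine nonneg_of_hasDerivAt (f := fun t ↦ axis B t - 2 * axis E₂ t)
    (a := fun t ↦ 1 / 4 * (2 * axis E₂ t - axis B t) / 6)
    (g := fun t ↦ 3 / 8 * (axis B t ^ 2 - 4 * axis hh t)) (w := fun t ↦ axis hh t ^ (1 / 4 : ℝ))
    (fun t ht ↦ ?_) (fun t ht ↦ hasDerivAt_axis_hh_rpow _ ht)
    (fun t ht ↦ Real.rpow_pos_of_pos (axis_hh_pos ht) _)
    (fun t ht ↦ by linarith [four_mul_axis_hh_lt ht]) (tendsto_div_axis_hh_rpow ?_ _) ht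
  · refine ((hasDerivAt_axis_B ht).sub ((hasDerivAt_axis_E₂ ht).const_mul 2)).congr_deriv ?_
    rw [axis_E₄ ht]
    ring
  · have := tendsto_axis_B.sub (tendsto_axis_E₂.const_mul 2)
    norm_num at this
    exact this

/-- The inhomogeneous term in the differential equation for `axis_E₂_cubic_bound` is `A` times a
multiple of this quantity. -/
lemma axis_E₂_quadratic_bound {t : ℝ} (ht : 0 < t) :
    0 ≤ axis B t ^ 2 - 8 * axis E₂ t * axis B t + 12 * axis hh t := by
  refine nonneg_of_hasDerivAt
    (f := fun t ↦ axis B t ^ 2 - 8 * axis E₂ t * axis B t + 12 * axis hh t)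
    (a := fun t ↦ 3 / 4 * (2 * axis E₂ t - axis B t) / 6)
    (g := fun t ↦ 9 / 8 * (axis B t ^ 2 - 4 * axis hh t) * (axis B t - 2 * axis E₂ t))
    (w := fun t ↦ axis hh t ^ (3 / 4 : ℝ))
    (fun t ht ↦ ?_) (fun t ht ↦ hasDerivAt_axis_hh_rpow _ ht)
    (fun t ht ↦ Real.rpow_pos_of_pos (axis_hh_pos ht) _)
    (fun t ht ↦ mul_nonneg (by linarith [four_mul_axis_hh_lt ht]) (axis_B_sub_two_mul_E₂_nonneg ht))
    (tendsto_div_axis_hh_rpow ?_ _) ht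
  · refine ((((hasDerivAt_axis_B ht).pow 2).sub (((hasDerivAt_axis_E₂ ht).const_mul 8).mul
      (hasDerivAt_axis_B ht))).add ((hasDerivAt_axis_hh ht).const_mul 12)).congr_deriv ?_
    rw [axis_E₄ ht]
    push_cast
    ring
  · have := ((tendsto_axis_B.pow 2).sub ((tendsto_axis_E₂.const_mul 8).mul tendsto_axis_B)).add
      (tendsto_axis_hh.const_mul 12)
    norm_num at this
    exact this

/-- An upper bound for `E₂` in terms of `B` and `h`, sharper than `axis_B_sub_two_mul_E₂_nonneg`. -/
lemma axis_E₂_cubic_bound {t : ℝ} (ht : 0 < t) :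
    0 ≤ 132 * axis B t * axis hh t - axis B t ^ 3 - 46 * axis E₂ t * axis B t ^ 2
      - 72 * axis E₂ t * axis hh t := by
  refine nonneg_of_hasDerivAt
    (f := fun t ↦ 132 * axis B t * axis hh t - axis B t ^ 3 - 46 * axis E₂ t * axis B t ^ 2
      - 72 * axis E₂ t * axis hh t)
    (a := fun t ↦ 5 / 4 * (2 * axis E₂ t - axis B t) / 6)
    (g := fun t ↦ 25 / 8 * (axis B t ^ 2 - 4 * axis hh t) *
      (axis B t ^ 2 - 8 * axis E₂ t * axis B t + 12 * axis hh t))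
    (w := fun t ↦ axis hh t ^ (5 / 4 : ℝ))
    (fun t ht ↦ ?_) (fun t ht ↦ hasDerivAt_axis_hh_rpow _ ht)
    (fun t ht ↦ Real.rpow_pos_of_pos (axis_hh_pos ht) _)
    (fun t ht ↦ mul_nonneg (by linarith [four_mul_axis_hh_lt ht]) (axis_E₂_quadratic_bound ht))
    (tendsto_div_axis_hh_rpow ?_ _) ht
  · refine ((((((hasDerivAt_axis_B ht).const_mul 132).mul (hasDerivAt_axis_hh ht)).sub
      ((hasDerivAt_axis_B ht).pow 3)).sub (((hasDerivAt_axis_E₂ ht).const_mul 46).mul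
      ((hasDerivAt_axis_B ht).pow 2))).sub (((hasDerivAt_axis_E₂ ht).const_mul 72).mul
      (hasDerivAt_axis_hh ht))).congr_deriv ?_
    rw [axis_E₄ ht]
    simp only [Pi.pow_apply]
    push_cast
    ring
  · have := ((((tendsto_axis_B.const_mul 132).mul tendsto_axis_hh).sub (tendsto_axis_B.pow 3)).sub
      ((tendsto_axis_E₂.const_mul 46).mul (tendsto_axis_B.pow 2))).sub
      ((tendsto_axis_E₂.const_mul 72).mul tendsto_axis_hh)
    norm_num at this
    exact this

/-- The quantity `(E₂ + B) ^ 2 - 9 h` is nonnegative on the imaginary axis. Its integrating factor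
is `H₂`, which decays like `q ^ (1 / 2)`, while the quantity itself is a power series in `q` without
constant term. -/
lemma sq_axis_E₂_add_B_sub_nonneg {t : ℝ} (ht : 0 < t) :
    0 ≤ (axis E₂ t + axis B t) ^ 2 - 9 * axis hh t := by
  refine nonneg_of_hasDerivAt (f := fun t ↦ (axis E₂ t + axis B t) ^ 2 - 9 * axis hh t)
    (a := fun t ↦ (axis E₂ t + axis B t) / 6)
    (g := fun t ↦ 3 / 2 * axis hh t * (axis B t - 2 * axis E₂ t)) (w := axis H₂)
    (fun t ht ↦ ?_) (fun t ht ↦ hasDerivAt_axis_H₂ ht) (fun t ht ↦ axis_H₂_pos ht)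
    (fun t ht ↦ mul_nonneg (by linarith [axis_hh_pos ht]) (axis_B_sub_two_mul_E₂_nonneg ht)) ?_ ht
  · refine ((((hasDerivAt_axis_E₂ ht).add (hasDerivAt_axis_B ht)).pow 2).sub
      ((hasDerivAt_axis_hh ht).const_mul 9)).congr_deriv ?_
    rw [axis_E₄ ht]
    simp only [Pi.add_apply]
    push_cast
    ring
  set n : ℍ → ℂ := (E₂ + B) * (E₂ + B) - (9 : ℂ) • hh with hn
  have hEB := hasQExp_E₂.add isMF_B.hasQExp_of_Gamma0
  have hq : HasQExp n := (hEB.mul hEB).sub (isMF_hh.hasQExp_of_Gamma0.smul 9)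
  have h0 : Tendsto n atImInfty (𝓝 0) := by
    have hEB' := tendsto_E₂.add tendsto_B
    have := (hEB'.mul hEB').sub (tendsto_hh.const_mul 9)
    norm_num at this
    exact this
  have e : ∀ᶠ t : ℝ in atTop, (axis E₂ t + axis B t) ^ 2 - 9 * axis hh t = (onAxis n t).re := by
    filter_upwards [eventually_gt_atTop 0] with t ht
    have : onAxis n t = ((axis E₂ t + axis B t) ^ 2 - 9 * axis hh t : ℝ) := by
      push_cast
      rw [← onAxis_E₂ ht, ← onAxis_B ht, ← onAxis_hh ht, sq]
      rfl
    rw [this, Complex.ofReal_re]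
  have h1 : (fun t ↦ (axis E₂ t + axis B t) ^ 2 - 9 * axis hh t) =O[atTop]
      fun t ↦ rexp (-(2 * π * t)) := by
    refine .trans (.of_norm_eventuallyLE (g := fun t ↦ ‖onAxis n t‖) ?_)
      (hq.isBigO_onAxis h0).norm_left
    filter_upwards [e] with t ht
    rw [ht, Real.norm_eq_abs]
    exact Complex.abs_re_le_norm _
  have h2 : (fun t ↦ (axis H₂ t)⁻¹) =O[atTop] fun t ↦ rexp (π * t) := by
    refine .of_norm_eventuallyLE ?_
    filter_upwards [eventually_gt_atTop 0] with t ht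
    rw [Real.norm_of_nonneg (inv_nonneg.mpr (axis_H₂_pos ht).le), ← neg_neg (π * t), Real.exp_neg]
    exact inv_anti₀ (Real.exp_pos _) (exp_le_axis_H₂ ht)
  refine (h1.mul h2).trans_tendsto ?_
  have : Tendsto (fun t : ℝ ↦ rexp (-(π * t))) atTop (𝓝 0) :=
    Real.tendsto_exp_neg_atTop_nhds_zero.comp (tendsto_id.const_mul_atTop Real.pi_pos)
  refine this.congr fun t ↦ ?_
  rw [← Real.exp_add]
  congr 1
  ring

lemma three_le_axis_E₂_add_B {t : ℝ} (ht : 0 < t) : 3 ≤ axis E₂ t + axis B t := by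
  refine sub_nonneg.mp (nonneg_of_hasDerivAt' (f := fun t ↦ axis E₂ t + axis B t - 3)
    (g := fun t ↦ ((axis E₂ t + axis B t) ^ 2 - 9 * axis hh t) / 12) (fun t ht ↦ ?_)
    (fun t ht ↦ div_nonneg (sq_axis_E₂_add_B_sub_nonneg ht) (by norm_num)) ?_ ht)
  · refine (((hasDerivAt_axis_E₂ ht).add (hasDerivAt_axis_B ht)).sub_const 3).congr_deriv ?_
    rw [axis_E₄ ht]
    ring
  · have := (tendsto_axis_E₂.add tendsto_axis_B).sub_const 3
    norm_num at this
    exact this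

/-! ### Positivity of the derivatives of Eisenstein series -/

/-- The bounds on `E₂` used below, with `r` the positive square root of `h`. -/
lemma exists_sqrt_hh {t : ℝ} (ht : 0 < t) : ∃ r, 0 < r ∧ axis hh t = r ^ 2 ∧
    2 * r < axis B t ∧ 3 * r - axis B t ≤ axis E₂ t ∧ axis E₂ t ≤ axis B t / 2 := by
  have hr := Real.sqrt_pos.mpr (axis_hh_pos ht)
  have hr2 := Real.sq_sqrt (axis_hh_pos ht).le
  refine ⟨√(axis hh t), hr, hr2.symm, ?_, ?_, by linarith [axis_B_sub_two_mul_E₂_nonneg ht]⟩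
  · refine lt_of_pow_lt_pow_left₀ 2 (axis_B_pos ht).le ?_
    rw [mul_pow, hr2]
    linarith [four_mul_axis_hh_lt ht]
  · have h3 : 3 * √(axis hh t) ≤ axis E₂ t + axis B t := by
      refine le_of_sq_le_sq ?_ (by linarith [three_le_axis_E₂_add_B ht])
      rw [mul_pow, hr2]
      linarith [sq_axis_E₂_add_B_sub_nonneg ht]
    linarith

/-- `P = -D E₂ / 24`. -/
noncomputable def axisP (t : ℝ) : ℝ := (axis E₄ t - axis E₂ t ^ 2) / 288

/-- `Q = D E₄ / 240`. -/
noncomputable def axisQ (t : ℝ) : ℝ := (axis E₂ t * axis E₄ t - axis E₆ t) / 720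

/-- `R = -D E₆ / 504`. -/
noncomputable def axisR (t : ℝ) : ℝ := (axis E₄ t ^ 2 - axis E₂ t * axis E₆ t) / 1008

lemma axisP_pos {t : ℝ} (ht : 0 < t) : 0 < axisP t := by
  obtain ⟨r, hr, hh, hb, h1, h2⟩ := exists_sqrt_hh ht
  rw [axisP, axis_E₄ ht, hh]
  set e := axis E₂ t
  set b := axis B t
  -- concave in `e`, hence at least its linear interpolation between the two bounds
  have k1 : 0 < 6 * r * (b - 2 * r) := by have := sub_pos.mpr hb; positivity
  have k2 : 0 < 3 / 4 * ((b - 2 * r) * (b + 2 * r)) := by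
    have := sub_pos.mpr hb
    have : 0 < b + 2 * r := by linarith
    positivity
  have key : (b ^ 2 - 3 * r ^ 2 - e ^ 2) * (b / 2 - (3 * r - b)) =
      (b / 2 - e) * (6 * r * (b - 2 * r)) +
      (e - (3 * r - b)) * (3 / 4 * ((b - 2 * r) * (b + 2 * r))) +
      (b / 2 - e) * (e - (3 * r - b)) * (b / 2 - (3 * r - b)) := by ring
  have hd : 0 < b / 2 - (3 * r - b) := by linarith
  have e1 := sub_nonneg.mpr h1
  have e2 := sub_nonneg.mpr h2
  have e3 : 0 < (b / 2 - e) * (6 * r * (b - 2 * r)) +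
      (e - (3 * r - b)) * (3 / 4 * ((b - 2 * r) * (b + 2 * r))) := by
    rcases e2.eq_or_lt with h | h
    · have : 0 < e - (3 * r - b) := by linarith
      rw [← h]
      positivity
    · positivity
  have : 0 < (b ^ 2 - 3 * r ^ 2 - e ^ 2) * (b / 2 - (3 * r - b)) := by rw [key]; positivity
  exact div_pos (pos_of_mul_pos_left this hd.le) (by norm_num)

lemma axisQ_pos {t : ℝ} (ht : 0 < t) : 0 < axisQ t := by
  obtain ⟨r, hr, hh, hb, h1, h2⟩ := exists_sqrt_hh ht
  rw [axisQ, axis_E₄ ht, axis_E₆ ht, hh]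
  set e := axis E₂ t
  set b := axis B t
  -- increasing in `e`, and positive at the lower bound
  have k1 : 0 < 3 / 2 * r * ((2 * b + 3 * r) * (b - 2 * r)) := by
    have := sub_pos.mpr hb
    have : 0 < b := by linarith
    positivity
  have k2 : 0 ≤ (e - (3 * r - b)) * (b ^ 2 - 3 * r ^ 2) :=
    mul_nonneg (by linarith) (by nlinarith)
  refine div_pos ?_ (by norm_num)
  linear_combination k1 + k2

lemma axisR_pos {t : ℝ} (ht : 0 < t) : 0 < axisR t := by
  obtain ⟨r, hr, hh, hb, h1, h2⟩ := exists_sqrt_hh ht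
  rw [axisR, axis_E₄ ht, axis_E₆ ht, hh]
  set e := axis E₂ t
  set b := axis B t
  have hb' := sub_pos.mpr hb
  have hb0 : 0 < b := by linarith
  -- linear in `e`, and positive at both bounds
  have k1 : 0 < 3 / 2 * r * ((b - 2 * r) * (2 * b ^ 2 + 3 * b * r - 3 * r ^ 2)) := by
    have : 0 < 2 * b ^ 2 + 3 * b * r - 3 * r ^ 2 := by nlinarith
    positivity
  have k2 : 0 < 3 / 4 * ((2 * b ^ 2 - 3 * r ^ 2) * ((b - 2 * r) * (b + 2 * r))) := by
    have : 0 < 2 * b ^ 2 - 3 * r ^ 2 := by nlinarith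
    positivity
  have key : ((b ^ 2 - 3 * r ^ 2) ^ 2 - e * (b * (9 * r ^ 2 - 2 * b ^ 2) / 2)) *
      (b / 2 - (3 * r - b)) =
      (b / 2 - e) * (3 / 2 * r * ((b - 2 * r) * (2 * b ^ 2 + 3 * b * r - 3 * r ^ 2))) +
      (e - (3 * r - b)) * (3 / 4 * ((2 * b ^ 2 - 3 * r ^ 2) * ((b - 2 * r) * (b + 2 * r)))) := by
    ring
  have hd : 0 < b / 2 - (3 * r - b) := by linarith
  have e1 := sub_nonneg.mpr h1
  have e2 := sub_nonneg.mpr h2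
  have : 0 < ((b ^ 2 - 3 * r ^ 2) ^ 2 - e * (b * (9 * r ^ 2 - 2 * b ^ 2) / 2)) *
      (b / 2 - (3 * r - b)) := by
    rw [key]
    rcases e2.eq_or_lt with h | h
    · have : 0 < e - (3 * r - b) := by linarith
      rw [← h]
      positivity
    · positivity
  exact div_pos (pos_of_mul_pos_left this hd.le) (by norm_num)

/-- The difference is a multiple of `(E₂ + B) ^ 2 - 9 h`. -/
lemma axisP_two_mul_le {t : ℝ} (ht : 0 < t) : 8 * axisP (2 * t) ≤ axisP t := by
  have := sq_axis_E₂_add_B_sub_nonneg ht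
  rw [axisP, axisP, axis_E₄ ht, axis_E₂_two_mul ht, axis_E₄_two_mul ht]
  linear_combination this / 288

/-- The difference is a multiple of `h (B - 2 E₂)`. -/
lemma axisQ_two_mul_le {t : ℝ} (ht : 0 < t) : 32 * axisQ (2 * t) ≤ axisQ t := by
  have := mul_nonneg (axis_hh_pos ht).le (axis_B_sub_two_mul_E₂_nonneg ht)
  rw [axisQ, axisQ, axis_E₄ ht, axis_E₆ ht, axis_E₂_two_mul ht, axis_E₄_two_mul ht,
    axis_E₆_two_mul ht]
  linear_combination this / 96

/-! ### Positivity of the extremal forms -/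

lemma onAxis_E₄' {t : ℝ} (ht : 0 < t) : onAxis E₄ t = axis E₄ t := by
  rw [axis_E₄ ht, onAxis_E₄ ht]

lemma onAxis_E₆' {t : ℝ} (ht : 0 < t) : onAxis E₆ t = axis E₆ t := by
  rw [axis_E₆ ht, onAxis_E₆ ht]

lemma hasDerivAt_axis_E₂' {t : ℝ} (ht : 0 < t) :
    HasDerivAt (axis E₂) (-(2 * π) * (-24 * axisP t)) t := by
  refine (hasDerivAt_axis_E₂ ht).congr_deriv ?_
  rw [axisP]
  ring

lemma hasDerivAt_axis_E₄ {t : ℝ} (ht : 0 < t) :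
    HasDerivAt (axis E₄) (-(2 * π) * (240 * axisQ t)) t := by
  refine (hasDerivAt_onAxis_re hasD_E₄ ht).congr_deriv ?_
  have : onAxis ((1 / 3 : ℂ) • (E₂ * E₄ - E₆)) t = (240 * axisQ t : ℝ) := by
    rw [axisQ]
    push_cast
    rw [← onAxis_E₂ ht, ← onAxis_E₄' ht, ← onAxis_E₆' ht]
    simp only [onAxis, Pi.smul_apply, Pi.sub_apply, Pi.mul_apply, smul_eq_mul]
    ring
  rw [this, Complex.ofReal_re]

lemma hasDerivAt_axis_E₆ {t : ℝ} (ht : 0 < t) :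
    HasDerivAt (axis E₆) (-(2 * π) * (-504 * axisR t)) t := by
  refine (hasDerivAt_onAxis_re hasD_E₆ ht).congr_deriv ?_
  have : onAxis ((1 / 2 : ℂ) • (E₂ * E₆ - E₄ * E₄)) t = (-504 * axisR t : ℝ) := by
    rw [axisR]
    push_cast
    rw [← onAxis_E₂ ht, ← onAxis_E₄' ht, ← onAxis_E₆' ht]
    simp only [onAxis, Pi.smul_apply, Pi.sub_apply, Pi.mul_apply, smul_eq_mul]
    ring
  rw [this, Complex.ofReal_re]

/-- The function `t ↦ X₈ (i t)`. -/
noncomputable def axisX₈ (t : ℝ) : ℝ :=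
  (-7 * axis E₂ t ^ 2 * axis E₄ t + 2 * axis E₂ t * axis E₆ t + 5 * axis E₄ t ^ 2) / 362880

/-- The function `t ↦ X₁₀ (i t)`. -/
noncomputable def axisX₁₀ (t : ℝ) : ℝ :=
  (5 * axis E₂ t ^ 2 * axis E₆ t + 2 * axis E₂ t * axis E₄ t ^ 2 - 7 * axis E₄ t * axis E₆ t)
    / 1088640

/-- The function `t ↦ X₁₂ (i t)`. -/
noncomputable def axisX₁₂ (t : ℝ) : ℝ :=
  (-77 * axis E₂ t ^ 2 * axis E₄ t ^ 2 + 34 * axis E₂ t * axis E₄ t * axis E₆ t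
    + 50 * axis E₄ t ^ 3 - 7 * axis E₆ t ^ 2) / 798336000

lemma onAxis_X₈ {t : ℝ} (ht : 0 < t) : onAxis X₈ t = axisX₈ t := by
  rw [onAxis, X₈_apply, axisX₈]
  push_cast
  rw [← onAxis_E₂ ht, ← onAxis_E₄' ht, ← onAxis_E₆' ht]
  rfl

lemma onAxis_X₁₀ {t : ℝ} (ht : 0 < t) : onAxis X₁₀ t = axisX₁₀ t := by
  rw [onAxis, X₁₀_apply, axisX₁₀]
  push_cast
  rw [← onAxis_E₂ ht, ← onAxis_E₄' ht, ← onAxis_E₆' ht]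
  rfl

lemma onAxis_X₁₂ {t : ℝ} (ht : 0 < t) : onAxis X₁₂ t = axisX₁₂ t := by
  rw [onAxis, X₁₂_apply, axisX₁₂]
  push_cast
  rw [← onAxis_E₂ ht, ← onAxis_E₄' ht, ← onAxis_E₆' ht]
  rfl

lemma hasDerivAt_axisX₈ {t : ℝ} (ht : 0 < t) :
    HasDerivAt axisX₈ (-(2 * π) * (2 * (axisP t * axisQ t))) t := by
  have h2 := hasDerivAt_axis_E₂' ht
  have h4 := hasDerivAt_axis_E₄ ht
  have h6 := hasDerivAt_axis_E₆ ht
  refine (((((h2.pow 2).const_mul (-7)).mul h4).add ((h2.const_mul 2).mul h6)).add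
    ((h4.pow 2).const_mul 5)).div_const 362880 |>.congr_deriv ?_
  simp only [axisP, axisQ, axisR, Pi.pow_apply]
  push_cast
  ring

lemma hasDerivAt_axisX₁₀ {t : ℝ} (ht : 0 < t) : HasDerivAt axisX₁₀
    (-(2 * π) * (8 / 9 * (axisP t * axisR t) + 10 / 9 * axisQ t ^ 2)) t := by
  have h2 := hasDerivAt_axis_E₂' ht
  have h4 := hasDerivAt_axis_E₄ ht
  have h6 := hasDerivAt_axis_E₆ ht
  refine (((((h2.pow 2).const_mul 5).mul h6).add ((h2.const_mul 2).mul (h4.pow 2))).sub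
    ((h4.const_mul 7).mul h6)).div_const 1088640 |>.congr_deriv ?_
  simp only [axisP, axisQ, axisR, Pi.pow_apply]
  push_cast
  ring

lemma hasDerivAt_axisX₁₂ {t : ℝ} (ht : 0 < t) :
    HasDerivAt axisX₁₂ (-(2 * π) * (3 * (axisQ t * axisX₈ t))) t := by
  have h2 := hasDerivAt_axis_E₂' ht
  have h4 := hasDerivAt_axis_E₄ ht
  have h6 := hasDerivAt_axis_E₆ ht
  refine ((((((h2.pow 2).const_mul (-77)).mul (h4.pow 2)).add (((h2.const_mul 34).mul h4).mul
    h6)).add ((h4.pow 3).const_mul 50)).sub ((h6.pow 2).const_mul 7)).div_const 798336000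
    |>.congr_deriv ?_
  simp only [axisP, axisQ, axisR, axisX₈, Pi.pow_apply, Pi.mul_apply]
  push_cast
  ring

lemma tendsto_axisX₈ : Tendsto axisX₈ atTop (𝓝 0) := by
  have h2 := tendsto_axis_E₂
  have h4 := tendsto_axis_E₄
  have h6 := tendsto_axis_E₆
  have := (((((h2.pow 2).const_mul (-7)).mul h4).add ((h2.const_mul 2).mul h6)).add
    ((h4.pow 2).const_mul 5)).div_const 362880
  refine this.mono_right (le_of_eq (congrArg 𝓝 ?_))
  norm_num

lemma tendsto_axisX₁₀ : Tendsto axisX₁₀ atTop (𝓝 0) := by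
  have h2 := tendsto_axis_E₂
  have h4 := tendsto_axis_E₄
  have h6 := tendsto_axis_E₆
  have := (((((h2.pow 2).const_mul 5).mul h6).add ((h2.const_mul 2).mul (h4.pow 2))).sub
    ((h4.const_mul 7).mul h6)).div_const 1088640
  refine this.mono_right (le_of_eq (congrArg 𝓝 ?_))
  norm_num

lemma tendsto_axisX₁₂ : Tendsto axisX₁₂ atTop (𝓝 0) := by
  have h2 := tendsto_axis_E₂
  have h4 := tendsto_axis_E₄
  have h6 := tendsto_axis_E₆
  have := ((((((h2.pow 2).const_mul (-77)).mul (h4.pow 2)).add (((h2.const_mul 34).mul h4).mul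
    h6)).add ((h4.pow 3).const_mul 50)).sub ((h6.pow 2).const_mul 7)).div_const 798336000
  refine this.mono_right (le_of_eq (congrArg 𝓝 ?_))
  norm_num

lemma axisX₈_pos {t : ℝ} (ht : 0 < t) : 0 < axisX₈ t :=
  pos_of_hasDerivAt (fun _ ht ↦ hasDerivAt_axisX₈ ht)
    (fun _ ht ↦ mul_pos two_pos (mul_pos (axisP_pos ht) (axisQ_pos ht))) tendsto_axisX₈ ht

lemma axisX₁₀_pos {t : ℝ} (ht : 0 < t) : 0 < axisX₁₀ t :=
  pos_of_hasDerivAt (fun _ ht ↦ hasDerivAt_axisX₁₀ ht)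
    (fun t ht ↦ by
      have := axisP_pos ht
      have := axisQ_pos ht
      have := axisR_pos ht
      positivity) tendsto_axisX₁₀ ht

lemma axisX₁₂_pos {t : ℝ} (ht : 0 < t) : 0 < axisX₁₂ t :=
  pos_of_hasDerivAt (fun _ ht ↦ hasDerivAt_axisX₁₂ ht)
    (fun _ ht ↦ mul_pos three_pos (mul_pos (axisQ_pos ht) (axisX₈_pos ht))) tendsto_axisX₁₂ ht

lemma hasDerivAt_comp_two_mul {f : ℝ → ℝ} {g t : ℝ} (hf : HasDerivAt f g (2 * t)) :
    HasDerivAt (fun t ↦ f (2 * t)) (2 * g) t := by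
  have h : HasDerivAt (fun t : ℝ ↦ 2 * t) 2 t := by simpa using (hasDerivAt_id t).const_mul 2
  exact (hf.comp t h).congr_deriv (mul_comm _ _)

lemma tendsto_comp_two_mul {f : ℝ → ℝ} (hf : Tendsto f atTop (𝓝 0)) :
    Tendsto (fun t ↦ f (2 * t)) atTop (𝓝 0) :=
  hf.comp (tendsto_id.const_mul_atTop two_pos)

lemma axisX₈_two_mul_le {t : ℝ} (ht : 0 < t) : 2 ^ 7 * axisX₈ (2 * t) ≤ axisX₈ t := by
  refine sub_nonneg.mp (nonneg_of_hasDerivAt' (f := fun t ↦ axisX₈ t - 2 ^ 7 * axisX₈ (2 * t))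
    (g := fun t ↦ 2 * (axisP t * axisQ t - (8 * axisP (2 * t)) * (32 * axisQ (2 * t))))
    (fun t ht ↦ ?_) (fun t ht ↦ ?_) ?_ ht)
  · refine ((hasDerivAt_axisX₈ ht).sub ((hasDerivAt_comp_two_mul
      (hasDerivAt_axisX₈ (mul_pos two_pos ht))).const_mul (2 ^ 7))).congr_deriv ?_
    ring
  · refine mul_nonneg two_pos.le (sub_nonneg.mpr ?_)
    exact mul_le_mul (axisP_two_mul_le ht) (axisQ_two_mul_le ht)
      (mul_nonneg (by norm_num) (axisQ_pos (mul_pos two_pos ht)).le) (axisP_pos ht).le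
  · simpa using tendsto_axisX₈.sub ((tendsto_comp_two_mul tendsto_axisX₈).const_mul (2 ^ 7))

lemma axisX₁₂_two_mul_le {t : ℝ} (ht : 0 < t) : 2 ^ 11 * axisX₁₂ (2 * t) ≤ axisX₁₂ t := by
  refine sub_nonneg.mp (nonneg_of_hasDerivAt' (f := fun t ↦ axisX₁₂ t - 2 ^ 11 * axisX₁₂ (2 * t))
    (g := fun t ↦ 3 * (axisQ t * axisX₈ t - (32 * axisQ (2 * t)) * (2 ^ 7 * axisX₈ (2 * t))))
    (fun t ht ↦ ?_) (fun t ht ↦ ?_) ?_ ht)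
  · refine ((hasDerivAt_axisX₁₂ ht).sub ((hasDerivAt_comp_two_mul
      (hasDerivAt_axisX₁₂ (mul_pos two_pos ht))).const_mul (2 ^ 11))).congr_deriv ?_
    ring
  · refine mul_nonneg three_pos.le (sub_nonneg.mpr ?_)
    exact mul_le_mul (axisQ_two_mul_le ht) (axisX₈_two_mul_le ht)
      (mul_nonneg (by norm_num) (axisX₈_pos (mul_pos two_pos ht)).le) (axisQ_pos ht).le
  · simpa using tendsto_axisX₁₂.sub ((tendsto_comp_two_mul tendsto_axisX₁₂).const_mul (2 ^ 11))

/-- In terms of `E₂, B, h` the difference is a quadratic polynomial in `E₂`, whose coefficients in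
powers of `v = E₂ + B` are positive if `2 B ^ 2 ≥ 135 h`. Otherwise it is concave, and it is
positive at both ends of the interval for `E₂` given by `v ≥ 0` and `axis_E₂_cubic_bound`. -/
lemma axisX₁₀_two_mul_le {t : ℝ} (ht : 0 < t) : 2 ^ 9 * axisX₁₀ (2 * t) ≤ axisX₁₀ t := by
  have hW := axis_E₂_cubic_bound ht
  have hv : 0 < axis E₂ t + axis B t := by linarith [three_le_axis_E₂_add_B ht]
  have hb := axis_B_pos ht
  have hh := axis_hh_pos ht
  have hA := four_mul_axis_hh_lt ht
  rw [axisX₁₀, axisX₁₀, axis_E₄ ht, axis_E₆ ht, axis_E₂_two_mul ht, axis_E₄_two_mul ht,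
    axis_E₆_two_mul ht]
  generalize axis E₂ t = e at *
  generalize axis B t = b at *
  generalize axis LeechIneq.hh t = h at *
  set v := e + b with hv'
  suffices hT : 0 ≤ (5 * b ^ 3 - 675 / 2 * (b * h)) * v ^ 2 + (255 * b ^ 2 - 270 * h) * h * v +
      3465 / 2 * (b * h ^ 2) by
    rw [hv'] at hT
    linear_combination hT / 1088640
  rcases le_total (135 * h) (2 * b ^ 2) with hc | hc
  · have h1 : 0 ≤ 5 * b ^ 3 - 675 / 2 * (b * h) := by
      have := mul_nonneg hb.le (sub_nonneg.mpr hc)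
      linear_combination 5 / 2 * this
    have h2 : 0 ≤ 255 * b ^ 2 - 270 * h := by linarith
    positivity
  · have h1 : 0 ≤ 675 / 2 * (b * h) - 5 * b ^ 3 := by
      have := mul_nonneg hb.le (sub_nonneg.mpr hc)
      linear_combination 5 / 2 * this
    -- `hM` is the positive multiple of the length of the interval for `e` that clears denominators
    have hM : 0 < (46 * b ^ 2 + 72 * h) * (b * (45 * b ^ 2 + 204 * h)) := by positivity
    refine nonneg_of_mul_nonneg_right ?_ hM
    have k1 : 0 ≤ (46 * b ^ 2 + 72 * h) * (132 * b * h - b ^ 3 - 46 * e * b ^ 2 - 72 * e * h) *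
        (3465 / 2 * (b * h ^ 2)) := by positivity
    have k2 : 0 ≤ v * (b * (b ^ 2 - 4 * h) ^ 2 *
        (10125 * b ^ 4 + 34425 / 2 * b ^ 2 * h + 313470 * h ^ 2)) := by positivity
    have k3 : 0 ≤ (675 / 2 * (b * h) - 5 * b ^ 3) * v *
        (132 * b * h - b ^ 3 - 46 * e * b ^ 2 - 72 * e * h) * (b * (45 * b ^ 2 + 204 * h)) := by
      positivity
    rw [hv'] at k2 k3 ⊢
    linear_combination k1 + k2 + k3

lemma pos_of_eq_ofReal {x : ℂ} {y : ℝ} (h : x = y) (hy : 0 < y) : 0 < x := by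
  rw [h]
  exact_mod_cast hy

lemma nonneg_of_eq_ofReal {x : ℂ} {y : ℝ} (h : x = y) (hy : 0 ≤ y) : 0 ≤ x := by
  rw [h]
  exact_mod_cast hy

lemma onAxis_A {t : ℝ} (ht : 0 < t) : onAxis A t = (axis H₂ t ^ 2 : ℝ) := by
  push_cast
  rw [← onAxis_H₂ ht]
  rfl

lemma isPosOnAxis_A : IsPosOnAxis A := fun _ ht ↦
  pos_of_eq_ofReal (onAxis_A ht) (pow_pos (axis_H₂_pos ht) 2)

lemma isPosOnAxis_B : IsPosOnAxis B := fun _ ht ↦ pos_of_eq_ofReal (onAxis_B ht) (axis_B_pos ht)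

lemma onAxis_level2_X₈ {t : ℝ} (ht : 0 < t) : onAxis (level2 X₈) t = axisX₈ (2 * t) := by
  rw [onAxis_level2 _ ht, onAxis_X₈ (mul_pos two_pos ht)]

lemma onAxis_level2_X₁₀ {t : ℝ} (ht : 0 < t) : onAxis (level2 X₁₀) t = axisX₁₀ (2 * t) := by
  rw [onAxis_level2 _ ht, onAxis_X₁₀ (mul_pos two_pos ht)]

lemma onAxis_level2_X₁₂ {t : ℝ} (ht : 0 < t) : onAxis (level2 X₁₂) t = axisX₁₂ (2 * t) := by
  rw [onAxis_level2 _ ht, onAxis_X₁₂ (mul_pos two_pos ht)]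

lemma isPosOnAxis_level2_X₈ : IsPosOnAxis (level2 X₈) := fun _ ht ↦
  pos_of_eq_ofReal (onAxis_level2_X₈ ht) (axisX₈_pos (mul_pos two_pos ht))

lemma isPosOnAxis_level2_X₁₀ : IsPosOnAxis (level2 X₁₀) := fun _ ht ↦
  pos_of_eq_ofReal (onAxis_level2_X₁₀ ht) (axisX₁₀_pos (mul_pos two_pos ht))

lemma isPosOnAxis_level2_X₁₂ : IsPosOnAxis (level2 X₁₂) := fun _ ht ↦
  pos_of_eq_ofReal (onAxis_level2_X₁₂ ht) (axisX₁₂_pos (mul_pos two_pos ht))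

lemma isPositive_Xt₈ : IsPositive Xt₈ := fun t ht ↦ by
  refine nonneg_of_eq_ofReal (y := axisX₈ t - 2 ^ 7 * axisX₈ (2 * t)) ?_
    (sub_nonneg.mpr (axisX₈_two_mul_le ht))
  push_cast
  rw [← onAxis_X₈ ht, ← onAxis_level2_X₈ ht]
  rfl

lemma isPositive_Xt₁₀ : IsPositive Xt₁₀ := fun t ht ↦ by
  refine nonneg_of_eq_ofReal (y := axisX₁₀ t - 2 ^ 9 * axisX₁₀ (2 * t)) ?_
    (sub_nonneg.mpr (axisX₁₀_two_mul_le ht))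
  push_cast
  rw [← onAxis_X₁₀ ht, ← onAxis_level2_X₁₀ ht]
  rfl

lemma isPositive_Xt₁₂ : IsPositive Xt₁₂ := fun t ht ↦ by
  refine nonneg_of_eq_ofReal (y := axisX₁₂ t - 2 ^ 11 * axisX₁₂ (2 * t)) ?_
    (sub_nonneg.mpr (axisX₁₂_two_mul_le ht))
  push_cast
  rw [← onAxis_X₁₂ ht, ← onAxis_level2_X₁₂ ht]
  rfl

/-- Every term on the right of `L_eq` is nonnegative, and the first one is positive. -/
lemma isPosOnAxis_L : IsPosOnAxis L := fun t ht ↦ by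
  have hA := isPosOnAxis_A t ht
  have hB := isPosOnAxis_B t ht
  have h8 := isPosOnAxis_level2_X₈ t ht
  have h10 := isPosOnAxis_level2_X₁₀ t ht
  have h12 := isPosOnAxis_level2_X₁₂ t ht
  have k8 := isPositive_Xt₈ t ht
  have k10 := isPositive_Xt₁₀ t ht
  have k12 := isPositive_Xt₁₂ t ht
  simp only [onAxis] at *
  rw [L_eq]
  positivity

lemma isPosOnAxis_H₂ : IsPosOnAxis H₂ := fun _ ht ↦
  pos_of_eq_ofReal (onAxis_H₂ ht) (axis_H₂_pos ht)

lemma isPosOnAxis_H₄ : IsPosOnAxis H₄ := fun _ ht ↦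
  pos_of_eq_ofReal (onAxis_H₄ ht) (axis_H₄_pos ht)

lemma isPosOnAxis_wronskian : IsPosOnAxis wronskian := fun t ht ↦ by
  have h2 := isPosOnAxis_H₂ t ht
  have h4 := isPosOnAxis_H₄ t ht
  have hL := isPosOnAxis_L t ht
  simp only [onAxis] at *
  rw [wronskian_eq]
  positivity

/-! ### The quotient `F / G` on the imaginary axis -/

lemma onAxis_F {t : ℝ} (ht : 0 < t) : onAxis F t = axis F t := by
  have h : onAxis F t = (49 * axis E₂ t ^ 2 * axis E₄ t ^ 3 - 25 * axis E₂ t ^ 2 * axis E₆ t ^ 2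
      - 48 * axis E₂ t * axis E₄ t ^ 2 * axis E₆ t - 25 * axis E₄ t ^ 4
      + 49 * axis E₄ t * axis E₆ t ^ 2 : ℝ) := by
    push_cast
    rw [← onAxis_E₂ ht, ← onAxis_E₄' ht, ← onAxis_E₆' ht]
    exact F_apply _
  rw [axis, h, Complex.ofReal_re]

lemma onAxis_G_pos {t : ℝ} (ht : 0 < t) : 0 < onAxis G t := by
  have h2 := isPosOnAxis_H₂ t ht
  have h4 := isPosOnAxis_H₄ t ht
  simp only [onAxis] at *
  rw [G_apply]
  positivity

lemma onAxis_G {t : ℝ} (ht : 0 < t) : onAxis G t = axis G t :=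
  Complex.ext rfl (Complex.pos_iff.mp (onAxis_G_pos ht)).2.symm

lemma axis_G_pos {t : ℝ} (ht : 0 < t) : 0 < axis G t := (Complex.pos_iff.mp (onAxis_G_pos ht)).1

lemma onAxis_F_div_G {t : ℝ} (ht : 0 < t) :
    onAxis F t / onAxis G t = (axis F t / axis G t : ℝ) := by
  rw [onAxis_F ht, onAxis_G ht, Complex.ofReal_div]

lemma strictAntiOn_axis_F_div_G : StrictAntiOn (fun t ↦ axis F t / axis G t) (Set.Ioi 0) := by
  have hd (t : ℝ) (ht : 0 < t) : HasDerivAt (fun t ↦ axis F t / axis G t)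
      (-(2 * π) * (axis wronskian t / axis G t ^ 2)) t := by
    have hF : HasDerivAt (axis F) _ t := hasDerivAt_onAxis_re ⟨mdiff_F, rfl⟩ ht
    have hG : HasDerivAt (axis G) _ t := hasDerivAt_onAxis_re ⟨mdiff_G, rfl⟩ ht
    refine (hF.div hG (axis_G_pos ht).ne').congr_deriv ?_
    have hW : axis wronskian t = (onAxis (D F) t).re * axis G t
        - axis F t * (onAxis (D G) t).re := by
      have : onAxis wronskian t = onAxis (D F) t * onAxis G t - onAxis F t * onAxis (D G) t := rfl
      rw [onAxis_F ht, onAxis_G ht] at this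
      rw [axis, this, Complex.sub_re, Complex.re_mul_ofReal, Complex.re_ofReal_mul]
    rw [hW]
    ring
  refine strictAntiOn_of_deriv_neg (convex_Ioi 0)
    (fun t ht ↦ (hd t ht).continuousAt.continuousWithinAt) fun t ht ↦ ?_
  have ht' : 0 < t := interior_subset ht
  rw [(hd t ht').deriv]
  have hW : 0 < axis wronskian t := (Complex.pos_iff.mp (isPosOnAxis_wronskian t ht')).1
  have := axis_G_pos ht'
  have : 0 < 2 * π * (axis wronskian t / axis G t ^ 2) := by positivity
  linarith

/-! ### The limit at the cusp `0` -/

lemma S_smul_axis {t : ℝ} (ht : 0 < t) :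
    ModularGroup.S • ofComplex (t * I) = ofComplex ((t⁻¹ : ℝ) * I) := by
  ext
  have : (t : ℂ) ≠ 0 := mod_cast ht.ne'
  rw [modular_S_smul, coe_axis (inv_pos.mpr ht)]
  simp only [coe_axis ht]
  push_cast
  field_simp
  rw [I_sq]

lemma slash_S_inv {f g : ℍ → ℂ} {k : ℤ} (h : f ∣[k] ModularGroup.S = g) (z : ℍ) :
    f (ModularGroup.S • z) = (z : ℂ) ^ k * g z := by
  rw [← h, slash_S_apply, zpow_neg]
  have := zpow_ne_zero k z.ne_zero
  field_simp

lemma E₂_S_smul (z : ℍ) : E₂ (ModularGroup.S • z) = (z : ℂ) ^ 2 * E₂ z + κ * z := by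
  have hz := z.ne_zero
  rw [slash_S_inv (f := E₂) (k := 2) rfl, E₂_slash, cocycle]
  simp [ModularGroup.S]
  field_simp

lemma E₄_S_smul (z : ℍ) : E₄ (ModularGroup.S • z) = (z : ℂ) ^ 4 * E₄ z :=
  mod_cast slash_S_inv (isMF_E₄.slash ModularGroup.S (Subgroup.mem_top _)) z

lemma E₆_S_smul (z : ℍ) : E₆ (ModularGroup.S • z) = (z : ℂ) ^ 6 * E₆ z :=
  mod_cast slash_S_inv (isMF_E₆.slash ModularGroup.S (Subgroup.mem_top _)) z

lemma H₂_S_smul (z : ℍ) : H₂ (ModularGroup.S • z) = -((z : ℂ) ^ 2 * H₄ z) := by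
  rw [slash_S_inv H₂_slash_S, Pi.neg_apply, mul_neg]
  rfl

lemma H₄_S_smul (z : ℍ) : H₄ (ModularGroup.S • z) = -((z : ℂ) ^ 2 * H₂ z) := by
  rw [slash_S_inv H₄_slash_S, Pi.neg_apply, mul_neg]
  rfl

/-- The coefficient of `E₂ ^ 2` in `F`. -/
noncomputable def F₂ : ℍ → ℂ := (49 : ℂ) • E₄ ^ 3 - (25 : ℂ) • E₆ ^ 2

/-- The formal derivative of `F` with respect to `E₂`. -/
noncomputable def F₁ : ℍ → ℂ := (2 : ℂ) • (E₂ * F₂) - (48 : ℂ) • (E₄ ^ 2 * E₆)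

lemma F_S_smul (z : ℍ) : F (ModularGroup.S • z) =
    (z : ℂ) ^ 14 * ((z : ℂ) ^ 2 * F z + κ * (z * F₁ z) + κ ^ 2 * F₂ z) := by
  rw [F_apply, F_apply, E₂_S_smul, E₄_S_smul, E₆_S_smul]
  simp only [F₁, F₂, Pi.smul_apply, Pi.sub_apply, Pi.mul_apply, Pi.pow_apply, smul_eq_mul]
  ring

lemma G_S_smul (z : ℍ) : G (ModularGroup.S • z) =
    -((z : ℂ) ^ 14 * (H₄ z ^ 5 * (2 * H₄ z ^ 2 + 7 * H₄ z * H₂ z + 7 * H₂ z ^ 2))) := by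
  rw [G_apply, H₂_S_smul, H₄_S_smul]
  ring

lemma HasQExp.tendsto_pow_mul_onAxis {f : ℍ → ℂ} (hf : HasQExp f)
    (h0 : Tendsto f atImInfty (𝓝 0)) (n : ℕ) :
    Tendsto (fun t : ℝ ↦ (t : ℂ) ^ n * onAxis f t) atTop (𝓝 0) := by
  have hp : (fun t : ℝ ↦ (t : ℂ) ^ n) =O[atTop] fun t : ℝ ↦ t ^ n :=
    Asymptotics.isBigO_of_le _ fun t ↦ by simp
  refine (hp.mul (hf.isBigO_onAxis h0)).trans_tendsto ?_
  have h2 := (isLittleO_pow_exp_pos_mul_atTop n (b := 2 * π) Real.two_pi_pos).tendsto_div_nhds_zero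
  refine h2.congr fun t ↦ ?_
  rw [Real.exp_neg, div_eq_mul_inv]

lemma tendsto_F₂ : Tendsto F₂ atImInfty (𝓝 24) := by
  have := ((tendsto_E₄.pow 3).const_smul (49 : ℂ)).sub ((tendsto_E₆.pow 2).const_smul (25 : ℂ))
  refine this.mono_right (le_of_eq (congrArg 𝓝 ?_))
  norm_num

lemma tendsto_F₁ : Tendsto F₁ atImInfty (𝓝 0) := by
  have := ((tendsto_E₂.mul tendsto_F₂).const_smul (2 : ℂ)).sub
    (((tendsto_E₄.pow 2).mul tendsto_E₆).const_smul (48 : ℂ))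
  refine this.mono_right (le_of_eq (congrArg 𝓝 ?_))
  norm_num

lemma hasQExp_F₂ : HasQExp F₂ :=
  ((isMF_E₄.hasQExp.pow 3).smul 49).sub ((isMF_E₆.hasQExp.pow 2).smul 25)

lemma hasQExp_F₁ : HasQExp F₁ :=
  ((hasQExp_E₂.mul hasQExp_F₂).smul 2).sub (((isMF_E₄.hasQExp.pow 2).mul isMF_E₆.hasQExp).smul 48)

lemma F_eq : F = E₂ ^ 2 * F₂ - (48 : ℂ) • (E₂ * E₄ ^ 2 * E₆) - (25 : ℂ) • E₄ ^ 4
    + (49 : ℂ) • (E₄ * E₆ ^ 2) := by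
  ext z
  rw [F_apply]
  simp only [F₂, Pi.add_apply, Pi.smul_apply, Pi.sub_apply, Pi.mul_apply, Pi.pow_apply, smul_eq_mul]
  ring

lemma hasQExp_F : HasQExp F := by
  have h4 := isMF_E₄.hasQExp
  have h6 := isMF_E₆.hasQExp
  rw [F_eq]
  exact ((((hasQExp_E₂.pow 2).mul hasQExp_F₂).sub (((hasQExp_E₂.mul (h4.pow 2)).mul h6).smul
    48)).sub ((h4.pow 4).smul 25)).add ((h4.mul (h6.pow 2)).smul 49)

lemma tendsto_F : Tendsto F atImInfty (𝓝 0) := by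
  have h4 := tendsto_E₄
  have h6 := tendsto_E₆
  have := ((((tendsto_E₂.pow 2).mul tendsto_F₂).sub
    (((tendsto_E₂.mul (h4.pow 2)).mul h6).const_smul (48 : ℂ))).sub
    ((h4.pow 4).const_smul (25 : ℂ))).add ((h4.mul (h6.pow 2)).const_smul (49 : ℂ))
  rw [F_eq]
  refine this.mono_right (le_of_eq (congrArg 𝓝 ?_))
  norm_num

/-- Under `z ↦ -1 / z` only the term `κ ^ 2 F₂` of `F` survives in the limit. -/
lemma tendsto_onAxis_F_div_G :
    Tendsto (fun t : ℝ ↦ onAxis F t / onAxis G t) (𝓝[>] 0) (𝓝 (432 / (π : ℂ) ^ 2)) := by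
  have hπ : (π : ℂ) ≠ 0 := mod_cast Real.pi_ne_zero
  have hF := hasQExp_F.tendsto_pow_mul_onAxis tendsto_F 2
  have hF₁ := hasQExp_F₁.tendsto_pow_mul_onAxis tendsto_F₁ 1
  have hF₂ := tendsto_F₂.comp tendsto_axis
  have h2 := tendsto_H₂.comp tendsto_axis
  have h4 := tendsto_H₄.comp tendsto_axis
  have hG := (h4.pow 5).mul ((((h4.pow 2).const_mul 2).add ((h4.const_mul 7).mul h2)).add
    ((h2.pow 2).const_mul 7))
  have key := ((hF.sub (hF₁.const_mul (κ * I))).sub (hF₂.const_mul (κ ^ 2))).div hG (by norm_num)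
  have hlim : (0 - κ * I * 0 - κ ^ 2 * 24) / (1 ^ 5 * (2 * 1 ^ 2 + 7 * 1 * 0 + 7 * 0 ^ 2)) =
      432 / (π : ℂ) ^ 2 := by
    rw [κ]
    field_simp
    rw [I_sq]
    norm_num
  rw [hlim] at key
  refine (key.comp tendsto_inv_nhdsGT_zero).congr' ?_
  filter_upwards [self_mem_nhdsWithin] with t ht
  have ht' : 0 < t⁻¹ := inv_pos.mpr ht
  have hS := S_smul_axis ht'
  rw [inv_inv] at hS
  have hz : (ofComplex ((t⁻¹ : ℝ) * I) : ℂ) = (t⁻¹ : ℝ) * I := coe_axis ht'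
  simp only [Function.comp_apply, Pi.div_apply, onAxis]
  rw [← hS, F_S_smul, G_S_smul, div_neg, mul_div_mul_left _ _
    (pow_ne_zero 14 (ne_zero _)), ← neg_div, hz]
  congr 1
  linear_combination ((t⁻¹ : ℝ) : ℂ) ^ 2 * F (ofComplex ((t⁻¹ : ℝ) * I)) * I_sq

lemma axis_F_lt {t : ℝ} (ht : 0 < t) : axis F t < 432 / π ^ 2 * axis G t := by
  have hl : Tendsto (fun t ↦ axis F t / axis G t) (𝓝[>] 0) (𝓝 (432 / π ^ 2)) := by
    have := (Complex.continuous_re.tendsto _).comp tendsto_onAxis_F_div_G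
    rw [show (432 / (π : ℂ) ^ 2) = (432 / π ^ 2 : ℝ) by push_cast; rfl, Complex.ofReal_re] at this
    refine this.congr' ?_
    filter_upwards [self_mem_nhdsWithin] with t ht
    rw [Function.comp_apply, onAxis_F_div_G ht, Complex.ofReal_re]
  have h1 : axis F (t / 2) / axis G (t / 2) ≤ 432 / π ^ 2 := by
    refine ge_of_tendsto hl ?_
    filter_upwards [Ioo_mem_nhdsGT (half_pos ht)] with s hs
    exact (strictAntiOn_axis_F_div_G hs.1 (half_pos ht) hs.2).le
  have h2 := strictAntiOn_axis_F_div_G (half_pos ht) ht (half_lt_self ht)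
  exact (div_lt_iff₀ (axis_G_pos ht)).mp (h2.trans_le h1)

end LeechIneq

theorem mainTheorem9 :
    -- the nature of the forms involved
    IsQuasimodular ⊤ 16 2 F ∧
    IsModular (CongruenceSubgroup.Gamma 2) 14 G ∧
    IsModular (CongruenceSubgroup.Gamma0 2) 10 K₁₀ ∧
    IsModular (CongruenceSubgroup.Gamma0 2) 12 K₁₂ ∧
    IsModular (CongruenceSubgroup.Gamma0 2) 14 K₁₄ ∧
    IsQuasimodular (CongruenceSubgroup.Gamma 2) 14 2 L ∧
    IsNormalizedExtremal 8 2 X₈ ∧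
    IsNormalizedExtremal 10 2 X₁₀ ∧
    IsNormalizedExtremal 12 2 X₁₂ ∧
    IsQuasimodular (CongruenceSubgroup.Gamma0 2) 8 2 Xt₈ ∧
    IsQuasimodular (CongruenceSubgroup.Gamma0 2) 10 2 Xt₁₀ ∧
    IsQuasimodular (CongruenceSubgroup.Gamma0 2) 12 2 Xt₁₂ ∧
    -- the factorization of the Wronskian-type form
    wronskian =
      Derivative.serreDerivative 14 F * G
        - F * Derivative.serreDerivative 14 G ∧
    (∀ z : UpperHalfPlane, wronskian z =
      105 / 8 * H₂ z ^ 5 * H₄ z ^ 2 * (H₂ z + H₄ z) ^ 2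
        * L z) ∧
    -- `L` as a positive combination
    (∀ z : UpperHalfPlane, L z =
      78278400 * level2 X₈ z * A z * B z
        + 550800 * Xt₈ z * A z * B z
        + 90823680 * level2 X₁₀ z * A z
        + 116640 * Xt₁₀ z * A z
        + 678813696000 * level2 X₁₂ z * B z
        + 331776000 * Xt₁₂ z * B z) ∧
    -- positivity of the building blocks
    IsPosOnAxis A ∧
    IsPosOnAxis B ∧
    IsPosOnAxis (level2 X₈) ∧
    IsPosOnAxis (level2 X₁₀) ∧
    IsPosOnAxis (level2 X₁₂) ∧
    IsPositive Xt₈ ∧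
    IsPositive Xt₁₀ ∧
    IsPositive Xt₁₂ ∧
    -- positivity of `L` and of the Wronskian-type form
    IsPosOnAxis L ∧
    IsPosOnAxis wronskian ∧
    -- monotonicity of the quotient, its limit, and the resulting inequality
    (∀ t : ℝ, 0 < t → (onAxis F t).im = 0 ∧ 0 < onAxis G t) ∧
    StrictAntiOn
      (fun t : ℝ => (onAxis F t / onAxis G t).re)
      (Set.Ioi 0) ∧
    Filter.Tendsto (fun t : ℝ => onAxis F t / onAxis G t)
      (𝓝[>] 0) (𝓝 (432 / (Real.pi : ℂ) ^ 2)) ∧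
    (∀ t : ℝ, 0 < t →
      (onAxis F t).re <
        432 / Real.pi ^ 2 * (onAxis G t).re) := by
  exact ⟨isQuasimodular_F, isMF_G.isModular, isMF_K₁₀.isModular, isMF_K₁₂.isModular,
    isMF_K₁₄.isModular, isQuasimodular_L, isNormalizedExtremal_X₈, isNormalizedExtremal_X₁₀,
    isNormalizedExtremal_X₁₂, isQuasimodular_Xt₈, isQuasimodular_Xt₁₀, isQuasimodular_Xt₁₂,
    wronskian_eq_serreDerivative, wronskian_eq, L_eq, isPosOnAxis_A, isPosOnAxis_B,
    isPosOnAxis_level2_X₈, isPosOnAxis_level2_X₁₀, isPosOnAxis_level2_X₁₂, isPositive_Xt₈,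
    isPositive_Xt₁₀, isPositive_Xt₁₂, isPosOnAxis_L, isPosOnAxis_wronskian,
    fun t ht ↦ ⟨by rw [onAxis_F ht, Complex.ofReal_im], onAxis_G_pos ht⟩,
    strictAntiOn_axis_F_div_G.congr fun t ht ↦ by rw [onAxis_F_div_G ht, Complex.ofReal_re],
    tendsto_onAxis_F_div_G, fun t ht ↦ axis_F_lt ht⟩
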